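/- Let $d\ge 1$ and $k\ge 0$ be integers. A \emph{$d$-parking function} of length $k$ is a list $(a_1,\dots,a_k)$ of positive integers whose increasing rearrangement $a_{(1)}\le\cdots\le a_{(k)}$ satisfies $a_{(i)}\le d(i-1)+1$ for all $i$. Let $S_{d,k}$ be the set of $d$-parking functions $(a_1,\dots,a_k)$ such that $a_i\le a_{i+1}+d-1$ for all $1\le i<k$. Let $NC^d_{n}$ be the poset, ordered by refinement, of the noncrossing partitions $\pi$ of $\{1,\dots,n\}$ such that every block of $\pi$ and every block of its Kreweras dual $\pi'$ has cardinality congruent to $1$ modulo $d$. If $\pi\prec\sigma$ is a cover relation in $NC^d_n$, let $B_1,\dots,B_{d+1}$ be the blocks of $\pi$ that are joined to form a block of $\sigma$, with $\min B_1<\min B_2<\cdots<\min B_{d+1}$, and put $\lambda(\pi,\sigma)=\max\{i\in B_1 : i<\min B_2\}$ and $\lambda^*(\pi,\sigma)=|\pi|-\lambda(\pi,\sigma)$, where $|\pi|$ is the number of blocks of $\pi$. A maximal chain $\mathbf m=\{\widehat 0=\pi_0\prec\pi_1\prec\cdots\prec\pi_k=\widehat 1\}$ of $NC^d_{dk+1}$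 is \emph{falling} if $\lambda^*(\pi_{i-1},\pi_i)>\lambda^*(\pi_i,\pi_{i+1})$ for all $1\le i<k$, and its list of labels is $\lambda(\mathbf m)=(\lambda(\pi_0,\pi_1),\dots,\lambda(\pi_{k-1},\pi_k))$. Then: 1. $\displaystyle |S_{d,k}|=\frac{1}{2dk-k+1}\binom{2dk}{k}$. 2. The map $\mathbf m\mapsto\lambda(\mathbf m)$ restricts to a bijection from the set of falling maximal chains of $NC^d_{dk+1}$ onto $S_{d,k}$. 3. $|S_{d,k}|=|\mu(NC^d_{dk+1})|$, where $\mu(P)=\mu_P(\widehat 0,\widehat 1)$ is the Möbius function of a finite bounded poset $P$. -/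

import Mathlib

open Finset

namespace IndivNC

/-- A partition of `[n] = {1, …, n}` is noncrossing if no two different blocks `B`, `C` admit
`i < j < k < l` with `i, k ∈ B` and `j, l ∈ C`. -/
def IsNoncrossing {n : ℕ} (π : Finpartition (Icc 1 n)) : Prop :=
  ∀ B ∈ π.parts, ∀ C ∈ π.parts, B ≠ C →
    ¬ ∃ i j k l : ℕ, i < j ∧ j < k ∧ k < l ∧ i ∈ B ∧ k ∈ B ∧ j ∈ C ∧ l ∈ C

/-- Place `i'` between `i` and `i + 1` on the circle. The primed points `i'` and `j'` lie in the
same region (of the complement of the convex hulls of the blocks of `π`) when the chord from `i'`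
to `j'` separates no block of `π`: any two elements of a block are on the same side of the chord.
One side of the chord consists of the `x` with `min i j < x ≤ max i j`, the other of the rest. -/
def dualSetoid {n : ℕ} (π : Finpartition (Icc 1 n)) : Setoid ℕ where
  r i j := ∀ B ∈ π.parts, ∀ x ∈ B, ∀ y ∈ B, (x ∈ Set.uIoc i j ↔ y ∈ Set.uIoc i j)
  iseqv :=
    { refl := by intro i B _ x _ y _; simp
      symm := by
        intro i j h B hB x hx y hy
        simpa only [Set.uIoc_comm] using h B hB x hx y hy
      trans := by
        intro i j k h₁ h₂ B hB x hx y hy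
        have e₁ := h₁ B hB x hx y hy
        have e₂ := h₂ B hB x hx y hy
        simp only [Set.mem_uIoc] at *
        omega }

open Classical in
/-- The Kreweras dual of a noncrossing partition; the primed point `i'` is written as `i`. -/
noncomputable def krewerasDual {n : ℕ} (π : Finpartition (Icc 1 n)) : Finpartition (Icc 1 n) :=
  Finpartition.ofSetSetoid (dualSetoid π) (Icc 1 n)

/-- `π` is a `d`-indivisible noncrossing partition. -/
def IsIndivisible (d : ℕ) {n : ℕ} (π : Finpartition (Icc 1 n)) : Prop :=
  IsNoncrossing π ∧ (∀ B ∈ π.parts, #B ≡ 1 [MOD d]) ∧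
    ∀ C ∈ (krewerasDual π).parts, #C ≡ 1 [MOD d]

/-- The poset of `d`-indivisible noncrossing partitions of `[n]`, ordered by refinement (the order
that it inherits from `Finpartition`). -/
abbrev NC (d n : ℕ) : Type := {π : Finpartition (Icc 1 n) // IsIndivisible d π}

noncomputable instance (d n : ℕ) : LocallyFiniteOrder (NC d n) := by
  classical
  haveI : Fintype (NC d n) := Fintype.ofFinite _
  exact Fintype.toLocallyFiniteOrder

theorem isIndivisible_bot (d k : ℕ) :
    IsIndivisible d (⊥ : Finpartition (Icc 1 (d * k + 1))) := by
  classical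
  refine ⟨?_, ?_, ?_⟩
  · rintro B hB C hC hne ⟨i, j, k, l, hij, hjk, hkl, hi, hk, hj, hl⟩
    obtain ⟨a, -, rfl⟩ := Finpartition.mem_bot_iff.1 hB
    simp only [mem_singleton] at hi hk
    omega
  · intro B hB
    obtain ⟨a, -, rfl⟩ := Finpartition.mem_bot_iff.1 hB
    simp [Nat.ModEq]
  · intro C hC
    simp only [krewerasDual, Finpartition.ofSetSetoid_parts, mem_image] at hC
    obtain ⟨a, -, rfl⟩ := hC
    have h : ({b ∈ Icc 1 (d * k + 1) | (dualSetoid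
        (⊥ : Finpartition (Icc 1 (d * k + 1)))).r a b} : Finset ℕ) = Icc 1 (d * k + 1) := by
      refine filter_true_of_mem fun b _ B hB x hx y hy => ?_
      obtain ⟨c, -, rfl⟩ := Finpartition.mem_bot_iff.1 hB
      simp only [mem_singleton] at hx hy
      rw [hx, hy]
    rw [h]
    simp [Nat.ModEq]

theorem Icc_ne_bot (d k : ℕ) : Icc 1 (d * k + 1) ≠ ⊥ := by
  simp

theorem isIndivisible_indiscrete (d k : ℕ) :
    IsIndivisible d (Finpartition.indiscrete (Icc_ne_bot d k)) := by
  classical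
  refine ⟨?_, ?_, ?_⟩
  · intro B hB C hC hne
    simp only [Finpartition.indiscrete_parts, mem_singleton] at hB hC
    exact absurd (hB.trans hC.symm) hne
  · intro B hB
    simp only [Finpartition.indiscrete_parts, mem_singleton] at hB
    subst hB
    simp [Nat.ModEq]
  · intro C hC
    simp only [krewerasDual, Finpartition.ofSetSetoid_parts, mem_image] at hC
    obtain ⟨a, ha, rfl⟩ := hC
    have h : ({b ∈ Icc 1 (d * k + 1) | (dualSetoid
        (Finpartition.indiscrete (Icc_ne_bot d k))).r a b} : Finset ℕ) = {a} := by
      ext b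
      simp only [mem_filter, mem_singleton]
      constructor
      · rintro ⟨hb, hab⟩
        have h₁ := hab _ (by rw [Finpartition.indiscrete_parts, mem_singleton]) a ha b hb
        have h₂ := hab _ (by rw [Finpartition.indiscrete_parts, mem_singleton]) 1 (by simp) (max a b)
          (by simp only [mem_Icc] at *; omega)
        simp only [Set.mem_uIoc, mem_Icc] at *
        omega
      · rintro rfl
        exact ⟨ha, (dualSetoid _).refl _⟩
    rw [h]
    simp [Nat.ModEq]

/-- `0̂` is the partition into singletons and `1̂` the partition with one block. -/
instance (d k : ℕ) : BoundedOrder (NC d (d * k + 1)) where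
  bot := ⟨⊥, isIndivisible_bot d k⟩
  bot_le π := (bot_le : (⊥ : Finpartition (Icc 1 (d * k + 1))) ≤ π.1)
  top := ⟨Finpartition.indiscrete (Icc_ne_bot d k), isIndivisible_indiscrete d k⟩
  le_top π := fun B hB => ⟨Icc 1 (d * k + 1), by simp [Finpartition.indiscrete_parts],
    π.1.le hB⟩

/-- The set `{min B₁, …, min B_r}`, where `B₁, …, B_r` are the blocks of `π` that are joined with
others on passing to `σ`, that is, the blocks of `π` that are not blocks of `σ`. -/
noncomputable def joinedMins {n : ℕ} (π σ : Finpartition (Icc 1 n)) : Finset ℕ :=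
  (π.parts \ σ.parts).image fun B : Finset ℕ => sInf (B : Set ℕ)

/-- The edge label `λ(π, σ)` of a cover relation `π ⋖ σ`: if `B₁, B₂, …` are the joined blocks and
`min B₁ < min B₂ < ⋯`, this is `max {i ∈ B₁ : i < min B₂}`. -/
noncomputable def edgeLabel {n : ℕ} (π σ : Finpartition (Icc 1 n)) : ℕ :=
  let m₁ := sInf (joinedMins π σ : Set ℕ)
  let m₂ := sInf ((joinedMins π σ).erase m₁ : Set ℕ)
  ((π.part m₁).filter (· < m₂)).sup id

/-- The edge label `λ*(π, σ) = |π| - λ(π, σ)`. -/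
noncomputable def edgeLabelStar {n : ℕ} (π σ : Finpartition (Icc 1 n)) : ℤ :=
  (#π.parts : ℤ) - edgeLabel π σ

/-- The maximal chains `0̂ = x₀ ⋖ x₁ ⋖ ⋯ ⋖ x_r = 1̂`, of any length `r`, of a bounded poset. -/
abbrev MaximalChain (P : Type) [PartialOrder P] [BoundedOrder P] : Type :=
  {c : RelSeries ({p | p.1 ⋖ p.2} : SetRel P P) // c.head = ⊥ ∧ c.last = ⊤}

/-- The list `λ(m) = (λ(π₀, π₁), λ(π₁, π₂), …, λ(π_{r-1}, π_r))` of labels of a maximal chain. -/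
noncomputable def chainLabels {d k : ℕ} (c : MaximalChain (NC d (d * k + 1))) : List ℕ :=
  List.ofFn fun i : Fin c.1.length => edgeLabel (c.1 i.castSucc).1 (c.1 i.succ).1

/-- The list of labels `λ*(π₀, π₁), …, λ*(π_{r-1}, π_r)` of a maximal chain. -/
noncomputable def chainLabelsStar {d k : ℕ} (c : MaximalChain (NC d (d * k + 1))) : List ℤ :=
  List.ofFn fun i : Fin c.1.length => edgeLabelStar (c.1 i.castSucc).1 (c.1 i.succ).1

/-- A maximal chain is falling if its labels `λ*` are strictly decreasing from step to step. -/
def IsFalling {d k : ℕ} (c : MaximalChain (NC d (d * k + 1))) : Prop :=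
  (chainLabelsStar c).IsChain (· > ·)

/-- A `d`-parking function: a list of positive integers whose increasing rearrangement satisfies
`a_{(i)} ≤ d (i - 1) + 1` for all `i` (the index is shifted by one in the code). -/
def IsParkingFunction (d : ℕ) (a : List ℕ) : Prop :=
  (∀ x ∈ a, 0 < x) ∧
    ∀ (i : ℕ) (hi : i < (a.insertionSort (· ≤ ·)).length),
      (a.insertionSort (· ≤ ·))[i] ≤ d * i + 1

/-- The `d`-parking functions `(a₁, …, a_k)` with `a_i ≤ a_{i+1} + d - 1` for `1 ≤ i < k`. -/
def restrictedParkingFunctions (d k : ℕ) : Set (List ℕ) :=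
  {a | a.length = k ∧ IsParkingFunction d a ∧
    ∀ (i : ℕ) (hi : i + 1 < a.length), a[i] ≤ a[i + 1] + d - 1}

end IndivNC

/-! ### Indivisibility as congruences inside the blocks -/

namespace IndivNC

/-! Structure of the poset. For `n ≡ 1` modulo `d`, the conditions on a noncrossing partition and on
its Kreweras dual amount to conditions on single blocks: each block has size `≡ 1`, and consecutive
elements of a block differ by `1` modulo `d` (`isIndivisible_iff`). Covers then become explicit: one
block `S` of the upper partition is cut at elements `e 0 < ⋯ < e d` of `S` into the `d` pieces
between successive cut points and the rest, and the label is `e 0` (`exists_split_of_covBy`,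
`edgeLabel_of_split`). Each cover changes the number of blocks by exactly `d`.

The bijection. Give `b` the weight `d * (multiplicity of b in w) - 1`, and call `w` compatible with
a partition if on every block the partial sums stay nonnegative until the last element, where the
total becomes `-1`. Going up a cover with label `c` and appending `c` to `w` preserves
compatibility. Conversely, deleting a last letter `c` lowers the path on the block of `c` by `d`
after `c`, and the first passages to the next `d` lower levels are the only possible further cut
points. So maximal chains correspond to words compatible with the top, which are the `d`-parking
functions. Since the number of blocks drops by `d` at each step, falling means `a_i < a_{i+1} + d`.

The count. Call words with `a_i < a_{i+1} + d` falling. Those over `{1, …, n}` have generating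
function `1 / D_n`, with `D_{t+1} = D_t - X D_{t+1-d}`. Cutting a falling word at the first failure
of the parking condition gives a parking word followed by a shifted falling word. With `g = 1 + X g
^ d`, the products `D_t g ^ t` converge `X`-adically, and in the limit the decomposition reads `∑
p_i (X g ^ (-d)) ^ i = g`, where `p_i` counts the parking words of length `i`. As `g = 1 + (X g ^
(-d)) g ^ (2 d)`, the `p_i` are the Raney numbers with parameter `2 d` (`card_parkingWords`).

The Möbius function. The value `μ(0̂, π)` is a product over the blocks of `π`, a block of size `d j
+ 1` contributing `(-1) ^ j` times the `j`-th of these Raney numbers. To verify this, sum the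
product over all refinements of `σ`. The sum factors over the blocks of `σ`, and each factor depends
only on the size of the block; its generating function by size is `1 / (1 - X K)` with `K = 1 - X ^
d K ^ d`. Among the exponents `≡ 1` modulo `d`, only `1` has a nonzero coefficient
(`sum_goodFamilies_eq`). -/

/-- In the set `B`, the rank difference of two elements is congruent to their difference. -/
def GoodSet (d : ℕ) (B : Finset ℕ) : Prop :=
  ∀ x ∈ B, ∀ y ∈ B, x ≤ y → ((#{z ∈ B | x ≤ z ∧ z < y} : ℕ) : ZMod d) = y - x

/-- `P` is the set of blocks of a noncrossing partition of `s`. -/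
structure IsNCFamily (s : Finset ℕ) (P : Finset (Finset ℕ)) : Prop where
  nonempty : ∀ B ∈ P, B.Nonempty
  eq_of_mem : ∀ B ∈ P, ∀ C ∈ P, ∀ x, x ∈ B → x ∈ C → B = C
  mem_iff : ∀ x, x ∈ s ↔ ∃ B ∈ P, x ∈ B
  noncrossing : ∀ B ∈ P, ∀ C ∈ P, ∀ i j k l, i ∈ B → j ∈ C → k ∈ B → l ∈ C →
    i < j → j < k → k < l → B = C

/-- `P` is the set of blocks of a noncrossing partition of `s` all of whose blocks are good sets
of cardinality congruent to one. -/
structure IsGoodFamily (d : ℕ) (s : Finset ℕ) (P : Finset (Finset ℕ)) : Prop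
    extends IsNCFamily s P where
  card : ∀ B ∈ P, ((#B : ℕ) : ZMod d) = 1
  good : ∀ B ∈ P, GoodSet d B

/-- The interval `(a, c]` is a union of blocks. -/
def IsSaturated (P : Finset (Finset ℕ)) (a c : ℕ) : Prop :=
  ∀ B ∈ P, ∀ x ∈ B, ∀ y ∈ B, (a < x ∧ x ≤ c ↔ a < y ∧ y ≤ c)

theorem isNCFamily_parts_iff {s : Finset ℕ} (P : Finpartition s) :
    IsNCFamily s P.parts ↔ ∀ B ∈ P.parts, ∀ C ∈ P.parts, B ≠ C →
    ¬ ∃ i j k l : ℕ, i < j ∧ j < k ∧ k < l ∧ i ∈ B ∧ k ∈ B ∧ j ∈ C ∧ l ∈ C := by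
  constructor
  · rintro h B hB C hC hne ⟨i, j, k, l, h1, h2, h3, hi, hk, hj, hl⟩
    exact hne (h.noncrossing B hB C hC i j k l hi hj hk hl h1 h2 h3)
  · intro h
    refine ⟨fun B hB => P.nonempty_of_mem_parts hB,
      fun B hB C hC x hx hx' => P.eq_of_mem_parts hB hC hx hx', fun x => ?_, ?_⟩
    · exact ⟨fun hx => P.exists_mem hx, fun ⟨B, hB, hx⟩ => P.le hB hx⟩
    · intro B hB C hC i j k l hi hj hk hl h1 h2 h3
      by_contra hne
      exact h B hB C hC hne ⟨i, j, k, l, h1, h2, h3, hi, hk, hj, hl⟩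

/-- A block that enters the gap between two neighbours of `B` cannot leave it without crossing `B`.
The right end is `y - 1` because saturated intervals are half-open. -/
theorem IsNCFamily.isSaturated_gap {s : Finset ℕ} {P : Finset (Finset ℕ)} (hP : IsNCFamily s P)
    {B : Finset ℕ} (hB : B ∈ P) {x y : ℕ} (hx : x ∈ B) (hy : y ∈ B)
    (hxy : ∀ z ∈ B, ¬ (x < z ∧ z < y)) : IsSaturated P x (y - 1) := by
  have key : ∀ C ∈ P, ∀ u ∈ C, ∀ v ∈ C, x < u ∧ u ≤ y - 1 → x < v ∧ v ≤ y - 1 := by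
    intro C hC u hu v hv huv
    have hCB : B ≠ C := by
      rintro rfl
      exact hxy u hu ⟨huv.1, by omega⟩
    have hvx : v ≠ x := by
      rintro rfl
      exact hCB (hP.eq_of_mem B hB C hC _ hx hv)
    have hvy : v ≠ y := by
      rintro rfl
      exact hCB (hP.eq_of_mem B hB C hC _ hy hv)
    by_contra hcon
    rcases lt_or_ge v x with h | h
    · exact hCB (hP.noncrossing C hC B hB v x u y hv hx hu hy h huv.1 (by omega)).symm
    · exact hCB (hP.noncrossing B hB C hC x u y v hx hu hy hv huv.1 (by omega) (by omega))
  exact fun C hC u hu v hv => ⟨key C hC u hu v hv, key C hC v hv u hu⟩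

theorem IsNCFamily.isSaturated_hull {s : Finset ℕ} {P : Finset (Finset ℕ)} (hP : IsNCFamily s P)
    {B : Finset ℕ} (hB : B ∈ P) {a x y : ℕ} (hx : x ∈ B) (hy : y ∈ B) (hax : x = a + 1)
    (hxy : ∀ z ∈ B, x ≤ z ∧ z ≤ y) : IsSaturated P a y := by
  have key : ∀ C ∈ P, ∀ u ∈ C, ∀ v ∈ C, a < u ∧ u ≤ y → a < v ∧ v ≤ y := by
    intro C hC u hu v hv huv
    by_cases hCB : B = C
    · subst hCB
      have := hxy v hv
      omega
    have hne : ∀ w ∈ C, w ≠ x ∧ w ≠ y := by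
      refine fun w hw => ⟨?_, ?_⟩
      · rintro rfl
        exact hCB (hP.eq_of_mem B hB C hC _ hx hw)
      · rintro rfl
        exact hCB (hP.eq_of_mem B hB C hC _ hy hw)
    have h1 := hne u hu
    have h2 := hne v hv
    by_contra hcon
    rcases lt_or_ge v x with h | h
    · exact hCB (hP.noncrossing C hC B hB v x u y hv hx hu hy h (by omega) (by omega)).symm
    · exact hCB (hP.noncrossing B hB C hC x u y v hx hu hy hv (by omega) (by omega) (by omega))
  exact fun C hC u hu v hv => ⟨key C hC u hu v hv, key C hC v hv u hu⟩

theorem GoodSet.card_eq {d : ℕ} {B : Finset ℕ} (h : GoodSet d B) {x y : ℕ} (hx : x ∈ B)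
    (hy : y ∈ B) (hxy : ∀ z ∈ B, x ≤ z ∧ z ≤ y) : ((#B : ℕ) : ZMod d) = y - x + 1 := by
  have h1 := h x hx y hy (hxy x hx).2
  have h2 : B = insert y {z ∈ B | x ≤ z ∧ z < y} := by
    ext z
    simp only [mem_insert, mem_filter]
    constructor
    · intro hz
      have := hxy z hz
      by_cases h : z = y
      · exact Or.inl h
      · exact Or.inr ⟨hz, by omega⟩
    · rintro (rfl | h)
      · exact hy
      · exact h.1
  rw [h2, card_insert_of_notMem (by simp)]
  push_cast
  rw [h1]

open Classical in
/-- The number of places at which a saturated interval can be cut is determined modulo `d`. -/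
theorem IsNCFamily.card_cuts {d : ℕ} {s : Finset ℕ} {P : Finset (Finset ℕ)} (hP : IsNCFamily s P)
    {c : ℕ} : ∀ {a : ℕ}, a ≤ c → Ioc a c ⊆ s → IsSaturated P a c →
    (∀ B ∈ P, B ⊆ Ioc a c → ((#B : ℕ) : ZMod d) = 1 ∧ GoodSet d B) →
    ((#{z ∈ Ioc a c | IsSaturated P a z} : ℕ) : ZMod d) = c - a := by
  suffices H : ∀ N a : ℕ, c - a ≤ N → a ≤ c → Ioc a c ⊆ s → IsSaturated P a c →
      (∀ B ∈ P, B ⊆ Ioc a c → ((#B : ℕ) : ZMod d) = 1 ∧ GoodSet d B) →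
      ((#{z ∈ Ioc a c | IsSaturated P a z} : ℕ) : ZMod d) = c - a from
    fun {a} => H (c - a) a le_rfl
  intro N
  induction N with
  | zero =>
    intro a h1 h2 _ _ _
    have : a = c := by omega
    subst this
    simp
  | succ N ih =>
    intro a h1 h2 hs hsat hg
    rcases h2.eq_or_lt with rfl | hlt
    · simp
    -- Peel off the block of `a + 1`: its maximum `m` is the first cut, and goodness together with
    -- `#B ≡ 1` gives `m - a ≡ 1`. One cut thus accounts for a length `≡ 1`.
    obtain ⟨B, hB, haB⟩ := (hP.mem_iff (a + 1)).1 (hs (by simp; omega))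
    have hBsub : ∀ z ∈ B, a < z ∧ z ≤ c := fun z hz =>
      (hsat B hB (a + 1) haB z hz).1 (by omega)
    obtain ⟨m, hm⟩ : ∃ m, m = B.max' ⟨_, haB⟩ := ⟨_, rfl⟩
    have hmB : m ∈ B := hm ▸ max'_mem _ _
    have hle : ∀ z ∈ B, z ≤ m := fun z hz => hm ▸ le_max' _ _ hz
    have hsm : IsSaturated P a m := hP.isSaturated_hull hB haB hmB rfl
      fun z hz => ⟨(hBsub z hz).1, hle z hz⟩
    have hmc := hBsub m hmB
    have hsat' : IsSaturated P m c := by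
      intro C hC u hu v hv
      have e1 := hsat C hC u hu v hv
      have e2 := hsm C hC u hu v hv
      omega
    obtain ⟨hc1, hc2⟩ := hg B hB fun z hz => mem_Ioc.2 (hBsub z hz)
    have e3 := hc2.card_eq haB hmB fun z hz => ⟨(hBsub z hz).1, hle z hz⟩
    have e4 := ih m (by omega) hmc.2 ((Ioc_subset_Ioc_left hmc.1.le).trans hs) hsat'
      fun C hC hCs => hg C hC (hCs.trans (Ioc_subset_Ioc_left hmc.1.le))
    have e5 : ({z ∈ Ioc a c | IsSaturated P a z} : Finset ℕ) =
        insert m {z ∈ Ioc m c | IsSaturated P m z} := by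
      ext z
      simp only [mem_insert, mem_filter, mem_Ioc]
      constructor
      · rintro ⟨hz, hz'⟩
        have := (hz' B hB (a + 1) haB m hmB).1 (by omega)
        rcases this.2.eq_or_lt with h | h
        · exact Or.inl h.symm
        · refine Or.inr ⟨⟨h, hz.2⟩, fun C hC u hu v hv => ?_⟩
          have e1 := hz' C hC u hu v hv
          have e2 := hsm C hC u hu v hv
          omega
      · rintro (rfl | ⟨hz, hz'⟩)
        · exact ⟨hmc, hsm⟩
        · refine ⟨by omega, fun C hC u hu v hv => ?_⟩
          have e1 := hz' C hC u hu v hv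
          have e2 := hsm C hC u hu v hv
          omega
    rw [e5, card_insert_of_notMem (by simp)]
    push_cast at e3 ⊢
    rw [e4]
    rw [hc1] at e3
    linear_combination e3

theorem goodSet_of_consecutive {d : ℕ} {B : Finset ℕ}
    (h : ∀ x ∈ B, ∀ y ∈ B, x < y → (∀ z ∈ B, ¬ (x < z ∧ z < y)) → (y : ZMod d) = x + 1) :
    GoodSet d B := by
  suffices H : ∀ N : ℕ, ∀ x ∈ B, ∀ y ∈ B, x ≤ y → #{z ∈ B | x ≤ z ∧ z < y} = N →
      ((#{z ∈ B | x ≤ z ∧ z < y} : ℕ) : ZMod d) = y - x from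
    fun x hx y hy hxy => H _ x hx y hy hxy rfl
  intro N
  induction N with
  | zero =>
    intro x hx y hy hxy h0
    have : x = y := by
      by_contra hne
      have : x ∈ ({z ∈ B | x ≤ z ∧ z < y} : Finset ℕ) := by simp [hx]; omega
      rw [card_eq_zero.1 h0] at this
      simp at this
    rw [h0, this]
    simp
  | succ N ih =>
    intro x hx y hy hxy h0
    have hne : ({z ∈ B | x ≤ z ∧ z < y} : Finset ℕ).Nonempty := by
      rw [← card_pos]; omega
    obtain ⟨m, hm⟩ : ∃ m, m = ({z ∈ B | x ≤ z ∧ z < y} : Finset ℕ).max' hne := ⟨_, rfl⟩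
    have hmm := hm ▸ max'_mem _ hne
    have hmax : ∀ z ∈ B, x ≤ z → z < y → z ≤ m := fun z hz h1 h2 =>
      hm ▸ le_max' _ _ (mem_filter.2 ⟨hz, h1, h2⟩)
    rw [mem_filter] at hmm
    have e : ({z ∈ B | x ≤ z ∧ z < y} : Finset ℕ) = insert m {z ∈ B | x ≤ z ∧ z < m} := by
      ext z
      simp only [mem_insert, mem_filter]
      constructor
      · rintro ⟨h1, h2, h3⟩
        have := hmax z h1 h2 h3
        by_cases hz : z = m
        · exact Or.inl hz
        · exact Or.inr ⟨h1, h2, by omega⟩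
      · rintro (rfl | ⟨h1, h2, h3⟩)
        · exact hmm
        · exact ⟨h1, h2, by omega⟩
    rw [e, card_insert_of_notMem (by simp)] at h0 ⊢
    have e1 := ih x hx m hmm.1 hmm.2.1 (by omega)
    have e2 := h m hmm.1 y hy hmm.2.2 fun z hz hz' => by
      have := hmax z hz (by omega) hz'.2
      omega
    push_cast
    rw [e1, e2]
    ring

theorem GoodSet.consecutive {d : ℕ} {B : Finset ℕ} (h : GoodSet d B) {x y : ℕ} (hx : x ∈ B)
    (hy : y ∈ B) (hxy : x < y) (hz : ∀ z ∈ B, ¬ (x < z ∧ z < y)) : (y : ZMod d) = x + 1 := by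
  have h1 := h x hx y hy hxy.le
  have : ({z ∈ B | x ≤ z ∧ z < y} : Finset ℕ) = {x} := by
    ext z
    simp only [mem_filter, mem_singleton]
    constructor
    · rintro ⟨h1, h2, h3⟩
      have := hz z h1
      omega
    · rintro rfl
      exact ⟨hx, le_rfl, hxy⟩
  rw [this] at h1
  push_cast [card_singleton] at h1
  linear_combination -h1

theorem isSaturated_iff_dualSetoid {n : ℕ} (π : Finpartition (Icc 1 n)) {i j : ℕ} (hij : i ≤ j) :
    IsSaturated π.parts i j ↔ (dualSetoid π).r i j := by
  change _ ↔ ∀ B ∈ π.parts, ∀ x ∈ B, ∀ y ∈ B, (x ∈ Set.uIoc i j ↔ y ∈ Set.uIoc i j)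
  simp only [IsSaturated, Set.uIoc_of_le hij, Set.mem_Ioc]

open Classical in
theorem mem_krewerasDual {n : ℕ} (π : Finpartition (Icc 1 n)) (C : Finset ℕ) :
    C ∈ (krewerasDual π).parts ↔ ∃ a ∈ Icc 1 n, ({b ∈ Icc 1 n | (dualSetoid π).r a b}) = C := by
  simp only [krewerasDual, Finpartition.ofSetSetoid_parts, mem_image]

open Classical in
-- Let `x` be the least element of the dual block. The other elements are the cuts of a saturated
-- interval `(x, y]`, so by `card_cuts` their number is `≡ y - x`; it remains to find `y` with `y ≡
-- x`.
theorem IsGoodFamily.card_dual {d n : ℕ} (π : Finpartition (Icc 1 n)) (hn : (n : ZMod d) = 1)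
    (h : IsGoodFamily d (Icc 1 n) π.parts) {a : ℕ} (ha : a ∈ Icc 1 n) :
    ((#{b ∈ Icc 1 n | (dualSetoid π).r a b} : ℕ) : ZMod d) = 1 := by
  set C := ({b ∈ Icc 1 n | (dualSetoid π).r a b} : Finset ℕ) with hC
  have haC : a ∈ C := mem_filter.2 ⟨ha, (dualSetoid π).refl a⟩
  obtain ⟨x, hx⟩ : ∃ x, x = C.min' ⟨_, haC⟩ := ⟨_, rfl⟩
  have hxC : x ∈ C := hx ▸ min'_mem _ _
  have hmin : ∀ z ∈ C, x ≤ z := fun z hz => hx ▸ min'_le _ _ hz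
  have hxn := (mem_filter.1 hxC).1
  have hC' : ∀ z ∈ Icc 1 n, z ∈ C ↔ (dualSetoid π).r x z := fun z hz => by
    rw [hC, mem_filter]
    have h1 := (mem_filter.1 hxC).2
    exact ⟨fun h => (dualSetoid π).trans ((dualSetoid π).symm h1) h.2,
      fun h => ⟨hz, (dualSetoid π).trans h1 h⟩⟩
  have hfin : ∀ y, x ≤ y → y ≤ n → IsSaturated π.parts x y →
      (∀ z, y < z → z ≤ n → ¬ IsSaturated π.parts x z) → (y : ZMod d) = x →
      ((#C : ℕ) : ZMod d) = 1 := by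
    intro y hxy hyn hsat hmax hmod
    have e := h.card_cuts (d := d) hxy (fun z hz => by simp at *; omega) hsat
      fun B hB _ => ⟨h.card B hB, h.good B hB⟩
    have : C = insert x {z ∈ Ioc x y | IsSaturated π.parts x z} := by
      ext z
      simp only [mem_insert, mem_filter, mem_Ioc]
      constructor
      · intro hz
        have h1 := hmin z hz
        have h2 := (mem_filter.1 hz).1
        rcases h1.eq_or_lt with h3 | h3
        · exact Or.inl h3.symm
        have h4 := (isSaturated_iff_dualSetoid π h1).2 ((hC' z h2).1 hz)
        refine Or.inr ⟨⟨h3, ?_⟩, h4⟩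
        by_contra hcon
        exact hmax z (by omega) (mem_Icc.1 h2).2 h4
      · rintro (rfl | ⟨h1, h2⟩)
        · exact hxC
        · exact (hC' z (by simp at *; omega)).2 ((isSaturated_iff_dualSetoid π h1.1.le).1 h2)
    rw [this, card_insert_of_notMem (by simp)]
    push_cast
    rw [e, hmod]
    ring
  obtain ⟨B, hB, hxB⟩ := (h.mem_iff x).1 hxn
  have hBn : ∀ z ∈ B, z ∈ Icc 1 n := fun z hz => (h.mem_iff z).2 ⟨B, hB, hz⟩
  -- If `x` has a successor in its block, the interval stops just before that successor. Otherwise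
  -- `x` is the maximum of its block, minimality of `x` forces this block to start at `1`, and the
  -- interval runs up to `n`.
  by_cases hne : ({z ∈ B | x < z} : Finset ℕ).Nonempty
  · obtain ⟨y, hy⟩ : ∃ y, y = ({z ∈ B | x < z} : Finset ℕ).min' hne := ⟨_, rfl⟩
    have hyB := mem_filter.1 (hy ▸ min'_mem _ hne)
    have hcons : ∀ z ∈ B, ¬ (x < z ∧ z < y) := fun z hz hz' => by
      have : y ≤ z := hy ▸ min'_le _ _ (mem_filter.2 ⟨hz, hz'.1⟩)
      omega
    have hmod := (h.good B hB).consecutive hxB hyB.1 hyB.2 hcons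
    have hyn := mem_Icc.1 (hBn y hyB.1)
    refine hfin (y - 1) (by omega) (by omega) (h.isSaturated_gap hB hxB hyB.1 hcons) ?_ ?_
    · intro z h1 h2 h3
      have := (h3 B hB x hxB y hyB.1)
      omega
    · rw [Nat.cast_sub (by omega), hmod]
      simp
  · have hmax : ∀ z ∈ B, z ≤ x := fun z hz => by
      by_contra hcon
      exact hne ⟨z, mem_filter.2 ⟨hz, by omega⟩⟩
    obtain ⟨b, hb⟩ : ∃ b, b = B.min' ⟨_, hxB⟩ := ⟨_, rfl⟩
    have hbB : b ∈ B := hb ▸ min'_mem _ _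
    have hbmin : ∀ z ∈ B, b ≤ z := fun z hz => hb ▸ min'_le _ _ hz
    have hbn := mem_Icc.1 (hBn b hbB)
    have hsat := h.isSaturated_hull (a := b - 1) hB hbB hxB (by omega)
      fun z hz => ⟨hbmin z hz, hmax z hz⟩
    have hbx := hbmin x hxB
    have hb1 : b = 1 := by
      by_contra hb1
      have hr := (isSaturated_iff_dualSetoid π (by omega)).1 hsat
      have := hmin (b - 1) ((hC' (b - 1) (by simp; omega)).2 ((dualSetoid π).symm hr))
      omega
    subst hb1
    have e1 := (h.good B hB).card_eq hbB hxB fun z hz => ⟨hbmin z hz, hmax z hz⟩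
    rw [h.card B hB] at e1
    refine hfin n (mem_Icc.1 hxn).2 le_rfl ?_ (fun z h1 h2 => by omega) ?_
    · intro D hD u hu v hv
      have h1 := hsat D hD u hu v hv
      have h2 := mem_Icc.1 ((h.mem_iff u).2 ⟨D, hD, hu⟩)
      have h3 := mem_Icc.1 ((h.mem_iff v).2 ⟨D, hD, hv⟩)
      omega
    · rw [hn]
      push_cast at e1
      linear_combination e1

open Classical in
-- Induction on the gap `y - x` between neighbours of a block: blocks inside the gap have smaller
-- gaps, hence are good, so the cuts of `(x, y - 1]` can be counted modulo `d`. Together with `x`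
-- they form the dual block of `x`, and its size `≡ 1` gives `y ≡ x + 1`.
theorem IsNCFamily.goodSet_of_card_dual {d n : ℕ} (π : Finpartition (Icc 1 n))
    (h : IsNCFamily (Icc 1 n) π.parts) (hcard : ∀ B ∈ π.parts, ((#B : ℕ) : ZMod d) = 1)
    (hdual : ∀ a ∈ Icc 1 n, ((#{b ∈ Icc 1 n | (dualSetoid π).r a b} : ℕ) : ZMod d) = 1) :
    ∀ B ∈ π.parts, GoodSet d B := by
  suffices H : ∀ N : ℕ, ∀ B ∈ π.parts, ∀ x ∈ B, ∀ y ∈ B, x < y → y - x < N →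
      (∀ z ∈ B, ¬ (x < z ∧ z < y)) → (y : ZMod d) = x + 1 from
    fun B hB => goodSet_of_consecutive fun x hx y hy hxy hz =>
      H (y - x + 1) B hB x hx y hy hxy (by omega) hz
  intro N
  induction N with
  | zero => intros; omega
  | succ N ih =>
    intro B hB x hx y hy hxy hN hcons
    have hBn : ∀ z ∈ B, 1 ≤ z ∧ z ≤ n := fun z hz => mem_Icc.1 ((h.mem_iff z).2 ⟨B, hB, hz⟩)
    have hxn := hBn x hx
    have hyn := hBn y hy
    have hsat := h.isSaturated_gap hB hx hy hcons
    have e1 := h.card_cuts (d := d) (a := x) (c := y - 1) (by omega)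
      (fun z hz => by simp at *; omega) hsat fun C hC hCs => ⟨hcard C hC,
        goodSet_of_consecutive fun u hu v hv huv hz => ih C hC u hu v hv huv (by
          have h1 := mem_Ioc.1 (hCs hu)
          have h2 := mem_Ioc.1 (hCs hv)
          omega) hz⟩
    have e2 := hdual x (mem_Icc.2 hxn)
    have : ({b ∈ Icc 1 n | (dualSetoid π).r x b} : Finset ℕ) =
        insert x {z ∈ Ioc x (y - 1) | IsSaturated π.parts x z} := by
      ext z
      simp only [mem_insert, mem_filter, mem_Ioc, mem_Icc]
      constructor
      · rintro ⟨h1, h2⟩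
        rcases lt_trichotomy z x with h3 | h3 | h3
        · have := (isSaturated_iff_dualSetoid π h3.le).2 ((dualSetoid π).symm h2) B hB x hx y hy
          omega
        · exact Or.inl h3
        · have h4 := (isSaturated_iff_dualSetoid π h3.le).2 h2
          have := h4 B hB x hx y hy
          exact Or.inr ⟨by omega, h4⟩
      · rintro (rfl | ⟨h1, h2⟩)
        · exact ⟨hxn, (dualSetoid π).refl z⟩
        · exact ⟨by omega, (isSaturated_iff_dualSetoid π h1.1.le).1 h2⟩
    rw [this, card_insert_of_notMem (by simp)] at e2
    push_cast [Nat.cast_sub (show 1 ≤ y by omega)] at e1 e2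
    rw [e1] at e2
    linear_combination e2

theorem isIndivisible_iff {d n : ℕ} (hn : (n : ZMod d) = 1) (π : Finpartition (Icc 1 n)) :
    IsIndivisible d π ↔ IsGoodFamily d (Icc 1 n) π.parts := by
  classical
  have hmod : ∀ m : ℕ, m ≡ 1 [MOD d] ↔ (m : ZMod d) = 1 := fun m => by
    rw [← ZMod.natCast_eq_natCast_iff, Nat.cast_one]
  simp only [IsIndivisible, hmod]
  constructor
  · rintro ⟨h1, h2, h3⟩
    have h := (isNCFamily_parts_iff π).2 h1
    exact ⟨h, h2, h.goodSet_of_card_dual π h2 fun a ha =>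
      h3 _ ((mem_krewerasDual π _).2 ⟨a, ha, rfl⟩)⟩
  · intro h
    refine ⟨(isNCFamily_parts_iff π).1 h.toIsNCFamily, h.card, fun C hC => ?_⟩
    obtain ⟨a, ha, rfl⟩ := (mem_krewerasDual π _).1 hC
    exact h.card_dual π hn ha

end IndivNC

/-! ### Splitting a block into `d + 1` arcs -/

namespace IndivNC

/-- The parts into which the cut points `e 0 < e 1 < ⋯ < e d` divide the set `S`: the arc with
number `i + 1` lies between `e i` and `e (i + 1)`, and the arc with number `0` is the rest. -/
def arc (S : Finset ℕ) (e : ℕ → ℕ) (d : ℕ) : ℕ → Finset ℕ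
  | 0 => {z ∈ S | z ≤ e 0 ∨ e d < z}
  | i + 1 => {z ∈ S | e i < z ∧ z ≤ e (i + 1)}

/-- The numbers `e 0 < e 1 < ⋯ < e d` are elements of `S`. -/
structure IsCut (S : Finset ℕ) (e : ℕ → ℕ) (d : ℕ) : Prop where
  mem : ∀ i ≤ d, e i ∈ S
  lt_succ : ∀ i < d, e i < e (i + 1)

/-- The family obtained from `P` by dividing the block `S` into arcs. -/
def splitFamily (P : Finset (Finset ℕ)) (S : Finset ℕ) (e : ℕ → ℕ) (d : ℕ) : Finset (Finset ℕ) :=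
  P.erase S ∪ (range (d + 1)).image (arc S e d)

theorem mem_splitFamily {P : Finset (Finset ℕ)} {S : Finset ℕ} {e : ℕ → ℕ} {d : ℕ}
    {B : Finset ℕ} :
    B ∈ splitFamily P S e d ↔ (B ≠ S ∧ B ∈ P) ∨ ∃ i ≤ d, arc S e d i = B := by
  simp [splitFamily]

theorem arc_subset (S : Finset ℕ) (e : ℕ → ℕ) (d i : ℕ) : arc S e d i ⊆ S := by
  cases i <;> exact filter_subset _ _

theorem IsCut.lt {S : Finset ℕ} {e : ℕ → ℕ} {d : ℕ} (h : IsCut S e d) {i j : ℕ} (hij : i < j)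
    (hj : j ≤ d) : e i < e j := by
  induction j with
  | zero => omega
  | succ j ih =>
    rcases Nat.lt_succ_iff_lt_or_eq.1 hij with h1 | rfl
    · exact (ih h1 (by omega)).trans (h.lt_succ j (by omega))
    · exact h.lt_succ i (by omega)

theorem IsCut.le {S : Finset ℕ} {e : ℕ → ℕ} {d : ℕ} (h : IsCut S e d) {i j : ℕ} (hij : i ≤ j)
    (hj : j ≤ d) : e i ≤ e j := by
  rcases hij.eq_or_lt with rfl | h1
  · rfl
  · exact (h.lt h1 hj).le

theorem IsCut.mem_arc {S : Finset ℕ} {e : ℕ → ℕ} {d : ℕ} (h : IsCut S e d) {i : ℕ} (hi : i ≤ d) :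
    e i ∈ arc S e d i := by
  cases i with
  | zero => simp [arc, h.mem 0 hi]
  | succ i => simp [arc, h.mem _ hi, h.lt_succ i (by omega)]

theorem IsCut.arc_unique {S : Finset ℕ} {e : ℕ → ℕ} {d : ℕ} (h : IsCut S e d) {i j x : ℕ}
    (hi : i ≤ d) (hj : j ≤ d) (hxi : x ∈ arc S e d i) (hxj : x ∈ arc S e d j) : i = j := by
  wlog hij : i < j generalizing i j
  · rcases (not_lt.1 hij).eq_or_lt with h1 | h1
    · exact h1.symm
    · exact (this hj hi hxj hxi h1).symm
  exfalso
  obtain ⟨j, rfl⟩ : ∃ j', j = j' + 1 := ⟨j - 1, by omega⟩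
  simp only [arc, mem_filter] at hxj
  have h1 := h.le (show i ≤ j by omega) (by omega)
  have h2 := h.le hj le_rfl
  have h3 := h.le (Nat.zero_le j) (by omega)
  cases i with
  | zero =>
    simp only [arc, mem_filter] at hxi
    omega
  | succ i =>
    simp only [arc, mem_filter] at hxi
    omega

theorem exists_mem_arc {S : Finset ℕ} (e : ℕ → ℕ) (d : ℕ) {x : ℕ} (hx : x ∈ S) :
    ∃ i ≤ d, x ∈ arc S e d i := by
  by_cases h0 : x ≤ e 0 ∨ e d < x
  · exact ⟨0, Nat.zero_le _, by simp [arc, hx, h0]⟩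
  push Not at h0
  have hex : ∃ i, x ≤ e i := ⟨d, h0.2⟩
  classical
  have h1 := Nat.find_spec hex
  have h2 : Nat.find hex ≤ d := Nat.find_le h0.2
  obtain ⟨i, hi⟩ : ∃ i, Nat.find hex = i + 1 := Nat.exists_eq_succ_of_ne_zero fun h => by
    rw [h] at h1
    omega
  have h3 : ¬ x ≤ e i := Nat.find_min hex (by omega)
  rw [hi] at h1 h2
  exact ⟨i + 1, h2, by simp [arc, hx, h1]; omega⟩

theorem IsCut.arc_ne {S : Finset ℕ} {e : ℕ → ℕ} {d : ℕ} (hd : 0 < d) (h : IsCut S e d) {i : ℕ}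
    (hi : i ≤ d) : arc S e d i ≠ S := by
  intro heq
  have h1 : e 0 ∈ arc S e d i := by rw [heq]; exact h.mem 0 (Nat.zero_le _)
  have h2 : e d ∈ arc S e d i := by rw [heq]; exact h.mem d le_rfl
  have := h.arc_unique hi (Nat.zero_le _) h1 (h.mem_arc (Nat.zero_le _))
  have := h.arc_unique hi le_rfl h2 (h.mem_arc le_rfl)
  omega

theorem IsNCFamily.arc_notMem {s : Finset ℕ} {P : Finset (Finset ℕ)} (hP : IsNCFamily s P)
    {S : Finset ℕ} (hS : S ∈ P) {e : ℕ → ℕ} {d : ℕ} (hd : 0 < d) (h : IsCut S e d) {i : ℕ}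
    (hi : i ≤ d) : arc S e d i ∉ P := fun hmem =>
  h.arc_ne hd hi (hP.eq_of_mem _ hmem S hS (e i) (h.mem_arc hi) (h.mem i hi))

theorem IsNCFamily.card_splitFamily {s : Finset ℕ} {P : Finset (Finset ℕ)} (hP : IsNCFamily s P)
    {S : Finset ℕ} (hS : S ∈ P) {e : ℕ → ℕ} {d : ℕ} (hd : 0 < d) (h : IsCut S e d) :
    #(splitFamily P S e d) = #P + d := by
  have h1 : Disjoint (P.erase S) ((range (d + 1)).image (arc S e d)) := by
    rw [Finset.disjoint_left]
    intro B hB hB'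
    obtain ⟨i, hi, rfl⟩ := mem_image.1 hB'
    exact hP.arc_notMem hS hd h (by simpa [Nat.lt_succ_iff] using hi) (mem_of_mem_erase hB)
  rw [splitFamily, card_union_of_disjoint h1, card_erase_of_mem hS, card_image_of_injOn,
    card_range]
  · have := card_pos.2 ⟨S, hS⟩
    omega
  · intro i hi j hj hij
    simp only [coe_range, Set.mem_Iio, Nat.lt_succ_iff] at hi hj
    exact h.arc_unique hi hj (h.mem_arc hi) (hij ▸ h.mem_arc hi)

theorem IsNCFamily.isNCFamily_splitFamily {s : Finset ℕ} {P : Finset (Finset ℕ)} (hP : IsNCFamily s P)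
    {S : Finset ℕ} (hS : S ∈ P) {e : ℕ → ℕ} {d : ℕ} (h : IsCut S e d) :
    IsNCFamily s (splitFamily P S e d) := by
  refine ⟨?_, ?_, ?_, ?_⟩
  · intro B hB
    rcases mem_splitFamily.1 hB with ⟨-, hB⟩ | ⟨i, hi, rfl⟩
    · exact hP.nonempty B hB
    · exact ⟨_, h.mem_arc hi⟩
  · intro B hB C hC x hxB hxC
    rcases mem_splitFamily.1 hB with ⟨hBS, hB⟩ | ⟨i, hi, rfl⟩ <;>
    rcases mem_splitFamily.1 hC with ⟨hCS, hC⟩ | ⟨j, hj, rfl⟩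
    · exact hP.eq_of_mem B hB C hC x hxB hxC
    · exact absurd (hP.eq_of_mem B hB S hS x hxB (arc_subset _ _ _ _ hxC)) hBS
    · exact absurd (hP.eq_of_mem C hC S hS x hxC (arc_subset _ _ _ _ hxB)) hCS
    · rw [h.arc_unique hi hj hxB hxC]
  · intro x
    rw [hP.mem_iff]
    constructor
    · rintro ⟨B, hB, hx⟩
      by_cases hBS : B = S
      · subst hBS
        obtain ⟨i, hi, hxi⟩ := exists_mem_arc e d hx
        exact ⟨_, mem_splitFamily.2 (Or.inr ⟨i, hi, rfl⟩), hxi⟩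
      · exact ⟨B, mem_splitFamily.2 (Or.inl ⟨hBS, hB⟩), hx⟩
    · rintro ⟨B, hB, hx⟩
      rcases mem_splitFamily.1 hB with ⟨-, hB⟩ | ⟨i, hi, rfl⟩
      · exact ⟨B, hB, hx⟩
      · exact ⟨S, hS, arc_subset _ _ _ _ hx⟩
  · intro B hB C hC i j k l hi hj hk hl hij hjk hkl
    rcases mem_splitFamily.1 hB with ⟨hBS, hB⟩ | ⟨a, ha, rfl⟩ <;>
    rcases mem_splitFamily.1 hC with ⟨hCS, hC⟩ | ⟨b, hb, rfl⟩
    · exact hP.noncrossing B hB C hC i j k l hi hj hk hl hij hjk hkl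
    · exact absurd (hP.noncrossing B hB S hS i j k l hi (arc_subset _ _ _ _ hj) hk
        (arc_subset _ _ _ _ hl) hij hjk hkl) hBS
    · exact absurd (hP.noncrossing S hS C hC i j k l (arc_subset _ _ _ _ hi) hj
        (arc_subset _ _ _ _ hk) hl hij hjk hkl).symm hCS
    -- Every arc other than number `0` is an interval of `S`. If two arcs cross and one has positive
    -- number, a point of the other lies between two of its points, hence in it.
    · have hconv : ∀ a u v w, u ∈ arc S e d (a + 1) → w ∈ arc S e d (a + 1) → v ∈ S → u < v →
          v < w → v ∈ arc S e d (a + 1) := by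
        intro a u v w hu hw hv h1 h2
        simp only [arc, mem_filter] at hu hw ⊢
        exact ⟨hv, by omega, by omega⟩
      rcases a with _ | a
      · rcases b with _ | b
        · rfl
        · rw [h.arc_unique ha hb hk (hconv b j k l hj hl (arc_subset _ _ _ _ hk) hjk hkl)]
      · rw [h.arc_unique ha hb (hconv a i j k hi hk (arc_subset _ _ _ _ hj) hij hjk) hj]

theorem IsCut.card_Ioc {d : ℕ} {S : Finset ℕ} {e : ℕ → ℕ} (h : IsCut S e d)
    (hcard : ∀ i < d, ((#(arc S e d (i + 1)) : ℕ) : ZMod d) = 1) {i : ℕ} (hi : i ≤ d) :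
    ((#{z ∈ S | e 0 < z ∧ z ≤ e i} : ℕ) : ZMod d) = i := by
  induction i with
  | zero =>
    have : ({z ∈ S | e 0 < z ∧ z ≤ e 0} : Finset ℕ) = ∅ :=
      filter_eq_empty_iff.2 fun z _ => by omega
    simp [this]
  | succ i ih =>
    have h1 := h.le (Nat.zero_le i) (by omega)
    have h2 := h.lt_succ i hi
    have : ({z ∈ S | e 0 < z ∧ z ≤ e (i + 1)} : Finset ℕ) =
        {z ∈ S | e 0 < z ∧ z ≤ e i} ∪ arc S e d (i + 1) := by
      ext z
      simp only [arc, mem_union, mem_filter, ← and_or_left]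
      exact and_congr_right fun _ => by omega
    rw [this, card_union_of_disjoint]
    · push_cast
      rw [ih (by omega), hcard i hi]
    · rw [Finset.disjoint_left]
      intro z
      simp only [arc, mem_filter]
      omega

/-- The `d` arcs between cut points have in total `≡ d ≡ 0` elements. Removing them therefore
changes neither the size of `S` nor rank differences in `S` modulo `d`, which settles arc `0`; the
other arcs are intervals of `S`. -/
theorem IsGoodFamily.isGoodFamily_splitFamily {d : ℕ} {s : Finset ℕ} {P : Finset (Finset ℕ)}
    (hP : IsGoodFamily d s P) {S : Finset ℕ} (hS : S ∈ P) {e : ℕ → ℕ} (h : IsCut S e d)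
    (hcard : ∀ i < d, ((#(arc S e d (i + 1)) : ℕ) : ZMod d) = 1) :
    IsGoodFamily d s (splitFamily P S e d) := by
  have hcd := h.card_Ioc hcard le_rfl
  rw [ZMod.natCast_self] at hcd
  have hle := h.le (Nat.zero_le d) le_rfl
  refine ⟨hP.toIsNCFamily.isNCFamily_splitFamily hS h, ?_, ?_⟩
  · intro B hB
    rcases mem_splitFamily.1 hB with ⟨-, hB⟩ | ⟨i, hi, rfl⟩
    · exact hP.card B hB
    · cases i with
      | succ i => exact hcard i hi
      | zero =>
        have h1 := hP.card S hS
        have : S = arc S e d 0 ∪ {z ∈ S | e 0 < z ∧ z ≤ e d} := by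
          ext z
          simp only [arc, mem_union, mem_filter, ← and_or_left]
          exact ⟨fun hz => ⟨hz, by omega⟩, fun hz => hz.1⟩
        rw [this, card_union_of_disjoint] at h1
        · push_cast at h1
          rw [hcd, add_zero] at h1
          exact h1
        · rw [Finset.disjoint_left]
          intro z
          simp only [arc, mem_filter]
          omega
  · intro B hB
    rcases mem_splitFamily.1 hB with ⟨-, hB⟩ | ⟨i, hi, rfl⟩
    · exact hP.good B hB
    · intro x hx y hy hxy
      have h1 := hP.good S hS x (arc_subset _ _ _ _ hx) y (arc_subset _ _ _ _ hy) hxy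
      by_cases hcase : i = 0 ∧ x ≤ e 0 ∧ e d < y
      · obtain ⟨rfl, h2, h3⟩ := hcase
        have : ({z ∈ S | x ≤ z ∧ z < y} : Finset ℕ) =
            {z ∈ arc S e d 0 | x ≤ z ∧ z < y} ∪ {z ∈ S | e 0 < z ∧ z ≤ e d} := by
          ext z
          simp only [arc, mem_union, mem_filter, and_assoc, ← and_or_left]
          exact and_congr_right fun _ => by omega
        rw [this, card_union_of_disjoint] at h1
        · push_cast at h1
          rw [hcd, add_zero] at h1
          exact h1
        · rw [Finset.disjoint_left]
          intro z
          simp only [arc, mem_filter]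
          omega
      · rw [← h1]
        congr 2
        ext z
        cases i with
        | zero =>
          simp only [arc, mem_filter] at hx hy ⊢
          constructor
          · rintro ⟨⟨hz, -⟩, hz'⟩
            exact ⟨hz, hz'⟩
          · rintro ⟨hz, hz'⟩
            exact ⟨⟨hz, by omega⟩, hz'⟩
        | succ i =>
          simp only [arc, mem_filter] at hx hy ⊢
          constructor
          · rintro ⟨⟨hz, -⟩, hz'⟩
            exact ⟨hz, hz'⟩
          · rintro ⟨hz, hz'⟩
            exact ⟨⟨hz, by omega, by omega⟩, hz'⟩

theorem exists_seq_of_step {d : ℕ} (Q : ℕ → ℕ → Prop) (R : ℕ → ℕ → Prop) {x : ℕ} (h0 : Q 0 x)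
    (hstep : ∀ i < d, ∀ y, Q i y → ∃ y', R y y' ∧ Q (i + 1) y') :
    ∃ e : ℕ → ℕ, e 0 = x ∧ (∀ i ≤ d, Q i (e i)) ∧ ∀ i < d, R (e i) (e (i + 1)) := by
  classical
  choose! f hf using hstep
  refine ⟨fun i => Nat.rec x (fun i y => f i y) i, rfl, ?_⟩
  have hQ : ∀ i ≤ d, Q i (Nat.rec x (fun i y => f i y) i : ℕ) := by
    intro i
    induction i with
    | zero => exact fun _ => h0
    | succ i ih => exact fun hi => (hf i hi _ (ih (by omega))).2
  exact ⟨hQ, fun i hi => (hf i hi _ (hQ i hi.le)).1⟩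

/-- The partition with a given family of blocks. -/
def IsNCFamily.toFinpartition {s : Finset ℕ} {P : Finset (Finset ℕ)} (h : IsNCFamily s P) :
    Finpartition s where
  parts := P
  supIndep := by
    rw [Finset.supIndep_iff_pairwiseDisjoint]
    intro B hB C hC hne
    exact Finset.disjoint_left.2 fun x hx hx' => hne (h.eq_of_mem B hB C hC x hx hx')
  sup_parts := by
    ext x
    rw [h.mem_iff, Finset.mem_sup]
    rfl
  bot_notMem := fun h0 => by
    obtain ⟨x, hx⟩ := h.nonempty _ h0
    exact absurd hx (by simp)

end IndivNC

/-! ### Strict refinements factor through a split -/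

namespace IndivNC

/-- If the block `S` of the coarser of two families is divided in the finer one, then it can be
divided into `d + 1` arcs without leaving the interval between the two. -/
theorem IsGoodFamily.exists_split_of_lt {d : ℕ} {s : Finset ℕ}
    {P Q : Finset (Finset ℕ)} (hP : IsGoodFamily d s P) (hQ : IsGoodFamily d s Q)
    (hle : ∀ B ∈ P, ∃ C ∈ Q, B ⊆ C) {S : Finset ℕ} (hS : S ∈ Q) (hSP : S ∉ P) :
    ∃ e, IsCut S e d ∧ (∀ i < d, ((#(arc S e d (i + 1)) : ℕ) : ZMod d) = 1) ∧
      ∀ B ∈ P, ∃ C ∈ splitFamily Q S e d, B ⊆ C := by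
  have hPS : ∀ B ∈ P, ∀ x ∈ B, x ∈ S → B ⊆ S := by
    intro B hB x hx hxS
    obtain ⟨C, hC, hBC⟩ := hle B hB
    rwa [← hQ.eq_of_mem C hC S hS x (hBC hx) hxS]
  obtain ⟨a, haS, hmin⟩ : ∃ a ∈ S, ∀ z ∈ S, a ≤ z :=
    ⟨S.min' (hQ.nonempty S hS), min'_mem _ _, fun z hz => min'_le _ _ hz⟩
  obtain ⟨B, hB, haB⟩ := (hP.mem_iff a).1 ((hQ.mem_iff a).2 ⟨S, hS, haS⟩)
  have hBS : B ⊆ S := hPS B hB a haB haS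
  have hne : (S \ B).Nonempty := by
    rw [sdiff_nonempty]
    exact fun h => hSP (h.antisymm hBS ▸ hB)
  obtain ⟨z₀, hz₀, hz₀min⟩ : ∃ z ∈ S \ B, ∀ y ∈ S \ B, z ≤ y :=
    ⟨(S \ B).min' hne, min'_mem _ _, fun z hz => min'_le _ _ hz⟩
  rw [mem_sdiff] at hz₀
  have hlow : ∀ z ∈ S, z < z₀ → z ∈ B := fun z hz hlt => by
    by_contra hzB
    exact absurd (hz₀min z (mem_sdiff.2 ⟨hz, hzB⟩)) (by omega)
  have haz : a < z₀ := lt_of_le_of_ne (hmin z₀ hz₀.1) fun h => hz₀.2 (h ▸ haB)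
  -- `x` is the predecessor in `S` of the first element outside `B`; it becomes the cut point `e 0`.
  -- All elements of `S` up to `x` lie in `B`.
  obtain ⟨x, hx, hxmax⟩ : ∃ x ∈ ({b ∈ B | b < z₀} : Finset ℕ),
      ∀ y ∈ ({b ∈ B | b < z₀} : Finset ℕ), y ≤ x :=
    have h : ({b ∈ B | b < z₀} : Finset ℕ).Nonempty := ⟨a, mem_filter.2 ⟨haB, haz⟩⟩
    ⟨_, max'_mem _ h, fun z hz => le_max' _ _ hz⟩
  rw [mem_filter] at hx
  have hlow' : ∀ z ∈ S, z < z₀ → z ≤ x := fun z hz h =>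
    hxmax z (mem_filter.2 ⟨hlow z hz h, h⟩)
  have hxS := hBS hx.1
  have hlowB : ∀ z ∈ S, z ≤ x → z ∈ B := fun z hz h => hlow z hz (by omega)
  have hdvd : ∀ i : ℕ, 0 < i → i < d → ((i : ℕ) : ZMod d) ≠ 0 := fun i h1 h2 h3 =>
    absurd (Nat.le_of_dvd h1 ((ZMod.natCast_eq_zero_iff i d).1 h3)) (by omega)
  -- Each further cut point is the maximum of the block of `P` that starts right after the current
  -- one. Invariant at step `i`: the part of `S` in `(x, y]` is a union of blocks of `P` and has `≡
  -- i` elements.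
  obtain ⟨e, he0, heQ, heR⟩ := exists_seq_of_step (d := d)
    (fun i y => y ∈ S ∧ x ≤ y ∧ (i = 0 → y = x) ∧ (∀ D ∈ P, ∀ u ∈ D, ∀ v ∈ D, u ∈ S →
      x < u → u ≤ y → x < v ∧ v ≤ y) ∧ ((#{z ∈ S | x < z ∧ z ≤ y} : ℕ) : ZMod d) = i)
    (fun y y' => y < y' ∧ ((#{z ∈ S | y < z ∧ z ≤ y'} : ℕ) : ZMod d) = 1) (x := x)
    ⟨hxS, le_rfl, fun _ => rfl, fun D _ u _ v _ _ h1 h2 => by omega, by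
      rw [filter_eq_empty_iff.2 fun z _ => by omega]; simp⟩ (by
    rintro i hi y ⟨hyS, hxy, hi0, hsat, hcard⟩
    have hnoB : ∀ z ∈ B, x < z → ¬ z ≤ y := fun z hz h1 h2 => by
      have := hsat B hB z hz x hx.1 (hBS hz) h1 h2
      omega
    -- The next element `w` of `S` exists and is not in `B`. For `0 < i < d`, if `S` ended at `y`,
    -- its size would be `≡ 1 + i`; if `w` were in `B`, it would follow `x` in `B`, so `w ≡ x + 1`,
    -- while the ranks in `S` give `w ≡ x + 1 + i`. Both would force `i ≡ 0`.
    have hexw : ∃ w ∈ S, y < w ∧ (∀ z ∈ S, y < z → w ≤ z) ∧ w ∉ B := by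
      rcases Nat.eq_zero_or_pos i with h0 | hipos
      · rw [hi0 h0]
        exact ⟨z₀, hz₀.1, hx.2, fun z hz h => by
          by_contra hlt
          have := hlow' z hz (by omega)
          omega, hz₀.2⟩
      have hw : ({z ∈ S | y < z} : Finset ℕ).Nonempty := by
        by_contra hempty
        rw [not_nonempty_iff_eq_empty, filter_eq_empty_iff] at hempty
        have h1 : S = B ∪ {z ∈ S | x < z ∧ z ≤ y} := by
          ext z
          simp only [mem_union, mem_filter]
          constructor
          · intro hz
            have := hempty hz
            by_cases hzx : z ≤ x
            · exact Or.inl (hlowB z hz hzx)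
            · exact Or.inr ⟨hz, by omega⟩
          · rintro (hz | hz)
            · exact hBS hz
            · exact hz.1
        have h2 := hQ.card S hS
        rw [h1, card_union_of_disjoint] at h2
        · push_cast at h2
          rw [hP.card B hB, hcard] at h2
          exact hdvd i hipos hi (by linear_combination h2)
        · rw [Finset.disjoint_left]
          intro z hz hz'
          rw [mem_filter] at hz'
          exact hnoB z hz hz'.2.1 hz'.2.2
      obtain ⟨w, hw1, hw2⟩ : ∃ w ∈ ({z ∈ S | y < z} : Finset ℕ),
          ∀ z ∈ ({z ∈ S | y < z} : Finset ℕ), w ≤ z :=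
        ⟨_, min'_mem _ hw, fun z hz => min'_le _ _ hz⟩
      rw [mem_filter] at hw1
      have hwmin : ∀ z ∈ S, y < z → w ≤ z := fun z hz h => hw2 z (mem_filter.2 ⟨hz, h⟩)
      refine ⟨w, hw1.1, hw1.2, hwmin, fun hwB => ?_⟩
      have h1 := (hP.good B hB).consecutive hx.1 hwB (by omega) fun z hz hz' => by
        have h3 := hnoB z hz hz'.1
        have h4 := hwmin z (hBS hz) (by omega)
        omega
      have h2 := hQ.good S hS x hxS w hw1.1 (by omega)
      have h3 : ({z ∈ S | x ≤ z ∧ z < w} : Finset ℕ) =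
          insert x {z ∈ S | x < z ∧ z ≤ y} := by
        ext z
        simp only [mem_insert, mem_filter]
        constructor
        · rintro ⟨hz, hz'⟩
          have := hwmin z hz
          by_cases hzx : z = x
          · exact Or.inl hzx
          · exact Or.inr ⟨hz, by omega, by omega⟩
        · rintro (rfl | ⟨hz, hz'⟩)
          · exact ⟨hxS, by omega⟩
          · exact ⟨hz, by omega⟩
      rw [h3, card_insert_of_notMem (by simp), h1] at h2
      push_cast at h2
      rw [hcard] at h2
      exact hdvd i hipos hi (by linear_combination h2)
    obtain ⟨w, hwS, hyw, hwmin, hwB⟩ := hexw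
    obtain ⟨C, hC, hwC⟩ := (hP.mem_iff w).1 ((hQ.mem_iff w).2 ⟨S, hS, hwS⟩)
    have hCS : C ⊆ S := hPS C hC w hwC hwS
    obtain ⟨m, hmC, hmmax⟩ : ∃ m ∈ C, ∀ z ∈ C, z ≤ m :=
      ⟨_, max'_mem C ⟨w, hwC⟩, fun z hz => le_max' _ _ hz⟩
    have hCmin : ∀ u ∈ C, w ≤ u := by
      intro u hu
      by_contra hlt
      have huy : u ≤ y := by
        by_contra h
        have := hwmin u (hCS hu) (by omega)
        omega
      by_cases hux : x < u
      · have := hsat C hC u hu w hwC (hCS hu) hux huy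
        omega
      · have := hlowB u (hCS hu) (by omega)
        exact hwB (hP.eq_of_mem C hC B hB u hu this ▸ hwC)
    have hwm := hmmax w hwC
    -- Goodness of `C` and of `S` both compute rank differences as `m - w`, so the stretch of `S`
    -- from `w` to `m` has the same size modulo `d` as `C`, although blocks nested in `C` may lie in
    -- it.
    have hcard' : ((#{z ∈ S | y < z ∧ z ≤ m} : ℕ) : ZMod d) = 1 := by
      have h1 := (hP.good C hC).card_eq hwC hmC fun z hz => ⟨hCmin z hz, hmmax z hz⟩
      have h2 := hQ.good S hS w hwS m (hCS hmC) hwm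
      have h3 : ({z ∈ S | y < z ∧ z ≤ m} : Finset ℕ) = insert m {z ∈ S | w ≤ z ∧ z < m} := by
        ext z
        simp only [mem_insert, mem_filter]
        constructor
        · rintro ⟨hz, hz'⟩
          have := hwmin z hz
          by_cases hzm : z = m
          · exact Or.inl hzm
          · exact Or.inr ⟨hz, by omega, by omega⟩
        · rintro (rfl | ⟨hz, hz'⟩)
          · exact ⟨hCS hmC, by omega⟩
          · exact ⟨hz, by omega⟩
      rw [h3, card_insert_of_notMem (by simp)]
      push_cast
      rw [h2, ← h1, hP.card C hC]
    refine ⟨m, ⟨by omega, hcard'⟩, hCS hmC, by omega, by omega, ?_, ?_⟩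
    · intro D hD u hu v hv huS hxu hum
      have hDS := hPS D hD u hu huS
      by_cases huy : u ≤ y
      · have := hsat D hD u hu v hv huS hxu huy
        omega
      have hvy : ¬ (x < v ∧ v ≤ y) := fun h => by
        have := hsat D hD v hv u hu (hDS hv) h.1 h.2
        omega
      by_cases hDC : D = C
      · subst hDC
        have h1 := hmmax v hv
        have h2 := hCmin v hv
        omega
      have hneC : ∀ t ∈ D, t ≠ w ∧ t ≠ m := fun t ht =>
        ⟨fun h => hDC (hP.eq_of_mem D hD C hC t ht (h ▸ hwC)),
          fun h => hDC (hP.eq_of_mem D hD C hC t ht (h ▸ hmC))⟩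
      have h1 := hneC u hu
      have h2 := hneC v hv
      have h3 := hwmin u huS (by omega)
      by_cases hvx : v ≤ x
      · have hDB := hP.eq_of_mem D hD B hB v hv (hlowB v (hDS hv) hvx)
        exact absurd (hP.noncrossing D hD C hC v w u m hv hwC hu hmC (by omega) (by omega)
          (by omega)) hDC
      · refine ⟨by omega, ?_⟩
        by_contra hvm
        exact hDC (hP.noncrossing C hC D hD w u m v hwC hu hmC hv (by omega) (by omega)
          (by omega)).symm
    · have h3 : ({z ∈ S | x < z ∧ z ≤ m} : Finset ℕ) =
          {z ∈ S | x < z ∧ z ≤ y} ∪ {z ∈ S | y < z ∧ z ≤ m} := by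
        ext z
        simp only [mem_union, mem_filter, ← and_or_left]
        exact and_congr_right fun _ => by omega
      rw [h3, card_union_of_disjoint]
      · push_cast
        rw [hcard, hcard']
      · rw [Finset.disjoint_left]
        intro z
        simp only [mem_filter]
        omega)
  have hcut : IsCut S e d := ⟨fun i hi => (heQ i hi).1, fun i hi => (heR i hi).1⟩
  refine ⟨e, hcut, fun i hi => (heR i hi).2, fun D hD => ?_⟩
  obtain ⟨T, hT, hDT⟩ := hle D hD
  by_cases hTS : T = S
  · subst hTS
    obtain ⟨u, hu⟩ := hP.nonempty D hD
    obtain ⟨i, hi, hui⟩ := exists_mem_arc e d (hDT hu)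
    refine ⟨_, mem_splitFamily.2 (Or.inr ⟨i, hi, rfl⟩), fun v hv => ?_⟩
    cases i with
    | zero =>
      have h1 := (heQ d le_rfl).2.2.2.1 D hD v hv u hu (hDT hv)
      simp only [arc, mem_filter, he0] at hui ⊢
      exact ⟨hDT hv, by omega⟩
    | succ i =>
      have h1 := (heQ (i + 1) hi).2.2.2.1 D hD u hu v hv (hDT hu)
      have h2 := (heQ i (by omega)).2.2.2.1 D hD v hv u hu (hDT hv)
      have h3 := (heQ i (by omega)).2.1
      simp only [arc, mem_filter] at hui ⊢
      exact ⟨hDT hv, by omega, by omega⟩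
  · exact ⟨T, mem_splitFamily.2 (Or.inl ⟨hTS, hT⟩), hDT⟩

end IndivNC

/-! ### Cover relations and their labels -/

namespace IndivNC

section Covers

variable {d n : ℕ}

theorem exists_split_parts (hn : (n : ZMod d) = 1) (σ : NC d n) {S : Finset ℕ}
    (hS : S ∈ σ.1.parts) {e : ℕ → ℕ} (h : IsCut S e d)
    (hcard : ∀ i < d, ((#(arc S e d (i + 1)) : ℕ) : ZMod d) = 1) :
    ∃ π : NC d n, π.1.parts = splitFamily σ.1.parts S e d :=
  have h1 := ((isIndivisible_iff hn σ.1).1 σ.2).isGoodFamily_splitFamily hS h hcard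
  ⟨⟨h1.toIsNCFamily.toFinpartition, (isIndivisible_iff hn _).2 h1⟩, rfl⟩

theorem lt_of_parts_eq_splitFamily (hd : 0 < d) (hn : (n : ZMod d) = 1) {π σ : NC d n}
    {S : Finset ℕ} (hS : S ∈ σ.1.parts) {e : ℕ → ℕ} (h : IsCut S e d)
    (hπ : π.1.parts = splitFamily σ.1.parts S e d) : π < σ := by
  have hσ := (isIndivisible_iff hn σ.1).1 σ.2
  refine lt_of_le_of_ne ?_ ?_
  · intro B hB
    rcases mem_splitFamily.1 (hπ ▸ hB) with ⟨-, hB⟩ | ⟨i, hi, rfl⟩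
    · exact ⟨B, hB, le_rfl⟩
    · exact ⟨S, hS, arc_subset _ _ _ _⟩
  · rintro rfl
    exact hσ.arc_notMem hS hd h (Nat.zero_le _)
      (hπ ▸ mem_splitFamily.2 (Or.inr ⟨0, Nat.zero_le _, rfl⟩))

theorem exists_split_between (hn : (n : ZMod d) = 1) {π σ : NC d n} (hlt : π < σ) :
    ∃ S ∈ σ.1.parts, ∃ e, IsCut S e d ∧
      (∀ i < d, ((#(arc S e d (i + 1)) : ℕ) : ZMod d) = 1) ∧
      ∃ ρ : NC d n, ρ.1.parts = splitFamily σ.1.parts S e d ∧ π ≤ ρ := by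
  have hπ := (isIndivisible_iff hn π.1).1 π.2
  have hσ := (isIndivisible_iff hn σ.1).1 σ.2
  have hle : ∀ B ∈ π.1.parts, ∃ C ∈ σ.1.parts, B ⊆ C := fun B hB => hlt.le hB
  obtain ⟨S, hS, hSP⟩ : ∃ S ∈ σ.1.parts, S ∉ π.1.parts := by
    by_contra! hall
    refine hlt.not_ge fun B hB => ⟨B, hall B hB, le_rfl⟩
  obtain ⟨e, he, hcard, hρ⟩ := hπ.exists_split_of_lt hσ hle hS hSP
  obtain ⟨ρ, hρ'⟩ := exists_split_parts hn σ hS he hcard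
  refine ⟨S, hS, e, he, hcard, ρ, hρ', fun B hB => ?_⟩
  obtain ⟨C, hC, hBC⟩ := hρ B hB
  exact ⟨C, hρ' ▸ hC, hBC⟩

theorem card_parts_of_split (hd : 0 < d) (hn : (n : ZMod d) = 1) {π σ : NC d n} {S : Finset ℕ}
    (hS : S ∈ σ.1.parts) {e : ℕ → ℕ} (h : IsCut S e d)
    (hπ : π.1.parts = splitFamily σ.1.parts S e d) : #π.1.parts = #σ.1.parts + d := by
  rw [hπ, ((isIndivisible_iff hn σ.1).1 σ.2).card_splitFamily hS hd h]

theorem card_parts_add_le_of_lt (hd : 0 < d) (hn : (n : ZMod d) = 1) {π σ : NC d n}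
    (hlt : π < σ) : #σ.1.parts + d ≤ #π.1.parts := by
  obtain ⟨S, hS, e, he, -, ρ, hρ, hle⟩ := exists_split_between hn hlt
  rw [← card_parts_of_split hd hn hS he hρ]
  exact Finpartition.card_mono hle

/-- A strict step changes the number of blocks by at least `d` and a split by exactly `d`, so
nothing fits in between. -/
theorem covBy_of_split (hd : 0 < d) (hn : (n : ZMod d) = 1) {π σ : NC d n} {S : Finset ℕ}
    (hS : S ∈ σ.1.parts) {e : ℕ → ℕ} (h : IsCut S e d)
    (hπ : π.1.parts = splitFamily σ.1.parts S e d) : π ⋖ σ := by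
  refine ⟨lt_of_parts_eq_splitFamily hd hn hS h hπ, fun ρ h1 h2 => ?_⟩
  have e1 := card_parts_add_le_of_lt hd hn h1
  have e2 := card_parts_add_le_of_lt hd hn h2
  have e3 := card_parts_of_split hd hn hS h hπ
  omega

theorem exists_split_of_covBy (hd : 0 < d) (hn : (n : ZMod d) = 1) {π σ : NC d n} (h : π ⋖ σ) :
    ∃ S ∈ σ.1.parts, ∃ e, IsCut S e d ∧ π.1.parts = splitFamily σ.1.parts S e d := by
  obtain ⟨S, hS, e, he, -, ρ, hρ, hle⟩ := exists_split_between hn h.lt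
  have hρσ := lt_of_parts_eq_splitFamily hd hn hS he hρ
  rcases hle.eq_or_lt with rfl | hlt
  · exact ⟨S, hS, e, he, hρ⟩
  · exact absurd hρσ (h.2 hlt)

/-- Arc `0` contains `e 0`, while all other arcs lie above `e 0`, so arc `0` plays the role of `B₁`.
The second smallest minimum lies in `(e 0, e d]`, where arc `0` has no elements, so the elements of
arc `0` below it are those up to `e 0`. -/
theorem edgeLabel_of_split (hd : 0 < d) (hn : (n : ZMod d) = 1) {π σ : NC d n} {S : Finset ℕ}
    (hS : S ∈ σ.1.parts) {e : ℕ → ℕ} (h : IsCut S e d)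
    (hπ : π.1.parts = splitFamily σ.1.parts S e d) : edgeLabel π.1 σ.1 = e 0 := by
  have hσ := (isIndivisible_iff hn σ.1).1 σ.2
  have hJ : ∀ m, m ∈ joinedMins π.1 σ.1 ↔ ∃ i ≤ d, sInf (arc S e d i : Set ℕ) = m := by
    intro m
    simp only [joinedMins, mem_image, mem_sdiff, hπ, mem_splitFamily]
    constructor
    · rintro ⟨B, ⟨⟨-, hB⟩ | ⟨i, hi, rfl⟩, hB'⟩, rfl⟩
      · exact absurd hB hB'
      · exact ⟨i, hi, rfl⟩
    · rintro ⟨i, hi, rfl⟩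
      exact ⟨_, ⟨Or.inr ⟨i, hi, rfl⟩, hσ.arc_notMem hS hd h hi⟩, rfl⟩
  have hinf : ∀ i ≤ d, sInf (arc S e d i : Set ℕ) ∈ arc S e d i := fun i hi =>
    Nat.sInf_mem (s := (arc S e d i : Set ℕ)) ⟨_, h.mem_arc hi⟩
  have hinfle : ∀ i, ∀ z ∈ arc S e d i, sInf (arc S e d i : Set ℕ) ≤ z := fun i z hz =>
    Nat.sInf_le (s := (arc S e d i : Set ℕ)) hz
  have hgt : ∀ i ≤ d, i ≠ 0 → ∀ z ∈ arc S e d i, e 0 < z := by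
    intro i hi h0 z hz
    obtain ⟨i, rfl⟩ := Nat.exists_eq_succ_of_ne_zero h0
    simp only [arc, mem_filter] at hz
    have := h.le (Nat.zero_le i) (by omega)
    omega
  have hm₁ : sInf (joinedMins π.1 σ.1 : Set ℕ) = sInf (arc S e d 0 : Set ℕ) := by
    have h0 : sInf (arc S e d 0 : Set ℕ) ∈ (joinedMins π.1 σ.1 : Set ℕ) :=
      (hJ _).2 ⟨0, Nat.zero_le _, rfl⟩
    refine le_antisymm (Nat.sInf_le h0) ?_
    obtain ⟨i, hi, hi'⟩ := (hJ _).1 (Nat.sInf_mem ⟨_, h0⟩)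
    rw [← hi']
    by_cases hi0 : i = 0
    · rw [hi0]
    · have h1 := hgt i hi hi0 _ (hinf i hi)
      have h2 := hinfle 0 _ (h.mem_arc (Nat.zero_le _))
      omega
  obtain ⟨m₁, hm₁'⟩ : ∃ m₁, m₁ = sInf (joinedMins π.1 σ.1 : Set ℕ) := ⟨_, rfl⟩
  obtain ⟨m₂, hm₂'⟩ : ∃ m₂, m₂ = sInf ((joinedMins π.1 σ.1).erase m₁ : Set ℕ) := ⟨_, rfl⟩
  have hE : ∀ m, m ∈ (((joinedMins π.1 σ.1).erase m₁ : Finset ℕ) : Set ℕ) ↔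
      ∃ i ≤ d, i ≠ 0 ∧ sInf (arc S e d i : Set ℕ) = m := by
    intro m
    rw [mem_coe, mem_erase, hJ, hm₁', hm₁]
    constructor
    · rintro ⟨hne, i, hi, rfl⟩
      exact ⟨i, hi, fun h => hne (h ▸ rfl), rfl⟩
    · rintro ⟨i, hi, hi0, rfl⟩
      refine ⟨fun heq => hi0 ?_, i, hi, rfl⟩
      exact h.arc_unique hi (Nat.zero_le _) (hinf i hi) (heq ▸ hinf 0 (Nat.zero_le _))
  have h1mem := (hE _).2 ⟨1, hd, one_ne_zero, rfl⟩
  have hm₂gt : e 0 < m₂ := by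
    obtain ⟨i, hi, hi0, hi'⟩ := (hE _).1 (Nat.sInf_mem ⟨_, h1mem⟩)
    rw [hm₂']
    exact hi' ▸ hgt i hi hi0 _ (hinf i hi)
  have hm₂le : m₂ ≤ e d := by
    rw [hm₂']
    exact ((Nat.sInf_le h1mem).trans (hinfle 1 _ (h.mem_arc hd))).trans (h.le hd le_rfl)
  have hpart : π.1.part m₁ = arc S e d 0 := by
    refine Finpartition.part_eq_of_mem _ (hπ ▸ mem_splitFamily.2 (Or.inr ⟨0, Nat.zero_le _, rfl⟩))
      ?_
    rw [hm₁', hm₁]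
    exact hinf 0 (Nat.zero_le _)
  have hlab : edgeLabel π.1 σ.1 = ((π.1.part m₁).filter (· < m₂)).sup id := by
    rw [hm₂', hm₁']
    rfl
  rw [hlab, hpart]
  refine le_antisymm (Finset.sup_le fun z hz => ?_) (Finset.le_sup (f := id) ?_)
  · simp only [arc, mem_filter] at hz
    simp only [id]
    omega
  · exact mem_filter.2 ⟨h.mem_arc (Nat.zero_le _), hm₂gt⟩

end Covers

end IndivNC

/-! ### Lattice paths on blocks and removal of the last letter -/

namespace IndivNC

/-- The partial sums of `g` over `B` stay nonnegative until the last element of `B`, where the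
sum drops to `-1`. -/
def IsLuk (g : ℕ → ℤ) (B : Finset ℕ) : Prop :=
  (∀ x ∈ B, 0 ≤ ∑ b ∈ B with b < x, g b) ∧ ∑ b ∈ B, g b = -1

theorem sum_filter_eq_add {S : Finset ℕ} {g : ℕ → ℤ} {p q r : ℕ → Prop} [DecidablePred p]
    [DecidablePred q] [DecidablePred r] (h : ∀ z ∈ S, (p z ↔ q z ∨ r z) ∧ ¬ (q z ∧ r z)) :
    ∑ z ∈ S with p z, g z = ∑ z ∈ S with q z, g z + ∑ z ∈ S with r z, g z := by
  rw [sum_filter, sum_filter, sum_filter, ← sum_add_distrib]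
  refine sum_congr rfl fun z hz => ?_
  have := h z hz
  by_cases h1 : q z <;> by_cases h2 : r z <;> simp_all

theorem sum_filter_congr' {S : Finset ℕ} {g : ℕ → ℤ} {p q : ℕ → Prop} [DecidablePred p]
    [DecidablePred q] (h : ∀ z ∈ S, (p z ↔ q z)) :
    ∑ z ∈ S with p z, g z = ∑ z ∈ S with q z, g z := by
  rw [filter_congr h]

theorem isLuk_arc_succ {S : Finset ℕ} {e : ℕ → ℕ} {d i : ℕ} {g : ℕ → ℤ} :
    IsLuk g (arc S e d (i + 1)) ↔
      (∀ x ∈ S, e i < x → x ≤ e (i + 1) → 0 ≤ ∑ b ∈ S with e i < b ∧ b < x, g b) ∧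
      ∑ b ∈ S with e i < b ∧ b ≤ e (i + 1), g b = -1 := by
  simp only [IsLuk, arc, filter_filter, mem_filter, and_imp]
  refine and_congr (forall₂_congr fun x hx => forall₂_congr fun h1 h2 => ?_) Iff.rfl
  rw [sum_filter_congr' (q := fun b => e i < b ∧ b < x) fun z _ => by omega]

theorem sum_Ioc_of_isLuk {S : Finset ℕ} {e : ℕ → ℕ} {d : ℕ} {g : ℕ → ℤ}
    (h : ∀ i < d, e i < e (i + 1) ∧ ∑ b ∈ S with e i < b ∧ b ≤ e (i + 1), g b = -1) {i : ℕ}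
    (hi : i ≤ d) : e 0 ≤ e i ∧ ∑ b ∈ S with e 0 < b ∧ b ≤ e i, g b = -i := by
  induction i with
  | zero =>
    rw [filter_eq_empty_iff.2 fun z _ => by omega]
    simp
  | succ i ih =>
    obtain ⟨h1, h2⟩ := ih (by omega)
    obtain ⟨h3, h4⟩ := h i hi
    refine ⟨by omega, ?_⟩
    rw [sum_filter_eq_add (q := fun b => e 0 < b ∧ b ≤ e i)
      (r := fun b => e i < b ∧ b ≤ e (i + 1)) fun z _ => by omega, h2, h4]
    push_cast
    ring

/-- The bonus `d` at `e 0` pays for the `d` inserted arcs, each of which lowers the path by `1`. -/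
theorem IsCut.isLuk_of_arcs {S : Finset ℕ} {e : ℕ → ℕ} {d : ℕ} (h : IsCut S e d) {g : ℕ → ℤ}
    (hluk : ∀ i ≤ d, IsLuk g (arc S e d i)) :
    IsLuk (fun b => g b + if b = e 0 then (d : ℤ) else 0) S := by
  have hs := fun i (hi : i < d) => isLuk_arc_succ.1 (hluk (i + 1) hi)
  have htel := fun i (hi : i ≤ d) =>
    sum_Ioc_of_isLuk (fun i hi => ⟨h.lt_succ i hi, (hs i hi).2⟩) hi
  obtain ⟨h01, h02⟩ := hluk 0 (Nat.zero_le _)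
  have hed := h.le (Nat.zero_le d) le_rfl
  -- The value `-1` can occur only if arc `0` has no elements after `e d`. Inside arc `i + 1` the
  -- path is then at least `-1 + d - i ≥ 0`.
  have hfirst : -1 ≤ ∑ b ∈ S with b ≤ e 0, g b := by
    by_cases hne : ({z ∈ S | e d < z} : Finset ℕ).Nonempty
    · obtain ⟨w, hw1, hw2⟩ : ∃ w ∈ ({z ∈ S | e d < z} : Finset ℕ),
          ∀ z ∈ ({z ∈ S | e d < z} : Finset ℕ), w ≤ z :=
        ⟨_, min'_mem _ hne, fun z hz => min'_le _ _ hz⟩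
      rw [mem_filter] at hw1
      have h1 := h01 w (by simp [arc, hw1])
      have h2 : ∑ b ∈ arc S e d 0 with b < w, g b = ∑ b ∈ S with b ≤ e 0, g b := by
        rw [arc, filter_filter]
        refine sum_filter_congr' fun z hz => ⟨fun hz' => ?_, fun hz' => by omega⟩
        by_contra hcon
        have := hw2 z (mem_filter.2 ⟨hz, by omega⟩)
        omega
      rw [h2] at h1
      omega
    · rw [not_nonempty_iff_eq_empty, filter_eq_empty_iff] at hne
      rw [← h02, arc]
      refine le_of_eq (sum_filter_congr' fun z hz => ?_)
      have := hne hz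
      omega
  have hind : ∀ x, ∑ b ∈ S with b < x, (g b + if b = e 0 then (d : ℤ) else 0) =
      ∑ b ∈ S with b < x, g b + if e 0 < x then (d : ℤ) else 0 := by
    intro x
    rw [sum_add_distrib, sum_ite_eq' _ (e 0)]
    simp [h.mem 0 (Nat.zero_le _)]
  refine ⟨fun x hx => ?_, ?_⟩
  · rw [hind]
    obtain ⟨i, hi, hxi⟩ := exists_mem_arc e d hx
    cases i with
    | zero =>
      have h1 := h01 x hxi
      simp only [arc, filter_filter, mem_filter] at h1 hxi
      by_cases hx0 : x ≤ e 0
      · rw [if_neg (by omega), add_zero]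
        rwa [sum_filter_congr' (q := fun b => b < x) fun z _ => by omega] at h1
      · rw [if_pos (by omega), sum_filter_eq_add (q := fun b => (b ≤ e 0 ∨ e d < b) ∧ b < x)
          (r := fun b => e 0 < b ∧ b ≤ e d) fun z _ => by omega, (htel d le_rfl).2]
        omega
    | succ i =>
      simp only [arc, mem_filter] at hxi
      have h1 := (hs i hi).1 x hx hxi.2.1 hxi.2.2
      have h2 := htel i (by omega)
      rw [if_pos (by omega), sum_filter_eq_add (q := fun b => b ≤ e 0)
          (r := fun b => e 0 < b ∧ b < x) fun z _ => by omega,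
          sum_filter_eq_add (p := fun b => e 0 < b ∧ b < x) (q := fun b => e 0 < b ∧ b ≤ e i)
          (r := fun b => e i < b ∧ b < x) fun z _ => by omega, h2.2]
      omega
  · rw [sum_add_distrib, sum_ite_eq' _ (e 0), if_pos (h.mem 0 (Nat.zero_le _))]
    have h1 := htel d le_rfl
    have h2 := sum_filter_eq_add (S := S) (g := g) (p := fun _ => True)
      (q := fun b => b ≤ e 0 ∨ e d < b) (r := fun b => e 0 < b ∧ b ≤ e d) fun z _ => by
        simp only [true_iff]; omega
    rw [arc] at h02
    rw [filter_true, h1.2, h02] at h2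
    rw [h2]
    ring

/-- Steps are at least `-1`, so the path hits `-1` exactly when it first becomes negative. -/
theorem exists_first_passage {S : Finset ℕ} {g : ℕ → ℤ} (hg : ∀ b, -1 ≤ g b) {y : ℕ}
    (hy : ∑ b ∈ S with y < b, g b < 0) :
    ∃ y' ∈ S, y < y' ∧ ∑ b ∈ S with y < b ∧ b ≤ y', g b = -1 ∧
      ∀ x ∈ S, y < x → x ≤ y' → 0 ≤ ∑ b ∈ S with y < b ∧ b < x, g b := by
  have hne : ({t ∈ S | y < t ∧ ∑ b ∈ S with y < b ∧ b ≤ t, g b < 0} : Finset ℕ).Nonempty := by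
    have h1 : ({t ∈ S | y < t} : Finset ℕ).Nonempty := by
      by_contra hcon
      rw [not_nonempty_iff_eq_empty] at hcon
      rw [hcon] at hy
      simp at hy
    obtain ⟨m, hm1, hm2⟩ : ∃ m ∈ ({t ∈ S | y < t} : Finset ℕ),
        ∀ z ∈ ({t ∈ S | y < t} : Finset ℕ), z ≤ m :=
      ⟨_, max'_mem _ h1, fun z hz => le_max' _ _ hz⟩
    rw [mem_filter] at hm1
    refine ⟨m, mem_filter.2 ⟨hm1.1, hm1.2, ?_⟩⟩
    rwa [sum_filter_congr' (q := fun b => y < b) fun z hz =>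
      ⟨fun h => h.1, fun h => ⟨h, hm2 z (mem_filter.2 ⟨hz, h⟩)⟩⟩]
  obtain ⟨t, ht1, ht2⟩ : ∃ t ∈ ({t ∈ S | y < t ∧ ∑ b ∈ S with y < b ∧ b ≤ t, g b < 0} : Finset ℕ),
      ∀ z ∈ ({t ∈ S | y < t ∧ ∑ b ∈ S with y < b ∧ b ≤ t, g b < 0} : Finset ℕ), t ≤ z :=
    ⟨_, min'_mem _ hne, fun z hz => min'_le _ _ hz⟩
  rw [mem_filter] at ht1
  have hpre : ∀ x ∈ S, y < x → x ≤ t → 0 ≤ ∑ b ∈ S with y < b ∧ b < x, g b := by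
    intro x hx hyx hxt
    by_cases hne : ({z ∈ S | y < z ∧ z < x} : Finset ℕ).Nonempty
    · obtain ⟨p, hp1, hp2⟩ : ∃ p ∈ ({z ∈ S | y < z ∧ z < x} : Finset ℕ),
          ∀ z ∈ ({z ∈ S | y < z ∧ z < x} : Finset ℕ), z ≤ p :=
        ⟨_, max'_mem _ hne, fun z hz => le_max' _ _ hz⟩
      rw [mem_filter] at hp1
      rw [sum_filter_congr' (q := fun b => y < b ∧ b ≤ p) fun z hz =>
        ⟨fun h => ⟨h.1, hp2 z (mem_filter.2 ⟨hz, h⟩)⟩, fun h => by omega⟩]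
      by_contra hcon
      have := ht2 p (mem_filter.2 ⟨hp1.1, hp1.2.1, by omega⟩)
      omega
    · rw [not_nonempty_iff_eq_empty.1 hne, sum_empty]
  refine ⟨t, ht1.1, ht1.2.1, ?_, hpre⟩
  have h1 := hpre t ht1.1 ht1.2.1 le_rfl
  have h2 := sum_filter_eq_add (S := S) (g := g) (p := fun b => y < b ∧ b ≤ t)
    (q := fun b => y < b ∧ b < t) (r := fun b => b = t) fun z _ => by omega
  rw [filter_eq', if_pos ht1.1, sum_singleton] at h2
  have h3 := hg t
  have h4 := ht1.2.2
  omega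

/-- Without the bonus the total is `-1 - d`, and the part up to and including `c` contributes at
least `-1`; so the path falls by at least `d` after `c`. The `d` successive first passages are the
remaining cut points. -/
theorem IsLuk.exists_cut {S : Finset ℕ} {d c : ℕ} {g : ℕ → ℤ} (hg : ∀ b, -1 ≤ g b) (hc : c ∈ S)
    (h : IsLuk (fun b => g b + if b = c then (d : ℤ) else 0) S) :
    ∃ e, e 0 = c ∧ IsCut S e d ∧ ∀ i ≤ d, IsLuk g (arc S e d i) := by
  have hind : ∀ (p : ℕ → Prop) [DecidablePred p],
      ∑ b ∈ S with p b, (g b + if b = c then (d : ℤ) else 0) =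
      ∑ b ∈ S with p b, g b + if p c then (d : ℤ) else 0 := by
    intro p _
    rw [sum_add_distrib, sum_ite_eq' _ c]
    simp [hc]
  obtain ⟨hpre, hsum⟩ := h
  have hpre' : ∀ x ∈ S, 0 ≤ ∑ b ∈ S with b < x, g b + if c < x then (d : ℤ) else 0 := by
    intro x hx
    rw [← hind]
    exact hpre x hx
  have hsum' : ∑ b ∈ S, g b = -1 - d := by
    rw [sum_add_distrib, sum_ite_eq' _ c, if_pos hc] at hsum
    linarith
  have hafter : ∑ b ∈ S with c < b, g b ≤ -d := by
    have h1 := hpre' c hc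
    rw [if_neg (by omega), add_zero] at h1
    have h2 := sum_filter_eq_add (S := S) (g := g) (p := fun b => b ≤ c)
      (q := fun b => b < c) (r := fun b => b = c) fun z _ => by omega
    rw [filter_eq', if_pos hc, sum_singleton] at h2
    have h3 := sum_filter_eq_add (S := S) (g := g) (p := fun _ => True)
      (q := fun b => b ≤ c) (r := fun b => c < b) fun z _ => by simp only [true_iff]; omega
    rw [filter_true, hsum'] at h3
    have h4 := hg c
    omega
  obtain ⟨e, he0, heQ, heR⟩ := exists_seq_of_step (d := d)
    (fun i y => y ∈ S ∧ ∑ b ∈ S with y < b, g b ≤ -d + i)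
    (fun y y' => y < y' ∧ ∑ b ∈ S with y < b ∧ b ≤ y', g b = -1 ∧
      ∀ x ∈ S, y < x → x ≤ y' → 0 ≤ ∑ b ∈ S with y < b ∧ b < x, g b) (x := c)
    ⟨hc, by simpa using hafter⟩ (by
      rintro i hi y ⟨hyS, hy⟩
      obtain ⟨y', h1, h2, h3, h4⟩ := exists_first_passage hg (S := S) (y := y) (by omega)
      refine ⟨y', ⟨h2, h3, h4⟩, h1, ?_⟩
      have h5 := sum_filter_eq_add (S := S) (g := g) (p := fun b => y < b)
        (q := fun b => y < b ∧ b ≤ y') (r := fun b => y' < b) fun z _ => by omega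
      push_cast
      omega)
  have hcut : IsCut S e d := ⟨fun i hi => (heQ i hi).1, fun i hi => (heR i hi).1⟩
  refine ⟨e, he0, hcut, fun i hi => ?_⟩
  cases i with
  | succ i => exact isLuk_arc_succ.2 ⟨(heR i hi).2.2, (heR i hi).2.1⟩
  | zero =>
    have htel := sum_Ioc_of_isLuk (fun i hi => ⟨(heR i hi).1, (heR i hi).2.1⟩) (le_refl d)
    refine ⟨fun x hx => ?_, ?_⟩
    · simp only [arc, mem_filter, filter_filter] at hx ⊢
      have h1 := hpre' x hx.1
      by_cases hx0 : x ≤ e 0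
      · rw [if_neg (by omega), add_zero] at h1
        rwa [sum_filter_congr' (q := fun b => b < x) fun z _ => by omega]
      · rw [if_pos (by omega), sum_filter_eq_add (q := fun b => (b ≤ e 0 ∨ e d < b) ∧ b < x)
          (r := fun b => e 0 < b ∧ b ≤ e d) fun z _ => by omega, htel.2] at h1
        omega
    · have h2 := sum_filter_eq_add (S := S) (g := g) (p := fun _ => True)
        (q := fun b => b ≤ e 0 ∨ e d < b) (r := fun b => e 0 < b ∧ b ≤ e d) fun z _ => by
          simp only [true_iff]; omega
      rw [filter_true, htel.2, hsum'] at h2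
      simp only [arc]
      omega

/-- A first passage is unique: if the path has reached `-1` at `y₁`, it cannot stay nonnegative
before some `y₂ > y₁`. Applied both ways, this identifies two cuts with the same starting point. -/
theorem arc_end_le {S : Finset ℕ} {g : ℕ → ℤ} {y y₁ y₂ : ℕ} (h2S : y₂ ∈ S) (h1 : y < y₁)
    (hsum : ∑ b ∈ S with y < b ∧ b ≤ y₁, g b = -1)
    (hpre : ∀ x ∈ S, y < x → x ≤ y₂ → 0 ≤ ∑ b ∈ S with y < b ∧ b < x, g b) : y₂ ≤ y₁ := by
  by_contra hlt
  obtain ⟨w, hw1, hw2⟩ : ∃ w ∈ ({z ∈ S | y₁ < z} : Finset ℕ),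
      ∀ z ∈ ({z ∈ S | y₁ < z} : Finset ℕ), w ≤ z :=
    have hne : ({z ∈ S | y₁ < z} : Finset ℕ).Nonempty := ⟨y₂, mem_filter.2 ⟨h2S, by omega⟩⟩
    ⟨_, min'_mem _ hne, fun z hz => min'_le _ _ hz⟩
  rw [mem_filter] at hw1
  have h3 := hpre w hw1.1 (by omega) (hw2 _ (mem_filter.2 ⟨h2S, by omega⟩))
  rw [sum_filter_congr' (q := fun b => y < b ∧ b ≤ y₁) fun z hz => ⟨fun h => ⟨h.1, ?_⟩,
    fun h => by omega⟩, hsum] at h3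
  · omega
  · by_contra hcon
    have := hw2 z (mem_filter.2 ⟨hz, by omega⟩)
    omega

theorem IsCut.eq_of_isLuk {S : Finset ℕ} {e e' : ℕ → ℕ} {d : ℕ} {g : ℕ → ℤ} (h : IsCut S e d)
    (h' : IsCut S e' d) (h0 : e 0 = e' 0) (hl : ∀ i ≤ d, IsLuk g (arc S e d i))
    (hl' : ∀ i ≤ d, IsLuk g (arc S e' d i)) {i : ℕ} (hi : i ≤ d) : e i = e' i := by
  induction i with
  | zero => exact h0
  | succ i ih =>
    obtain ⟨h1, h2⟩ := isLuk_arc_succ.1 (hl (i + 1) hi)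
    obtain ⟨h3, h4⟩ := isLuk_arc_succ.1 (hl' (i + 1) hi)
    have h5 := h.lt_succ i hi
    have h6 := h'.lt_succ i hi
    rw [← ih (by omega)] at h3 h4 h6
    exact le_antisymm (arc_end_le (h.mem _ hi) h6 h4 h1) (arc_end_le (h'.mem _ hi) h5 h2 h3)

theorem arc_congr {S : Finset ℕ} {e e' : ℕ → ℕ} {d : ℕ} (h : ∀ i ≤ d, e i = e' i) {i : ℕ}
    (hi : i ≤ d) : arc S e d i = arc S e' d i := by
  cases i with
  | zero => simp only [arc, h 0 hi, h d le_rfl]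
  | succ i => simp only [arc, h i (by omega), h (i + 1) hi]

/-- The weight of `b` in the lattice path of the word `w`. -/
def pathWeight (d : ℕ) (w : List ℕ) (b : ℕ) : ℤ := d * w.count b - 1

theorem neg_one_le_pathWeight (d : ℕ) (w : List ℕ) (b : ℕ) : -1 ≤ pathWeight d w b := by
  have : (0 : ℤ) ≤ d * w.count b := by positivity
  unfold pathWeight
  omega

theorem pathWeight_append_singleton (d : ℕ) (w : List ℕ) (c : ℕ) :
    pathWeight d (w ++ [c]) = fun b => pathWeight d w b + if b = c then (d : ℤ) else 0 := by
  funext b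
  simp only [pathWeight, List.count_append, List.count_singleton]
  by_cases h : b = c
  · subst h
    simp
    ring
  · simp [h, Ne.symm h]

/-- The total weight is `d` times a count minus `#B`; reduce the equation with `-1` modulo `d`. -/
theorem IsLuk.card {d : ℕ} {w : List ℕ} {B : Finset ℕ} (h : IsLuk (pathWeight d w) B) :
    ((#B : ℕ) : ZMod d) = 1 := by
  have h1 := h.2
  simp only [pathWeight, sum_sub_distrib, sum_const, ← mul_sum] at h1
  have h2 := congrArg (Int.cast : ℤ → ZMod d) h1
  push_cast at h2
  simp at h2
  exact h2

/-- The word `w` induces a parking function on every block of `P`. -/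
structure IsCompatible (d : ℕ) (P : Finset (Finset ℕ)) (w : List ℕ) : Prop where
  isLuk : ∀ B ∈ P, IsLuk (pathWeight d w) B
  mem : ∀ x ∈ w, ∃ B ∈ P, x ∈ B

section Steps

variable {d n : ℕ}

theorem isLuk_add_of_notMem {g : ℕ → ℤ} {B : Finset ℕ} {c : ℕ} {t : ℤ} (hc : c ∉ B) :
    IsLuk (fun b => g b + if b = c then t else 0) B ↔ IsLuk g B := by
  have : ∀ b ∈ B, (g b + if b = c then t else 0) = g b := fun b hb => by
    have hne : b ≠ c := by
      rintro rfl
      exact hc hb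
    rw [if_neg hne, add_zero]
  unfold IsLuk
  rw [sum_congr rfl this]
  refine and_congr (forall₂_congr fun x hx => ?_) Iff.rfl
  rw [sum_congr rfl fun b hb => this b (filter_subset _ _ hb)]

theorem IsCompatible.of_split (hn : (n : ZMod d) = 1) {π σ : NC d n} {w : List ℕ}
    (hw : IsCompatible d π.1.parts w) {S : Finset ℕ} (hS : S ∈ σ.1.parts) {e : ℕ → ℕ}
    (h : IsCut S e d) (hπ : π.1.parts = splitFamily σ.1.parts S e d) :
    IsCompatible d σ.1.parts (w ++ [e 0]) := by
  have hσ := (isIndivisible_iff hn σ.1).1 σ.2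
  refine ⟨fun B hB => ?_, fun x hx => ?_⟩
  · rw [pathWeight_append_singleton]
    by_cases hBS : B = S
    · subst hBS
      exact h.isLuk_of_arcs fun i hi =>
        hw.isLuk _ (hπ ▸ mem_splitFamily.2 (Or.inr ⟨i, hi, rfl⟩))
    · rw [isLuk_add_of_notMem fun hmem =>
        hBS (hσ.eq_of_mem B hB S hS _ hmem (h.mem 0 (Nat.zero_le _)))]
      exact hw.isLuk _ (hπ ▸ mem_splitFamily.2 (Or.inl ⟨hBS, hB⟩))
  · rw [List.mem_append, List.mem_singleton] at hx
    rcases hx with hx | rfl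
    · obtain ⟨B, hB, hxB⟩ := hw.mem x hx
      rcases mem_splitFamily.1 (hπ ▸ hB) with ⟨-, hB⟩ | ⟨i, hi, rfl⟩
      · exact ⟨B, hB, hxB⟩
      · exact ⟨S, hS, arc_subset _ _ _ _ hxB⟩
    · exact ⟨S, hS, h.mem 0 (Nat.zero_le _)⟩

theorem IsCompatible.of_covBy (hd : 0 < d) (hn : (n : ZMod d) = 1) {π σ : NC d n} {w : List ℕ}
    (hw : IsCompatible d π.1.parts w) (h : π ⋖ σ) :
    IsCompatible d σ.1.parts (w ++ [edgeLabel π.1 σ.1]) := by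
  obtain ⟨S, hS, e, he, hπ⟩ := exists_split_of_covBy hd hn h
  rw [edgeLabel_of_split hd hn hS he hπ]
  exact hw.of_split hn hS he hπ

theorem IsCompatible.exists_covBy (hd : 0 < d) (hn : (n : ZMod d) = 1) {σ : NC d n} {w : List ℕ}
    {c : ℕ} (hw : IsCompatible d σ.1.parts (w ++ [c])) :
    ∃ π : NC d n, π ⋖ σ ∧ edgeLabel π.1 σ.1 = c ∧ IsCompatible d π.1.parts w := by
  have hσ := (isIndivisible_iff hn σ.1).1 σ.2
  obtain ⟨S, hS, hcS⟩ := hw.mem c (by simp)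
  have hluk := hw.isLuk S hS
  rw [pathWeight_append_singleton] at hluk
  obtain ⟨e, rfl, hcut, harc⟩ := hluk.exists_cut (neg_one_le_pathWeight d w) hcS
  obtain ⟨π, hπ⟩ := exists_split_parts hn σ hS hcut fun i hi => (harc (i + 1) hi).card
  refine ⟨π, covBy_of_split hd hn hS hcut hπ, edgeLabel_of_split hd hn hS hcut hπ,
    fun B hB => ?_, fun x hx => ?_⟩
  · rcases mem_splitFamily.1 (hπ ▸ hB) with ⟨hBS, hB⟩ | ⟨i, hi, rfl⟩
    · have h1 := hw.isLuk B hB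
      rwa [pathWeight_append_singleton, isLuk_add_of_notMem fun hmem =>
        hBS (hσ.eq_of_mem B hB S hS _ hmem hcS)] at h1
    · exact harc i hi
  · obtain ⟨B, hB, hxB⟩ := hw.mem x (by simp [hx])
    exact (((isIndivisible_iff hn π.1).1 π.2).mem_iff x).1 ((hσ.mem_iff x).2 ⟨B, hB, hxB⟩)

theorem IsCompatible.eq_of_covBy (hd : 0 < d) (hn : (n : ZMod d) = 1) {π π' σ : NC d n}
    {w : List ℕ} (h : π ⋖ σ) (h' : π' ⋖ σ) (hlab : edgeLabel π.1 σ.1 = edgeLabel π'.1 σ.1)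
    (hw : IsCompatible d π.1.parts w) (hw' : IsCompatible d π'.1.parts w) : π = π' := by
  have hσ := (isIndivisible_iff hn σ.1).1 σ.2
  obtain ⟨S, hS, e, he, hπ⟩ := exists_split_of_covBy hd hn h
  obtain ⟨S', hS', e', he', hπ'⟩ := exists_split_of_covBy hd hn h'
  rw [edgeLabel_of_split hd hn hS he hπ, edgeLabel_of_split hd hn hS' he' hπ'] at hlab
  obtain rfl := hσ.eq_of_mem S hS S' hS' (e 0) (he.mem 0 (Nat.zero_le _))
    (hlab ▸ he'.mem 0 (Nat.zero_le _))
  have hee : ∀ i ≤ d, e i = e' i := fun i hi => he.eq_of_isLuk he' hlab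
    (fun i hi => hw.isLuk _ (hπ ▸ mem_splitFamily.2 (Or.inr ⟨i, hi, rfl⟩)))
    (fun i hi => hw'.isLuk _ (hπ' ▸ mem_splitFamily.2 (Or.inr ⟨i, hi, rfl⟩))) hi
  refine Subtype.ext (Finpartition.ext ?_)
  rw [hπ, hπ', splitFamily, splitFamily]
  congr 1
  exact image_congr fun i hi => arc_congr hee (by simpa [Nat.lt_succ_iff] using hi)

end Steps

end IndivNC

/-! ### Maximal chains and parking functions -/

namespace IndivNC

theorem sum_count_eq_countP (s : Finset ℕ) (a : List ℕ) :
    ∑ b ∈ s, (a.count b : ℤ) = a.countP (· ∈ s) := by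
  induction a with
  | nil => simp
  | cons x a ih =>
    simp only [List.count_cons, List.countP_cons]
    push_cast
    rw [sum_add_distrib, ih]
    simp

theorem getElem_le_iff_of_pairwise {l : List ℕ} (h : l.Pairwise (· ≤ ·)) (m i : ℕ)
    (hi : i < l.length) : l[i] ≤ m ↔ i < l.countP (· ≤ m) := by
  induction l generalizing i with
  | nil => simp at hi
  | cons x l ih =>
    rw [List.pairwise_cons] at h
    by_cases hx : x ≤ m
    · cases i with
      | zero => simp [hx]
      | succ i =>
        have := ih h.2 i (by simpa using hi)
        simp [hx, this]
    · have h0 : l.countP (· ≤ m) = 0 := by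
        rw [List.countP_eq_zero]
        intro y hy
        have := h.1 y hy
        simp
        omega
      cases i with
      | zero => simp [hx, h0]
      | succ i =>
        have := h.1 (l[i]'(by simpa using hi)) (List.getElem_mem _)
        simp [hx, h0]
        omega

theorem isParkingFunction_iff (d : ℕ) (a : List ℕ) :
    IsParkingFunction d a ↔
      (∀ x ∈ a, 0 < x) ∧ ∀ i < a.length, i < a.countP (· ≤ d * i + 1) := by
  refine and_congr Iff.rfl ?_
  have hs : (a.insertionSort (· ≤ ·)).Pairwise (· ≤ ·) := List.pairwise_insertionSort _ _
  have hp := List.perm_insertionSort (· ≤ ·) a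
  simp only [getElem_le_iff_of_pairwise hs, hp.countP_eq, List.length_insertionSort]

theorem sum_pathWeight_lt {d n x : ℕ} {a : List ℕ} (ha : ∀ y ∈ a, y ∈ Icc 1 n)
    (hx : x ∈ Icc 1 n) : ∑ b ∈ Icc 1 n with b < x, pathWeight d a b =
      d * a.countP (· ≤ x - 1) - ((x - 1 : ℕ) : ℤ) := by
  simp only [pathWeight, sum_sub_distrib, sum_const, ← mul_sum, sum_count_eq_countP]
  have h1 : ({b ∈ Icc 1 n | b < x} : Finset ℕ) = Icc 1 (x - 1) := by
    ext z
    simp only [mem_filter, mem_Icc] at *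
    omega
  have h2 : a.countP (fun y => decide (y ∈ ({b ∈ Icc 1 n | b < x} : Finset ℕ))) =
      a.countP (· ≤ x - 1) := by
    refine List.countP_congr fun y hy => ?_
    have := ha y hy
    rw [h1]
    simp only [mem_Icc, decide_eq_true_eq] at *
    omega
  rw [h2, h1]
  simp

theorem sum_pathWeight {d n : ℕ} {a : List ℕ} (ha : ∀ y ∈ a, y ∈ Icc 1 n) :
    ∑ b ∈ Icc 1 n, pathWeight d a b = d * a.length - (n : ℤ) := by
  simp only [pathWeight, sum_sub_distrib, sum_const, ← mul_sum, sum_count_eq_countP]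
  have h2 : a.countP (fun y => decide (y ∈ Icc 1 n)) = a.length := by
    rw [List.countP_eq_length]
    intro y hy
    simpa using ha y hy
  rw [h2]
  simp

theorem mem_Icc_of_lt_countP {d k : ℕ} {a : List ℕ} (hlen : a.length = k)
    (hpos : ∀ x ∈ a, 0 < x) (hpark : ∀ i < a.length, i < a.countP (· ≤ d * i + 1)) :
    ∀ x ∈ a, x ∈ Icc 1 (d * k + 1) := by
  intro x hx
  have hk : 0 < k := hlen ▸ List.length_pos_of_mem hx
  have h1 := hpark (k - 1) (by omega)
  have h2 : a.countP (· ≤ d * (k - 1) + 1) = a.length :=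
    le_antisymm List.countP_le_length (by omega)
  rw [List.countP_eq_length] at h2
  have h3 := h2 x hx
  have h4 : d * (k - 1) ≤ d * k := Nat.mul_le_mul_left _ (by omega)
  simp only [decide_eq_true_eq] at h3
  exact mem_Icc.2 ⟨hpos x hx, by omega⟩

/-- The partial sum below `x` is `d` times the number of letters up to `x - 1`, minus `x - 1`. Its
nonnegativity for all `x` is the parking condition, which is tested only at the values `d * i + 1`.
-/
theorem isCompatible_top_iff {d k : ℕ} (hd : 0 < d) (a : List ℕ) :
    IsCompatible d (⊤ : NC d (d * k + 1)).1.parts a ↔ a.length = k ∧ IsParkingFunction d a := by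
  have htop : (⊤ : NC d (d * k + 1)).1.parts = {Icc 1 (d * k + 1)} := rfl
  rw [isParkingFunction_iff, htop]
  constructor
  · rintro ⟨h1, h2⟩
    simp only [mem_singleton, forall_eq, exists_eq_left] at h1 h2
    obtain ⟨h3, h4⟩ := h1
    rw [sum_pathWeight h2] at h4
    have hlen : a.length = k := by
      have : (d : ℤ) * a.length = d * k := by push_cast at h4; linarith
      exact_mod_cast mul_left_cancel₀ (by positivity) this
    refine ⟨hlen, fun x hx => (mem_Icc.1 (h2 x hx)).1, fun i hi => ?_⟩
    have hik : d * i + d ≤ d * k := by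
      rw [← Nat.mul_succ]
      exact Nat.mul_le_mul_left _ (by omega)
    -- At `d * i + 2` the path condition says `d * count ≥ d * i + 1`, that is, `count > i`.
    have hx : d * i + 2 ∈ Icc 1 (d * k + 1) := by simp; omega
    have h5 := h3 _ hx
    rw [sum_pathWeight_lt h2 hx] at h5
    by_contra hcon
    have h6 : d * a.countP (· ≤ d * i + 1) ≤ d * i := Nat.mul_le_mul_left _ (by omega)
    have h7 : d * i + 2 - 1 = d * i + 1 := by omega
    rw [h7] at h5
    generalize a.countP (· ≤ d * i + 1) = t at h5 h6
    push_cast at h5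
    zify at h6
    linarith
  · rintro ⟨hlen, hpos, hpark⟩
    have hmem := mem_Icc_of_lt_countP hlen hpos hpark
    refine ⟨?_, fun x hx => ⟨_, mem_singleton_self _, hmem x hx⟩⟩
    simp only [mem_singleton, forall_eq]
    refine ⟨fun x hx => ?_, ?_⟩
    · rw [sum_pathWeight_lt hmem hx]
      obtain ⟨m, hm⟩ : ∃ m, x - 1 = m := ⟨_, rfl⟩
      rw [hm]
      have hx' := mem_Icc.1 hx
      suffices h : m ≤ d * a.countP (· ≤ m) by
        generalize a.countP (· ≤ m) = t at h
        zify at h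
        linarith
      rcases Nat.eq_zero_or_pos m with rfl | hm0
      · omega
      -- With `i = (m - 1) / d` one has `d * i + 1 ≤ m ≤ d * (i + 1)`, so the test value `d * i + 1`
      -- suffices for `m`.
      have h1 := Nat.div_add_mod (m - 1) d
      have h2 := Nat.mod_lt (m - 1) hd
      have h3 : (m - 1) / d < k := by
        rw [Nat.div_lt_iff_lt_mul hd, mul_comm]
        omega
      have h4 := hpark _ (hlen ▸ h3)
      have h5 : a.countP (· ≤ d * ((m - 1) / d) + 1) ≤ a.countP (· ≤ m) := by
        refine List.countP_mono_left fun y _ hy => ?_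
        simp only [decide_eq_true_eq] at hy ⊢
        omega
      have h6 := Nat.mul_le_mul_left d (h4.trans_le h5)
      rw [Nat.mul_succ] at h6
      omega
    · rw [sum_pathWeight hmem, hlen]
      push_cast
      ring

theorem isCompatible_bot (d k : ℕ) : IsCompatible d (⊥ : NC d (d * k + 1)).1.parts [] := by
  refine ⟨fun B hB => ?_, by simp⟩
  obtain ⟨x, -, rfl⟩ := Finpartition.mem_bot_iff.1 hB
  simp [IsLuk, pathWeight]

theorem eq_bot_of_isCompatible_nil {d k : ℕ} {σ : NC d (d * k + 1)}
    (h : IsCompatible d σ.1.parts []) : σ = ⊥ := by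
  refine le_bot_iff.1 fun B hB => ?_
  have h1 := (h.isLuk B hB).2
  simp only [pathWeight, List.count_nil, sum_const] at h1
  have h2 : #B = 1 := by
    simp at h1
    exact h1
  obtain ⟨x, rfl⟩ := card_eq_one.1 h2
  exact ⟨{x}, Finpartition.mem_bot_iff.2 ⟨x, σ.1.le hB (mem_singleton_self x), rfl⟩, le_rfl⟩

/-- The list of labels of a saturated chain. -/
noncomputable def seriesLabels {d n : ℕ}
    (c : RelSeries ({p | p.1 ⋖ p.2} : SetRel (NC d n) (NC d n))) : List ℕ :=
  List.ofFn fun i : Fin c.length => edgeLabel (c i.castSucc).1 (c i.succ).1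

theorem seriesLabels_snoc {d n : ℕ} (c : RelSeries ({p | p.1 ⋖ p.2} : SetRel (NC d n) (NC d n)))
    (x : NC d n) (h : c.last ⋖ x) :
    seriesLabels (c.snoc x h) = seriesLabels c ++ [edgeLabel c.last.1 x.1] := by
  have h1 : (c.snoc x h).length = c.length + 1 := rfl
  have h2 : seriesLabels (c.snoc x h) = List.ofFn fun i : Fin (c.length + 1) =>
    edgeLabel ((c.snoc x h) i.castSucc).1 ((c.snoc x h) i.succ).1 := rfl
  have h3 : ∀ j : Fin (c.length + 1), (c.snoc x h).toFun (Fin.castSucc j) = c j :=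
    RelSeries.snoc_castSucc c x h
  rw [h2, List.ofFn_succ', List.concat_eq_append, seriesLabels]
  congr 1
  · congr 1
    funext i
    exact congrArg₂ (fun p q : NC d n => edgeLabel p.1 q.1) (h3 _) (h3 i.succ)
  · exact congrArg (fun y => [y]) (congrArg₂ (fun p q : NC d n => edgeLabel p.1 q.1)
      (h3 (Fin.last _)) (RelSeries.last_snoc' c x h))

theorem exists_eq_snoc {α : Type*} {r : SetRel α α} (p : RelSeries r) (h : p.length ≠ 0) :
    ∃ (q : RelSeries r) (x : α) (hx : (q.last, x) ∈ r), p = q.snoc x hx :=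
  ⟨p.eraseLast, p.last, p.eraseLast_last_rel_last h, (p.snoc_self_eraseLast h).symm⟩

theorem eq_singleton_of_length_eq_zero {α : Type*} {r : SetRel α α} (p : RelSeries r)
    (h : p.length = 0) : p = RelSeries.singleton r p.head := by
  obtain ⟨n, f, hf⟩ := p
  obtain rfl : n = 0 := h
  refine RelSeries.ext rfl (funext fun i => ?_)
  have hi : i = (0 : Fin (0 + 1)) := Fin.ext (Nat.lt_one_iff.1 i.2)
  subst hi
  rfl

section Chains

variable {d k : ℕ}

theorem natCast_mul_add_one : ((d * k + 1 : ℕ) : ZMod d) = 1 := by simp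

theorem isCompatible_seriesLabels (hd : 0 < d)
    (c : RelSeries ({p | p.1 ⋖ p.2} : SetRel (NC d (d * k + 1)) (NC d (d * k + 1))))
    (h : c.head = ⊥) : IsCompatible d c.last.1.parts (seriesLabels c) := by
  suffices H : ∀ N, ∀ c : RelSeries ({p | p.1 ⋖ p.2} :
      SetRel (NC d (d * k + 1)) (NC d (d * k + 1))), c.length = N → c.head = ⊥ →
      IsCompatible d c.last.1.parts (seriesLabels c) from H _ c rfl h
  intro N
  induction N with
  | zero =>
    intro c hN hc
    rw [eq_singleton_of_length_eq_zero c hN, hc, RelSeries.last_singleton]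
    exact isCompatible_bot d k
  | succ N ih =>
    intro c hN hc
    obtain ⟨q, x, hx, rfl⟩ := exists_eq_snoc c (by omega)
    rw [RelSeries.head_snoc] at hc
    rw [RelSeries.last_snoc, seriesLabels_snoc q x hx]
    exact (ih q (by simpa using hN) hc).of_covBy hd natCast_mul_add_one hx

theorem seriesLabels_injective (hd : 0 < d) :
    ∀ c c' : RelSeries ({p | p.1 ⋖ p.2} : SetRel (NC d (d * k + 1)) (NC d (d * k + 1))),
      c.head = ⊥ → c'.head = ⊥ → c.last = c'.last → seriesLabels c = seriesLabels c' →
      c = c' := by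
  suffices H : ∀ N, ∀ c c' : RelSeries ({p | p.1 ⋖ p.2} :
      SetRel (NC d (d * k + 1)) (NC d (d * k + 1))), c.length = N → c'.length = N →
      c.head = ⊥ → c'.head = ⊥ → c.last = c'.last → seriesLabels c = seriesLabels c' →
      c = c' by
    intro c c' h1 h2 h3 h4
    have h5 := congrArg List.length h4
    simp only [seriesLabels, List.length_ofFn] at h5
    exact H _ c c' rfl h5.symm h1 h2 h3 h4
  intro N
  induction N with
  | zero =>
    intro c c' h1 h2 h3 h4 _ _
    rw [eq_singleton_of_length_eq_zero c h1, eq_singleton_of_length_eq_zero c' h2, h3, h4]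
  | succ N ih =>
    intro c c' h1 h2 h3 h4 h5 h6
    obtain ⟨q, x, hx, rfl⟩ := exists_eq_snoc c (by omega)
    obtain ⟨q', x', hx', rfl⟩ := exists_eq_snoc c' (by omega)
    rw [RelSeries.head_snoc] at h3 h4
    rw [RelSeries.last_snoc, RelSeries.last_snoc] at h5
    subst h5
    rw [seriesLabels_snoc q x hx, seriesLabels_snoc q' x hx'] at h6
    obtain ⟨h7, h8⟩ := List.append_inj' h6 rfl
    have h9 := isCompatible_seriesLabels hd q h3
    have h10 := isCompatible_seriesLabels hd q' h4
    rw [← h7] at h10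
    have h11 := IsCompatible.eq_of_covBy hd natCast_mul_add_one hx hx' (by simpa using h8) h9 h10
    obtain rfl := ih q q' (by simpa using h1) (by simpa using h2) h3 h4 h11 h7
    rfl

theorem exists_series_of_isCompatible (hd : 0 < d) (a : List ℕ) :
    ∀ σ : NC d (d * k + 1), IsCompatible d σ.1.parts a →
      ∃ c : RelSeries ({p | p.1 ⋖ p.2} : SetRel (NC d (d * k + 1)) (NC d (d * k + 1))),
        c.head = ⊥ ∧ c.last = σ ∧ seriesLabels c = a := by
  induction a using List.reverseRecOn with
  | nil =>
    intro σ h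
    obtain rfl := eq_bot_of_isCompatible_nil h
    exact ⟨RelSeries.singleton _ ⊥, RelSeries.head_singleton _, RelSeries.last_singleton _, rfl⟩
  | append_singleton a x ih =>
    intro σ h
    obtain ⟨π, hπ, rfl, hcomp⟩ := h.exists_covBy hd natCast_mul_add_one
    obtain ⟨c, hc1, rfl, rfl⟩ := ih π hcomp
    exact ⟨c.snoc σ hπ, by rw [RelSeries.head_snoc, hc1], RelSeries.last_snoc _ _ _,
      seriesLabels_snoc _ _ _⟩

theorem card_parts_of_covBy (hd : 0 < d) {π σ : NC d (d * k + 1)} (h : π ⋖ σ) :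
    #π.1.parts = #σ.1.parts + d := by
  obtain ⟨S, hS, e, he, hπ⟩ := exists_split_of_covBy hd natCast_mul_add_one h
  exact card_parts_of_split hd natCast_mul_add_one hS he hπ

/-- The number of blocks drops by `d` at each step, so `λ*` decreases exactly when `a_i < a_{i+1} +
d`. -/
theorem isFalling_iff (hd : 0 < d) (c : MaximalChain (NC d (d * k + 1))) :
    IsFalling c ↔ ∀ (i : ℕ) (hi : i + 1 < (chainLabels c).length),
      (chainLabels c)[i] ≤ (chainLabels c)[i + 1] + d - 1 := by
  rw [IsFalling, chainLabelsStar, List.isChain_ofFn]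
  have hlen : (chainLabels c).length = c.1.length := List.length_ofFn
  have key : ∀ (i : ℕ) (hi : i + 1 < c.1.length) (hi' : i + 1 < (chainLabels c).length),
      edgeLabelStar (c.1 (⟨i, by omega⟩ : Fin c.1.length).castSucc).1
        (c.1 (⟨i, by omega⟩ : Fin c.1.length).succ).1 >
      edgeLabelStar (c.1 (⟨i + 1, hi⟩ : Fin c.1.length).castSucc).1
        (c.1 (⟨i + 1, hi⟩ : Fin c.1.length).succ).1 ↔
      (chainLabels c)[i] ≤ (chainLabels c)[i + 1] + d - 1 := by
    intro i hi hi'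
    have h1 : #(c.1 (⟨i, by omega⟩ : Fin c.1.length).castSucc).1.parts =
      #(c.1 (⟨i + 1, hi⟩ : Fin c.1.length).castSucc).1.parts + d :=
      card_parts_of_covBy hd (c.1.step ⟨i, by omega⟩)
    simp only [chainLabels, List.getElem_ofFn, edgeLabelStar, h1]
    push_cast
    omega
  exact ⟨fun h i hi => (key i (hlen ▸ hi) hi).1 (h i (hlen ▸ hi)),
    fun h i hi => (key i hi (hlen.symm ▸ hi)).2 (h i (hlen.symm ▸ hi))⟩

theorem bijOn_chainLabels (hd : 0 < d) :
    Set.BijOn chainLabels {c : MaximalChain (NC d (d * k + 1)) | IsFalling c}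
      (restrictedParkingFunctions d k) := by
  refine ⟨?_, ?_, ?_⟩
  · intro c hc
    have h1 := isCompatible_seriesLabels hd c.1 c.2.1
    rw [c.2.2] at h1
    obtain ⟨h2, h3⟩ := (isCompatible_top_iff hd _).1 h1
    exact ⟨h2, h3, (isFalling_iff hd c).1 hc⟩
  · intro c _ c' _ h
    exact Subtype.ext (seriesLabels_injective hd c.1 c'.1 c.2.1 c'.2.1
      (c.2.2.trans c'.2.2.symm) h)
  · rintro a ⟨h1, h2, h3⟩
    obtain ⟨c, hc1, hc2, rfl⟩ := exists_series_of_isCompatible hd a ⊤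
      ((isCompatible_top_iff hd a).2 ⟨h1, h2⟩)
    exact ⟨⟨c, hc1, hc2⟩, (isFalling_iff hd _).2 h3, rfl⟩

end Chains

end IndivNC

/-! ### Raney numbers and their generating functions -/

namespace IndivNC

/-- The Raney numbers `r / (t k + r) * (t k + r).choose k`. -/
def raney (t : ℕ) : ℕ → ℕ → ℕ
  | 0, _ => 1
  | _ + 1, 0 => 0
  | k + 1, r + 1 => raney t (k + 1) r + raney t k (r + t)
termination_by k r => (k, r)

theorem raney_zero_left (t r : ℕ) : raney t 0 r = 1 := by
  rw [raney]

theorem raney_succ_zero (t k : ℕ) : raney t (k + 1) 0 = 0 := by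
  rw [raney]

theorem raney_succ_succ (t k r : ℕ) :
    raney t (k + 1) (r + 1) = raney t (k + 1) r + raney t k (r + t) := by
  rw [raney]

/-- The closed form, cleared of denominators, satisfies the defining recursion: both terms of the
recursion have the same `N = t * (k + 1) + r`, and Pascal's rule with the absorption identity `h4`
combines them. -/
theorem mul_raney {t : ℕ} (ht : 0 < t) (k r : ℕ) :
    (t * k + r) * raney t k r = r * (t * k + r).choose k := by
  induction k generalizing r with
  | zero => simp [raney_zero_left]
  | succ k ihk =>
    induction r with
    | zero => simp [raney_succ_zero]
    | succ r ihr =>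
      have h1 := ihk (r + t)
      obtain ⟨N, hN⟩ : ∃ N, t * (k + 1) + r = N := ⟨_, rfl⟩
      have h2 : t * k + (r + t) = N := by rw [← hN]; ring
      have h3 : t * (k + 1) + (r + 1) = N + 1 := by rw [← hN]; ring
      have hpos : 0 < N := by rw [← hN]; positivity
      rw [hN] at ihr
      rw [h2] at h1
      rw [h3, raney_succ_succ, Nat.choose_succ_succ]
      have h4 : (k + 1) * N.choose (k + 1) + k * N.choose k = N * N.choose k := by
        have := Nat.add_one_mul_choose_eq N k
        rw [Nat.choose_succ_succ] at this
        nlinarith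
      refine Nat.eq_of_mul_eq_mul_left hpos ?_
      zify at *
      have hN' : (N : ℤ) = t * (k + 1) + r := hN.symm
      linear_combination ((N : ℤ) + 1) * ihr + ((N : ℤ) + 1) * h1 -
        (t : ℤ) * h4 - ((N.choose k : ℤ) + N.choose (k + 1)) * hN'

theorem raney_one {t : ℕ} (ht : 0 < t) (k : ℕ) :
    (raney t k 1 : ℚ) = ((t * k).choose k : ℚ) / (t * k - k + 1) := by
  have h1 := mul_raney ht k 1
  have h2 := Nat.choose_mul_succ_eq (t * k) k
  have h3 : k ≤ t * k := Nat.le_mul_of_pos_left k ht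
  have h4 : ((t * k : ℚ) - k + 1) ≠ 0 := by
    have : (k : ℚ) ≤ t * k := by exact_mod_cast h3
    intro h
    linarith
  rw [eq_div_iff h4]
  have h5 : ((t * k + 1 : ℕ) : ℚ) ≠ 0 := by positivity
  refine mul_left_cancel₀ h5 ?_
  rw [one_mul] at h1
  have h6 : ((t * k + 1 - k : ℕ) : ℚ) = t * k - k + 1 := by
    rw [Nat.cast_sub (by omega)]
    push_cast
    ring
  rw [← h6, ← mul_assoc]
  norm_cast
  rw [h1, ← h2, mul_comm]

open PowerSeries

/-- The generating function of the Raney numbers. -/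
noncomputable def raneySeries (t r : ℕ) : ℤ⟦X⟧ := PowerSeries.mk fun k => (raney t k r : ℤ)

theorem raneySeries_zero (t : ℕ) : raneySeries t 0 = 1 := by
  ext k
  cases k <;> simp [raneySeries, raney_zero_left, raney_succ_zero, coeff_one]

theorem raneySeries_succ (t r : ℕ) :
    raneySeries t (r + 1) = raneySeries t r + X * raneySeries t (r + t) := by
  ext k
  cases k <;> simp [raneySeries, raney_zero_left, raney_succ_succ, coeff_succ_X_mul]

theorem raneySeries_mul (t r s : ℕ) :
    raneySeries t r * raneySeries t s = raneySeries t (r + s) := by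
  suffices H : ∀ k r, coeff k (raneySeries t r * raneySeries t s) =
      coeff k (raneySeries t (r + s)) from PowerSeries.ext fun k => H k r
  intro k
  induction k with
  | zero =>
    intro r
    simp [raneySeries, raney_zero_left]
  | succ k ih =>
    intro r
    induction r with
    | zero => rw [raneySeries_zero, one_mul, zero_add]
    | succ r ihr =>
      rw [raneySeries_succ, add_mul, mul_assoc, map_add, coeff_succ_X_mul, ihr, ih,
        show r + 1 + s = r + s + 1 by ring, raneySeries_succ, map_add, coeff_succ_X_mul,
        show r + t + s = r + s + t by ring]

theorem raneySeries_eq_pow (t r : ℕ) : raneySeries t r = raneySeries t 1 ^ r := by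
  induction r with
  | zero => rw [raneySeries_zero, pow_zero]
  | succ r ih => rw [pow_succ, ← ih, raneySeries_mul]

theorem raneySeries_one (t : ℕ) : raneySeries t 1 = 1 + X * raneySeries t 1 ^ t := by
  rw [← raneySeries_eq_pow, ← zero_add 1, raneySeries_succ, raneySeries_zero, zero_add]

theorem hasSubst_X_mul (u : ℤ⟦X⟧) : HasSubst (X * u) :=
  HasSubst.of_constantCoeff_zero' (by simp)

theorem constantCoeff_raneySeries (t r : ℕ) : constantCoeff (raneySeries t r) = 1 := by
  rw [← coeff_zero_eq_constantCoeff_apply]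
  simp [raneySeries, raney_zero_left]

theorem subst_raneySeries (t : ℕ) (u : ℤ⟦X⟧) :
    (raneySeries t 1).subst (X * u) = 1 + X * u * (raneySeries t 1).subst (X * u) ^ t := by
  have h := congrArg (substAlgHom (R := ℤ) (hasSubst_X_mul u)) (raneySeries_one t)
  simp only [map_add, map_one, map_mul, map_pow, substAlgHom_X] at h
  rwa [coe_substAlgHom] at h

/-- A power series with `g = 1 + X u g ^ d` satisfies `g = B (X u g ^ (-d))`, where `B` is the
generating function for the parameter `2 d`. -/
theorem subst_raneySeries_eq {d : ℕ} {g u v : ℤ⟦X⟧} (hg : g = 1 + X * u * g ^ d)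
    (hv : v * g ^ d = 1) : (raneySeries (2 * d) 1).subst (X * (u * v)) = g := by
  have h1 := subst_raneySeries (2 * d) (u * v)
  set b := (raneySeries (2 * d) 1).subst (X * (u * v)) with hb
  have h2 : g = 1 + X * (u * v) * g ^ (2 * d) := by
    rw [two_mul, pow_add]
    nth_rewrite 1 [hg]
    linear_combination (-X * u * g ^ d) * hv
  -- `b` and `g` solve the same fixed-point equation. Their difference is annihilated by a series
  -- with constant coefficient `1`, hence it is zero.
  obtain ⟨q, hq⟩ := sub_dvd_pow_sub_pow b g (2 * d)
  have h3 : (b - g) * (1 - X * (u * v * q)) = 0 := by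
    linear_combination h1 - h2 + X * (u * v) * hq
  rcases mul_eq_zero.1 h3 with h4 | h4
  · exact sub_eq_zero.1 h4
  · have := congrArg constantCoeff h4
    simp at this

/-- The series obtained from `f` by deleting the first `j` coefficients. -/
noncomputable def tailSeries (f : ℤ⟦X⟧) (j : ℕ) : ℤ⟦X⟧ :=
  PowerSeries.mk fun i => coeff (i + j) f

theorem tailSeries_zero (f : ℤ⟦X⟧) : tailSeries f 0 = f := by
  ext i
  simp [tailSeries]

theorem tailSeries_eq (f : ℤ⟦X⟧) (j : ℕ) :
    tailSeries f j = C (coeff j f) + X * tailSeries f (j + 1) := by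
  ext i
  cases i with
  | zero => simp [tailSeries]
  | succ i =>
    rw [map_add, coeff_C, if_neg (Nat.succ_ne_zero i), coeff_succ_X_mul, zero_add]
    simp only [tailSeries, coeff_mk]
    rw [show i + 1 + j = i + (j + 1) by omega]

theorem subst_tailSeries (f u : ℤ⟦X⟧) (j : ℕ) :
    (tailSeries f j).subst (X * u) =
      C (coeff j f) + X * u * (tailSeries f (j + 1)).subst (X * u) := by
  have h := congrArg (substAlgHom (R := ℤ) (hasSubst_X_mul u)) (tailSeries_eq f j)
  rw [map_add, map_mul, substAlgHom_X, coe_substAlgHom, subst_C] at h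
  exact h

theorem subst_eq_sum_add (f u : ℤ⟦X⟧) (N : ℕ) :
    f.subst (X * u) = ∑ i ∈ range N, C (coeff i f) * (X * u) ^ i +
      (X * u) ^ N * (tailSeries f N).subst (X * u) := by
  induction N with
  | zero => simp [tailSeries_zero]
  | succ N ih =>
    rw [sum_range_succ, ih, subst_tailSeries f u N]
    ring

end IndivNC

/-! ### Falling words and their parking prefix -/

namespace IndivNC

/-- The words of length `k` over the alphabet `s`. -/
def words (s : Finset ℕ) : ℕ → Finset (List ℕ)
  | 0 => {[]}
  | k + 1 => (s ×ˢ words s k).image fun p => p.1 :: p.2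

theorem mem_words {s : Finset ℕ} {k : ℕ} {l : List ℕ} :
    l ∈ words s k ↔ l.length = k ∧ ∀ x ∈ l, x ∈ s := by
  induction k generalizing l with
  | zero =>
    simp only [words, mem_singleton, List.length_eq_zero_iff]
    constructor
    · rintro rfl
      simp
    · exact fun h => h.1
  | succ k ih =>
    simp only [words, mem_image, mem_product, Prod.exists, ih]
    constructor
    · rintro ⟨a, w, ⟨ha, hw, hw'⟩, rfl⟩
      simp [hw, ha]
      exact hw'
    · rintro ⟨h1, h2⟩
      obtain ⟨a, w, rfl⟩ := List.exists_cons_of_length_eq_add_one h1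
      exact ⟨a, w, ⟨h2 a (by simp), by simpa using h1, fun x hx => h2 x (by simp [hx])⟩, rfl⟩

/-- The words over `{1, …, n}` in which no letter is followed by one that is smaller by at
least `d`, and whose first letter exceeds `t`. -/
def fallingWords (d n k t : ℕ) : Finset (List ℕ) :=
  {l ∈ words (Icc 1 n) k | l.IsChain (fun a b => a < b + d) ∧ ∀ y ∈ l.head?, t < y}

theorem mem_fallingWords {d n k t : ℕ} {l : List ℕ} : l ∈ fallingWords d n k t ↔
    (l.length = k ∧ ∀ x ∈ l, x ∈ Icc 1 n) ∧ l.IsChain (fun a b => a < b + d) ∧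
      ∀ y ∈ l.head?, t < y := by
  rw [fallingWords, mem_filter, mem_words]

theorem fallingWords_zero (d n t : ℕ) : fallingWords d n 0 t = {[]} := by
  ext l
  rw [mem_fallingWords, mem_singleton, List.length_eq_zero_iff]
  constructor
  · exact fun h => h.1.1
  · rintro rfl
    simp

theorem fallingWords_self (d n k : ℕ) : fallingWords d n (k + 1) n = ∅ := by
  rw [eq_empty_iff_forall_notMem]
  intro l hl
  obtain ⟨⟨h1, h2⟩, -, h3⟩ := mem_fallingWords.1 hl
  obtain ⟨a, w, rfl⟩ := List.exists_cons_of_length_eq_add_one h1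
  have h4 := mem_Icc.1 (h2 a (by simp))
  have h5 := h3 a (by simp)
  omega

/-- Either the first letter exceeds `t + 1`, or it is `t + 1` and the next letter must exceed `t + 1
- d`. Truncated subtraction is harmless, since letters are positive. -/
theorem card_fallingWords_succ {d n t : ℕ} (k : ℕ) (ht : t < n) :
    #(fallingWords d n (k + 1) t) =
      #(fallingWords d n (k + 1) (t + 1)) + #(fallingWords d n k (t + 1 - d)) := by
  have h1 : fallingWords d n (k + 1) t = fallingWords d n (k + 1) (t + 1) ∪
      (fallingWords d n k (t + 1 - d)).image (List.cons (t + 1)) := by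
    ext l
    rw [mem_union, mem_image]
    constructor
    · intro hl
      obtain ⟨⟨h1, h2⟩, h3, h4⟩ := mem_fallingWords.1 hl
      obtain ⟨a, w, rfl⟩ := List.exists_cons_of_length_eq_add_one h1
      have h5 := h4 a (by simp)
      by_cases ha : a = t + 1
      · subst ha
        rw [List.isChain_cons] at h3
        refine Or.inr ⟨w, mem_fallingWords.2 ⟨⟨by simpa using h1, fun x hx => h2 x (by simp [hx])⟩,
          h3.2, fun y hy => ?_⟩, rfl⟩
        have h6 := h3.1 y hy
        have h7 := mem_Icc.1 (h2 y (by simp [List.mem_of_mem_head? hy]))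
        omega
      · refine Or.inl (mem_fallingWords.2 ⟨⟨h1, h2⟩, h3, fun y hy => ?_⟩)
        simp only [List.head?_cons, Option.mem_def, Option.some.injEq] at hy
        omega
    · rintro (hl | ⟨w, hw, rfl⟩)
      · obtain ⟨h1, h3, h4⟩ := mem_fallingWords.1 hl
        exact mem_fallingWords.2 ⟨h1, h3, fun y hy => by
          have := h4 y hy
          omega⟩
      · obtain ⟨⟨h1, h2⟩, h3, h4⟩ := mem_fallingWords.1 hw
        refine mem_fallingWords.2 ⟨⟨by simp [h1], ?_⟩, ?_, ?_⟩
        · intro x hx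
          rcases List.mem_cons.1 hx with rfl | hx
          · exact mem_Icc.2 ⟨by omega, by omega⟩
          · exact h2 x hx
        · refine List.isChain_cons.2 ⟨fun y hy => ?_, h3⟩
          have := h4 y hy
          omega
        · simp
  rw [h1, card_union_of_disjoint, card_image_of_injective _ (List.cons_injective)]
  rw [Finset.disjoint_left]
  intro l hl hl'
  obtain ⟨w, -, rfl⟩ := mem_image.1 hl'
  have := (mem_fallingWords.1 hl).2.2 (t + 1) (by simp)
  omega

theorem all_not_of_isChain {d : ℕ} {p : ℕ → Prop} {a : ℕ} {l : List ℕ}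
    (hp : ∀ x ∈ a :: l, ∀ y ∈ a :: l, p x → ¬ p y → x + d ≤ y)
    (h : (a :: l).IsChain (fun a b => a < b + d)) (ha : ¬ p a) : ∀ x ∈ l, ¬ p x := by
  induction l generalizing a with
  | nil => simp
  | cons b l ih =>
    rw [List.isChain_cons_cons] at h
    have hb : ¬ p b := fun hb => by
      have := hp b (by simp) a (by simp) hb ha
      omega
    intro x hx
    rcases List.mem_cons.1 hx with rfl | hx
    · exact hb
    · exact ih (fun x hx y hy => hp x (List.mem_cons_of_mem _ hx) y (List.mem_cons_of_mem _ hy))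
        h.2 hb x hx

/-- In a falling word the small letters come first. -/
theorem filter_append_filter {d : ℕ} {p : ℕ → Prop} [DecidablePred p] {l : List ℕ}
    (hp : ∀ x ∈ l, ∀ y ∈ l, p x → ¬ p y → x + d ≤ y) (h : l.IsChain (fun a b => a < b + d)) :
    l.filter p ++ l.filter (fun x => ¬ p x) = l := by
  induction l with
  | nil => simp
  | cons a l ih =>
    by_cases ha : p a
    · have := ih (fun x hx y hy => hp x (List.mem_cons_of_mem _ hx) y (List.mem_cons_of_mem _ hy))
        h.tail
      simpa [ha] using this
    · have h1 := all_not_of_isChain hp h ha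
      have h2 : l.filter (fun x => decide (p x)) = [] := by
        rw [List.filter_eq_nil_iff]
        simpa using h1
      have h3 : l.filter (fun x => decide (¬ p x)) = l := by
        rw [List.filter_eq_self]
        simpa using h1
      rw [List.filter_cons_of_neg (by simpa using ha), List.filter_cons_of_pos (by simpa using ha),
        h2, h3, List.nil_append]

/-- The falling words of length `k` that are parking functions. -/
def parkingWords (d k : ℕ) : Finset (List ℕ) :=
  {l ∈ words (Icc 1 (d * k + 1)) k | l.IsChain (fun a b => a < b + d) ∧
    ∀ i < k, i < l.countP (· ≤ d * i + 1)}

theorem mem_parkingWords {d k : ℕ} {l : List ℕ} : l ∈ parkingWords d k ↔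
    (l.length = k ∧ ∀ x ∈ l, x ∈ Icc 1 (d * k + 1)) ∧ l.IsChain (fun a b => a < b + d) ∧
      ∀ i < k, i < l.countP (· ≤ d * i + 1) := by
  rw [parkingWords, mem_filter, mem_words]

theorem restrictedParkingFunctions_eq {d : ℕ} (hd : 0 < d) (k : ℕ) :
    restrictedParkingFunctions d k = (parkingWords d k : Set (List ℕ)) := by
  ext a
  rw [mem_coe, mem_parkingWords, restrictedParkingFunctions, Set.mem_ofPred_eq,
    isParkingFunction_iff, List.isChain_iff_getElem]
  have h0 : (∀ (i : ℕ) (hi : i + 1 < a.length), a[i] ≤ a[i + 1] + d - 1) ↔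
      ∀ (i : ℕ) (hi : i + 1 < a.length), a[i] < a[i + 1] + d :=
    forall₂_congr fun i hi => by omega
  rw [h0]
  constructor
  · rintro ⟨h1, ⟨h2, h3⟩, h4⟩
    exact ⟨⟨h1, mem_Icc_of_lt_countP h1 h2 h3⟩, h4, h1 ▸ h3⟩
  · rintro ⟨⟨h1, h2⟩, h3, h4⟩
    exact ⟨h1, ⟨fun x hx => (mem_Icc.1 (h2 x hx)).1, h1 ▸ h4⟩, h3⟩

/-- The length of the parking prefix is the first index at which the parking condition fails, so the
concatenation determines it. -/
theorem countP_append_map {d i : ℕ} {u v : List ℕ} (hu : u ∈ parkingWords d i)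
    (hv : ∀ x ∈ v, 1 ≤ x) :
    (u ++ v.map (· + (d * i + 1))).countP (· ≤ d * i + 1) = i ∧
      ∀ j < i, j < (u ++ v.map (· + (d * i + 1))).countP (· ≤ d * j + 1) := by
  obtain ⟨⟨h1, h2⟩, -, h4⟩ := mem_parkingWords.1 hu
  refine ⟨?_, fun j hj => ?_⟩
  · rw [List.countP_append, List.countP_map]
    have e1 : u.countP (· ≤ d * i + 1) = u.length := by
      rw [List.countP_eq_length]
      intro x hx
      have := mem_Icc.1 (h2 x hx)
      simpa using this.2
    have e2 : v.countP ((fun x => decide (x ≤ d * i + 1)) ∘ (· + (d * i + 1))) = 0 := by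
      rw [List.countP_eq_zero]
      intro x hx
      have := hv x hx
      simp
      omega
    rw [e1, e2, h1, add_zero]
  · rw [List.countP_append]
    exact (h4 j hj).trans_le (Nat.le_add_right _ _)

/-- Let `i` be the first index at which the word has at most `i` letters up to `d * i + 1`. These
letters form a prefix that is a parking word of length `i`, and the rest, lowered by `d * i + 1`, is
an arbitrary falling word. Conversely, every concatenation is falling, as its junction ascends. -/
theorem card_fallingWords_eq_sum {d n k : ℕ} (hn : d * k + 1 ≤ n) :
    #(fallingWords d n k 0) = ∑ i ∈ range (k + 1),
      #(parkingWords d i) * #(fallingWords d (n - (d * i + 1)) (k - i) 0) := by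
  have hpos : ∀ {m j : ℕ} {v : List ℕ}, v ∈ fallingWords d m j 0 → ∀ x ∈ v, 1 ≤ x :=
    fun hv x hx => (mem_Icc.1 ((mem_fallingWords.1 hv).1.2 x hx)).1
  simp_rw [← card_product]
  rw [← card_sigma]
  symm
  refine Finset.card_bij (fun q _ => q.2.1 ++ q.2.2.map (· + (d * q.1 + 1))) ?_ ?_ ?_
  · rintro ⟨i, u, v⟩ hq
    simp only [mem_sigma, mem_range, mem_product] at hq
    obtain ⟨hi, hu, hv⟩ := hq
    obtain ⟨⟨h1, h2⟩, h3, h4⟩ := mem_parkingWords.1 hu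
    obtain ⟨⟨g1, g2⟩, g3, -⟩ := mem_fallingWords.1 hv
    have hdi : d * i ≤ d * k := Nat.mul_le_mul_left _ (by omega)
    have hmem : ∀ x ∈ u ++ v.map (· + (d * i + 1)), x ∈ Icc 1 n := by
      intro x hx
      rcases List.mem_append.1 hx with hx | hx
      · have := mem_Icc.1 (h2 x hx)
        exact mem_Icc.2 ⟨this.1, by omega⟩
      · obtain ⟨y, hy, rfl⟩ := List.mem_map.1 hx
        have := mem_Icc.1 (g2 y hy)
        exact mem_Icc.2 ⟨by omega, by omega⟩
    refine mem_fallingWords.2 ⟨⟨by simp [h1, g1]; omega, hmem⟩, ?_, fun y hy => ?_⟩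
    · rw [List.isChain_append, List.isChain_map]
      refine ⟨h3, g3.imp fun a b h => by omega, fun x hx y hy => ?_⟩
      have e1 := mem_Icc.1 (h2 x (List.mem_of_mem_getLast? hx))
      obtain ⟨z, hz, rfl⟩ := List.mem_map.1 (List.mem_of_mem_head? hy)
      have e2 := hpos hv z hz
      change x < z + (d * i + 1) + d
      omega
    · have := mem_Icc.1 (hmem y (List.mem_of_mem_head? hy))
      omega
  · rintro ⟨i, u, v⟩ hq ⟨i', u', v'⟩ hq' heq
    simp only [mem_sigma, mem_range, mem_product] at hq hq' heq
    obtain ⟨e1, e2⟩ := countP_append_map hq.2.1 (hpos hq.2.2)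
    obtain ⟨e1', e2'⟩ := countP_append_map hq'.2.1 (hpos hq'.2.2)
    have hii : i = i' := by
      rcases lt_trichotomy i i' with h | h | h
      · have := e2' i h
        rw [← heq, e1] at this
        omega
      · exact h
      · have := e2 i' h
        rw [heq, e1'] at this
        omega
    subst hii
    obtain ⟨h1, h2⟩ := List.append_inj heq
      ((mem_parkingWords.1 hq.2.1).1.1.trans (mem_parkingWords.1 hq'.2.1).1.1.symm)
    have h3 := List.map_injective_iff.2 (add_left_injective (d * i + 1)) h2
    rw [h1, h3]
  · intro l hl
    obtain ⟨⟨h1, h2⟩, h3, -⟩ := mem_fallingWords.1 hl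
    have hex : ∃ i, l.countP (· ≤ d * i + 1) ≤ i := ⟨k, h1 ▸ List.countP_le_length⟩
    obtain ⟨i, hi⟩ : ∃ i, i = Nat.find hex := ⟨_, rfl⟩
    have hle : l.countP (· ≤ d * i + 1) ≤ i := hi ▸ Nat.find_spec hex
    have hmin : ∀ j < i, j < l.countP (· ≤ d * j + 1) := fun j hj => by
      have := Nat.find_min hex (hi ▸ hj)
      omega
    have hik : i ≤ k := by
      rw [hi]
      exact Nat.find_le (h1 ▸ List.countP_le_length)
    -- The condition holds at `i - 1` and fails at `i`, so there are exactly `i` letters up to `d *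
    -- i + 1`, and none of them exceeds `d * (i - 1) + 1`. By this gap no large letter can be
    -- followed by a small one in a falling word.
    have hcount : l.countP (· ≤ d * i + 1) = i ∧
        ∀ x ∈ l, x ≤ d * i + 1 → x + d ≤ d * i + 1 := by
      rcases Nat.eq_zero_or_pos i with h0 | hipos
      · have e0 : l.countP (· ≤ d * i + 1) = 0 := by omega
        refine ⟨by omega, fun x hx hx' => ?_⟩
        rw [List.countP_eq_zero] at e0
        exact absurd hx' (by simpa using e0 x hx)
      · obtain ⟨j, rfl⟩ : ∃ j, i = j + 1 := ⟨i - 1, by omega⟩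
        have e1 := hmin j (by omega)
        have e2 : d * (j + 1) = d * j + d := Nat.mul_succ d j
        have e3 : l.countP (· ≤ d * (j + 1) + 1) = l.countP (· ≤ d * j + 1) +
            l.countP (fun x => decide (d * j + 1 < x ∧ x ≤ d * (j + 1) + 1)) := by
          clear hmin hle h1 h2 h3 hl hex hi e1
          induction l with
          | nil => simp
          | cons a l ih =>
            simp only [List.countP_cons, ih, decide_eq_true_eq]
            split_ifs <;> omega
        refine ⟨by omega, fun x hx hx' => ?_⟩
        have e4 : l.countP (fun x => decide (d * j + 1 < x ∧ x ≤ d * (j + 1) + 1)) = 0 := by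
          omega
        rw [List.countP_eq_zero] at e4
        have := e4 x hx
        simp only [decide_eq_true_eq] at this
        omega
    obtain ⟨hcount, hgap⟩ := hcount
    have happ := filter_append_filter (d := d) (p := (· ≤ d * i + 1)) (l := l)
      (fun x hx y hy hpx hpy => by
        have := hgap x hx hpx
        omega) h3
    obtain ⟨u, hu⟩ : ∃ u, u = l.filter (fun x => decide (x ≤ d * i + 1)) := ⟨_, rfl⟩
    obtain ⟨v, hv⟩ : ∃ v, v = l.filter (fun x => decide (¬ x ≤ d * i + 1)) := ⟨_, rfl⟩
    rw [← hu, ← hv] at happ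
    have hul : u.length = i := by rw [hu, ← List.countP_eq_length_filter, hcount]
    have hvl : v.length = k - i := by
      have := congrArg List.length happ
      rw [List.length_append] at this
      omega
    have hum : ∀ x ∈ u, x ∈ l ∧ x ≤ d * i + 1 := fun x hx => by
      rw [hu, List.mem_filter] at hx
      simpa using hx
    have hvm : ∀ x ∈ v, x ∈ l ∧ d * i + 1 < x := fun x hx => by
      rw [hv, List.mem_filter] at hx
      simpa using hx
    have hchain := h3
    rw [← happ, List.isChain_append] at hchain
    have hvv : (v.map (· - (d * i + 1))).map (· + (d * i + 1)) = v := by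
      rw [List.map_map]
      conv_rhs => rw [← List.map_id v]
      refine List.map_congr_left fun x hx => ?_
      have := (hvm x hx).2
      simp only [Function.comp_apply, id]
      omega
    refine ⟨⟨i, u, v.map (· - (d * i + 1))⟩, ?_, ?_⟩
    · simp only [mem_sigma, mem_range, mem_product]
      refine ⟨by omega, mem_parkingWords.2 ⟨⟨hul, fun x hx => ?_⟩, hchain.1, fun j hj => ?_⟩,
        mem_fallingWords.2 ⟨⟨by simp [hvl], fun x hx => ?_⟩, ?_, fun y hy => ?_⟩⟩
      · have e1 := hum x hx
        exact mem_Icc.2 ⟨(mem_Icc.1 (h2 x e1.1)).1, e1.2⟩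
      · have e1 := hmin j hj
        have e2 : d * j ≤ d * i := Nat.mul_le_mul_left _ hj.le
        have e3 : v.countP (· ≤ d * j + 1) = 0 := by
          rw [List.countP_eq_zero]
          intro x hx
          have := (hvm x hx).2
          simp only [decide_eq_true_eq]
          omega
        rw [← happ, List.countP_append, e3] at e1
        exact e1
      · obtain ⟨y, hy, rfl⟩ := List.mem_map.1 hx
        have e1 := hvm y hy
        have e2 := mem_Icc.1 (h2 y e1.1)
        exact mem_Icc.2 ⟨by omega, by omega⟩
      · have e1 := hchain.2.1
        rw [← hvv, List.isChain_map] at e1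
        exact e1.imp fun a b h => by omega
      · obtain ⟨z, hz, rfl⟩ := List.mem_map.1 (List.mem_of_mem_head? hy)
        have e1 := hvm z hz
        omega
    · simp only [hvv, happ]

end IndivNC

/-! ### Counting the restricted parking functions -/

namespace IndivNC

open PowerSeries

/-- The generating function of the falling words with a given bound for the first letter. -/
noncomputable def wordSeries (d n t : ℕ) : ℤ⟦X⟧ :=
  PowerSeries.mk fun k => (#(fallingWords d n k t) : ℤ)

/-- The polynomials with `wordSeries d n 0 * denomSeries d n = 1`. -/
noncomputable def denomSeries (d : ℕ) : ℕ → ℤ⟦X⟧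
  | 0 => 1
  | t + 1 => denomSeries d t - X * denomSeries d (t - (d - 1))
termination_by t => t

theorem denomSeries_succ {d : ℕ} (hd : 0 < d) (t : ℕ) :
    denomSeries d (t + 1) = denomSeries d t - X * denomSeries d (t + 1 - d) := by
  rw [denomSeries, show t - (d - 1) = t + 1 - d by omega]

theorem denomSeries_zero (d : ℕ) : denomSeries d 0 = 1 := by
  rw [denomSeries]

theorem wordSeries_eq_add {d n t : ℕ} (ht : t < n) :
    wordSeries d n t = wordSeries d n (t + 1) + X * wordSeries d n (t + 1 - d) := by
  ext k
  cases k with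
  | zero => simp [wordSeries, fallingWords_zero]
  | succ k => simp [wordSeries, coeff_succ_X_mul, card_fallingWords_succ k ht]

theorem wordSeries_self (d n : ℕ) : wordSeries d n n = 1 := by
  ext k
  cases k with
  | zero => simp [wordSeries, fallingWords_zero]
  | succ k => simp [wordSeries, fallingWords_self, coeff_one]

/-- As functions of the threshold `t`, both sides obey the same recursion and agree at `0`. At `t =
n`, where the word series is `1`, this identifies it at threshold `0` as the inverse of `denomSeries
d n`. -/
theorem wordSeries_eq_mul {d n : ℕ} (hd : 0 < d) {t : ℕ} (ht : t ≤ n) :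
    wordSeries d n t = wordSeries d n 0 * denomSeries d t := by
  induction t using Nat.strong_induction_on with
  | _ t ih =>
    cases t with
    | zero => rw [denomSeries_zero, mul_one]
    | succ t =>
      have h1 := wordSeries_eq_add (d := d) ht
      rw [ih t (by omega) (by omega), ih (t + 1 - d) (by omega) (by omega)] at h1
      rw [denomSeries_succ hd]
      linear_combination -h1

theorem wordSeries_mul_denomSeries {d : ℕ} (hd : 0 < d) (n : ℕ) :
    wordSeries d n 0 * denomSeries d n = 1 := by
  rw [← wordSeries_eq_mul hd le_rfl, wordSeries_self]

/-- The product of `denomSeries d t` with the inverse of its limiting growth rate. -/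
noncomputable def scaledDenom (d t : ℕ) : ℤ⟦X⟧ := denomSeries d t * raneySeries d 1 ^ t

theorem scaledDenom_succ_sub {d t : ℕ} (hd : 0 < d) (ht : d ≤ t + 1) :
    scaledDenom d (t + 1) - scaledDenom d t =
      X * (raneySeries d 1 ^ d * (scaledDenom d t - scaledDenom d (t + 1 - d))) := by
  have h1 : raneySeries d 1 ^ (t + 1) = raneySeries d 1 ^ (t + 1 - d) * raneySeries d 1 ^ d := by
    rw [← pow_add]
    congr 1
    omega
  have h2 := raneySeries_one d
  have h3 : scaledDenom d (t + 1) = raneySeries d 1 * scaledDenom d t -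
      X * raneySeries d 1 ^ d * scaledDenom d (t + 1 - d) := by
    simp only [scaledDenom]
    rw [denomSeries_succ hd, sub_mul, mul_assoc X]
    nth_rewrite 2 [h1]
    rw [pow_succ]
    ring
  rw [h3]
  linear_combination scaledDenom d t * h2

/-- By `scaledDenom_succ_sub` an increment is `X` times a multiple of a sum of `d - 1` earlier
increments, so every `d` steps gain a factor `X`. Hence the sequence converges `X`-adically. -/
theorem X_pow_dvd_scaledDenom_succ_sub {d : ℕ} (hd : 0 < d) (j : ℕ) :
    ∀ t, d * j ≤ t + 1 → (X : ℤ⟦X⟧) ^ j ∣ scaledDenom d (t + 1) - scaledDenom d t := by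
  induction j with
  | zero => simp
  | succ j ih =>
    intro t ht
    rw [Nat.mul_succ] at ht
    rw [scaledDenom_succ_sub hd (by omega), pow_succ']
    refine mul_dvd_mul_left _ (Dvd.dvd.mul_left ?_ _)
    have key : ∀ m s, d * j ≤ s + 1 → (X : ℤ⟦X⟧) ^ j ∣ scaledDenom d (s + m) - scaledDenom d s := by
      intro m s hs
      induction m with
      | zero => simp
      | succ m ihm =>
        have := dvd_add (ih (s + m) (by omega)) ihm
        rwa [sub_add_sub_cancel] at this
    have := key (d - 1) (t + 1 - d) (by omega)
    rwa [show t + 1 - d + (d - 1) = t by omega] at this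

theorem X_pow_dvd_scaledDenom_sub {d : ℕ} (hd : 0 < d) {j s t : ℕ} (hs : d * j ≤ s)
    (hst : s ≤ t) : (X : ℤ⟦X⟧) ^ j ∣ scaledDenom d t - scaledDenom d s := by
  induction t, hst using Nat.le_induction with
  | base => simp
  | succ t hst ih =>
    have := dvd_add (X_pow_dvd_scaledDenom_succ_sub hd j t (by omega)) ih
    rwa [sub_add_sub_cancel] at this

theorem X_pow_dvd_wordSeries_sub {d n k : ℕ} (hn : d * k + 1 ≤ n) :
    (X : ℤ⟦X⟧) ^ (k + 1) ∣ wordSeries d n 0 - ∑ i ∈ range (k + 1),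
      C (#(parkingWords d i) : ℤ) * (X ^ i * wordSeries d (n - (d * i + 1)) 0) := by
  rw [X_pow_dvd_iff]
  intro m hm
  have hdm : d * m ≤ d * k := Nat.mul_le_mul_left _ (by omega)
  rw [map_sub, sub_eq_zero, map_sum]
  simp only [coeff_C_mul, coeff_X_pow_mul']
  rw [← sum_subset (range_subset_range.2 (show m + 1 ≤ k + 1 by omega))]
  · simp only [wordSeries, coeff_mk]
    rw [card_fallingWords_eq_sum (k := m) (by omega)]
    push_cast
    refine sum_congr rfl fun i hi => ?_
    rw [mem_range] at hi
    rw [if_pos (by omega)]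
  · intro i _ hi
    rw [mem_range] at hi
    rw [if_neg (by omega), mul_zero]

/-- Multiplying the prefix decomposition by the scaled denominator turns each word series over `m`
letters into `g ^ m`, up to order `k + 1`. The Raney numbers satisfy the same relation, and its
coefficient of `X ^ k` determines the new term from the earlier ones. -/
theorem card_parkingWords {d : ℕ} (hd : 0 < d) (k : ℕ) :
    #(parkingWords d k) = raney (2 * d) k 1 := by
  induction k using Nat.strong_induction_on with
  | _ k ih =>
    set g := raneySeries d 1 with hg
    have hg0 : constantCoeff g = 1 := constantCoeff_raneySeries d 1
    -- This `n` leaves `n - (d * i + 1) ≥ d * (k + 1)` for all `i ≤ k`, the range in which the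
    -- scaled denominators agree modulo `X ^ (k + 1)`.
    obtain ⟨n, hn⟩ : ∃ n, n = d * (k + 1) + (d * k + 1) := ⟨_, rfl⟩
    have hin : ∀ i ∈ range (k + 1), d * (k + 1) + (d * i + 1) ≤ n := fun i hi => by
      rw [mem_range] at hi
      have : d * i ≤ d * k := Nat.mul_le_mul_left _ (by omega)
      omega
    have h1 := X_pow_dvd_wordSeries_sub (d := d) (n := n) (k := k) (by omega)
    have hpow : ∀ m, wordSeries d m 0 * scaledDenom d m = g ^ m := fun m => by
      rw [scaledDenom, ← mul_assoc, wordSeries_mul_denomSeries hd, one_mul]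
    have h2 : ∀ i ∈ range (k + 1), (X : ℤ⟦X⟧) ^ (k + 1) ∣
        wordSeries d (n - (d * i + 1)) 0 * scaledDenom d n - g ^ (n - (d * i + 1)) := by
      intro i hi
      have := hin i hi
      rw [← hpow, ← mul_sub]
      exact Dvd.dvd.mul_left (X_pow_dvd_scaledDenom_sub hd (by omega) (by omega)) _
    have h3 : (X : ℤ⟦X⟧) ^ (k + 1) ∣ g ^ n - ∑ i ∈ range (k + 1),
        C (#(parkingWords d i) : ℤ) * (X ^ i * g ^ (n - (d * i + 1))) := by
      have e1 := Dvd.dvd.mul_right h1 (scaledDenom d n)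
      have e2 : (X : ℤ⟦X⟧) ^ (k + 1) ∣ ∑ i ∈ range (k + 1), C (#(parkingWords d i) : ℤ) *
          (X ^ i * (wordSeries d (n - (d * i + 1)) 0 * scaledDenom d n -
            g ^ (n - (d * i + 1)))) :=
        dvd_sum fun i hi => Dvd.dvd.mul_left (Dvd.dvd.mul_left (h2 i hi) _) _
      have e3 := dvd_add e1 e2
      convert e3 using 1
      rw [sub_mul, hpow, sum_mul, sub_add, ← sum_sub_distrib]
      congr 1
      exact sum_congr rfl fun i _ => by ring
    have h4 : (X : ℤ⟦X⟧) ^ (k + 1) ∣ g ^ n - ∑ i ∈ range (k + 1),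
        C (raney (2 * d) i 1 : ℤ) * (X ^ i * g ^ (n - (d * i + 1))) := by
      obtain ⟨v, hv⟩ : ∃ v, v * g ^ d = 1 := by
        have : IsUnit (g ^ d) := isUnit_iff_constantCoeff.2 (by simp [hg0])
        obtain ⟨v, hv⟩ := this.exists_left_inv
        exact ⟨v, hv⟩
      -- Here `v = g ^ (-d)`. The expansion of `B(X v) = g` to order `k + 1`, multiplied by `g ^ (n
      -- - 1)`, is the required relation.
      have e1 := subst_raneySeries_eq (d := d) (g := g) (u := 1) (v := v)
        (by rw [mul_one]; exact raneySeries_one d) hv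
      rw [one_mul, subst_eq_sum_add _ _ (k + 1)] at e1
      have e2 : g ^ n = g * g ^ (n - 1) := by
        rw [← pow_succ']
        congr 1
        omega
      have e3 : ∀ i ∈ range (k + 1), v ^ i * g ^ (n - 1) = g ^ (n - (d * i + 1)) := by
        intro i hi
        have := hin i hi
        rw [show n - 1 = d * i + (n - (d * i + 1)) by omega, pow_add, pow_mul, ← mul_assoc,
          ← mul_pow, hv, one_pow, one_mul]
      rw [e2]
      nth_rewrite 1 [← e1]
      rw [add_mul, sum_mul, add_sub_right_comm, ← sum_sub_distrib, sum_eq_zero, zero_add, mul_pow]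
      · exact Dvd.intro _ (by rw [mul_assoc, mul_assoc])
      · intro i hi
        rw [← e3 i hi, mul_pow, raneySeries, coeff_mk]
        ring
    have h5 := dvd_sub h4 h3
    rw [sub_sub_sub_cancel_left, ← sum_sub_distrib, sum_range_succ, sum_eq_zero, zero_add,
      ← sub_mul, ← map_sub, X_pow_dvd_iff] at h5
    · have h6 := h5 k (by omega)
      rw [coeff_C_mul, coeff_X_pow_mul', if_pos le_rfl, Nat.sub_self,
        coeff_zero_eq_constantCoeff_apply, map_pow, hg0, one_pow, mul_one, sub_eq_zero] at h6
      exact_mod_cast h6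
    · intro i hi
      rw [ih i (mem_range.1 hi), sub_self]

end IndivNC

/-! ### Power series for the Möbius function -/

namespace IndivNC

open PowerSeries

/-- The series `f` with `f = 1 - X f ^ d`. -/
noncomputable def altSeries (d : ℕ) : ℤ⟦X⟧ := rescale (-1) (raneySeries d 1)

theorem altSeries_eq (d : ℕ) : altSeries d = 1 - X * altSeries d ^ d := by
  have h := congrArg (rescale (-1 : ℤ)) (raneySeries_one d)
  rw [map_add, map_one, map_mul, map_pow, rescale_X] at h
  rw [altSeries]
  nth_rewrite 1 [h]
  simp
  ring

theorem isUnit_altSeries (d : ℕ) : IsUnit (altSeries d) := by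
  rw [isUnit_iff_constantCoeff]
  have := congrArg constantCoeff (altSeries_eq d)
  rw [this]
  simp

/-- The inverse of `altSeries`. -/
noncomputable def altInv (d : ℕ) : ℤ⟦X⟧ := ((isUnit_altSeries d).unit⁻¹ : ℤ⟦X⟧ˣ)

theorem altInv_mul (d : ℕ) : altInv d * altSeries d = 1 :=
  (isUnit_altSeries d).val_inv_mul

/-- Substitution of `X ^ d`. -/
noncomputable def dilate {d : ℕ} (hd : 0 < d) : ℤ⟦X⟧ →ₐ[ℤ] ℤ⟦X⟧ :=
  substAlgHom (HasSubst.X_pow hd.ne')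

theorem dilate_X {d : ℕ} (hd : 0 < d) : dilate hd X = X ^ d := substAlgHom_X _

theorem coeff_dilate {d : ℕ} (hd : 0 < d) (f : ℤ⟦X⟧) (n : ℕ) :
    coeff n (dilate hd f) = if d ∣ n then coeff (n / d) f else 0 := by
  rw [dilate, coe_substAlgHom, coeff_subst_X_pow hd.ne']
  rfl

section

variable {d : ℕ} (hd : 0 < d)

/-- The series `K` in `X ^ d` with `K = 1 - X ^ d K ^ d`. -/
noncomputable def kSeries : ℤ⟦X⟧ := dilate hd (altSeries d)

/-- The inverse of `kSeries`. -/
noncomputable def kInv : ℤ⟦X⟧ := dilate hd (altInv d)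

theorem kSeries_eq : kSeries hd = 1 - X ^ d * kSeries hd ^ d := by
  have h := congrArg (dilate hd) (altSeries_eq d)
  rwa [map_sub, map_one, map_mul, map_pow, dilate_X] at h

theorem kInv_mul : kInv hd * kSeries hd = 1 := by
  rw [kInv, kSeries, ← map_mul, altInv_mul, map_one]

theorem coeff_X_pow_mul_dilate {r : ℕ} (hr : r < d) (f : ℤ⟦X⟧) {n : ℕ} (hn : d ∣ n) :
    coeff n (X ^ r * dilate hd f) = if r = 0 then coeff n (dilate hd f) else 0 := by
  rw [coeff_X_pow_mul', coeff_dilate]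
  rcases Nat.eq_zero_or_pos r with rfl | hr0
  · simp [coeff_dilate]
  rw [if_neg hr0.ne']
  split_ifs with h1 h2
  · exact absurd (Nat.le_of_dvd hr0 ((Nat.dvd_sub_iff_right h1 hn).1 h2)) (by omega)
  · rfl
  · rfl

/-- The generating function of the weighted sums over good families, by the size of the
underlying set. -/
noncomputable def familySeries : ℤ⟦X⟧ := ∑ r ∈ range d, X ^ r * (kSeries hd ^ r * kInv hd)

/-- A geometric sum in `X K`: the numerator `1 - (X K) ^ d` is `K` by the equation for `K`, and
cancels against `kInv`. -/
theorem familySeries_mul : familySeries hd * (1 - X * kSeries hd) = 1 := by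
  have h1 : familySeries hd = kInv hd * ∑ r ∈ range d, (X * kSeries hd) ^ r := by
    rw [familySeries, mul_sum]
    exact sum_congr rfl fun r _ => by rw [mul_pow]; ring
  have h2 := geom_sum_mul_neg (X * kSeries hd) d
  have h3 := kSeries_eq hd
  have h4 := kInv_mul hd
  rw [mul_pow] at h2
  rw [h1, mul_assoc, h2, ← h3, h4]

theorem coeff_familySeries_of_dvd {n : ℕ} (hn : d ∣ n) :
    coeff n (familySeries hd) = coeff n (kInv hd) := by
  have h : ∀ r ∈ range d, coeff n (X ^ r * (kSeries hd ^ r * kInv hd)) =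
      if r = 0 then coeff n (kInv hd) else 0 := by
    intro r hr
    rw [kSeries, kInv, ← map_pow, ← map_mul,
      coeff_X_pow_mul_dilate hd (mem_range.1 hr) _ hn]
    split_ifs with h0
    · rw [h0, pow_zero, one_mul]
    · rfl
  rw [familySeries, map_sum, sum_congr rfl h, sum_ite_eq', if_pos (mem_range.2 hd)]

theorem coeff_kInv_of_not_dvd {n : ℕ} (hn : ¬ d ∣ n) : coeff n (kInv hd) = 0 := by
  rw [kInv, coeff_dilate, if_neg hn]

/-- `F = 1 + X K F`, and `K F` is the sum of `X ^ r K ^ r` over `r < d`. As `K` is a series in `X ^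
d`, exponents divisible by `d` come only from `r = 0`, where the term is `1`. -/
theorem coeff_familySeries_succ {n : ℕ} (hn : d ∣ n) :
    coeff (n + 1) (familySeries hd) = if n = 0 then 1 else 0 := by
  have h1 : familySeries hd = 1 + X * (kSeries hd * familySeries hd) := by
    linear_combination familySeries_mul hd
  have h2 : kSeries hd * familySeries hd = ∑ r ∈ range d, X ^ r * dilate hd (altSeries d ^ r) := by
    rw [familySeries, mul_sum]
    refine sum_congr rfl fun r _ => ?_
    have := kInv_mul hd
    rw [map_pow, ← kSeries]
    linear_combination (X ^ r * kSeries hd ^ r) * this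
  have h3 : ∀ r ∈ range d, coeff n (X ^ r * dilate hd (altSeries d ^ r)) =
      if r = 0 then coeff n (1 : ℤ⟦X⟧) else 0 := by
    intro r hr
    rw [coeff_X_pow_mul_dilate hd (mem_range.1 hr) _ hn]
    split_ifs with h0
    · rw [h0, pow_zero, map_one]
    · rfl
  rw [h1, map_add, coeff_succ_X_mul, h2, map_sum, sum_congr rfl h3, sum_ite_eq',
    if_pos (mem_range.2 hd), coeff_one, coeff_one, if_neg (Nat.succ_ne_zero n), zero_add]

/-- The weight of a block with `i + 1` elements. -/
def blockWeight (d i : ℕ) : ℤ := (-1) ^ (i / d) * raney (2 * d) (i / d) 1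

/-- The tails of the generating function of the block weights. -/
noncomputable def weightTail (j : ℕ) : ℤ⟦X⟧ :=
  (tailSeries (raneySeries (2 * d) 1) j).subst (X * (-X ^ (d - 1) * kInv hd ^ d))

theorem weightTail_eq (j : ℕ) : weightTail hd j =
    C (raney (2 * d) j 1 : ℤ) - X ^ d * kInv hd ^ d * weightTail hd (j + 1) := by
  have h : X ^ d = (X : ℤ⟦X⟧) * X ^ (d - 1) := by
    rw [← pow_succ']
    congr 1
    omega
  rw [weightTail, subst_tailSeries, ← weightTail, raneySeries, coeff_mk, h]
  ring

theorem weightTail_zero : weightTail hd 0 = kSeries hd := by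
  rw [weightTail, tailSeries_zero]
  have h : X ^ d = (X : ℤ⟦X⟧) * X ^ (d - 1) := by
    rw [← pow_succ']
    congr 1
    omega
  refine subst_raneySeries_eq ?_ ?_
  · have := kSeries_eq hd
    rw [h] at this
    linear_combination this
  · rw [← mul_pow, kInv_mul, one_pow]

/-- The generating function of the weighted sums over the good families that extend a partial
block with `i + 1` elements. -/
noncomputable def partialSeries (i : ℕ) : ℤ⟦X⟧ :=
  (X * kInv hd) ^ (d * ((i + (d - 1)) / d) - i) *
    (C ((-1) ^ ((i + (d - 1)) / d)) * weightTail hd ((i + (d - 1)) / d) * familySeries hd)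

theorem familySeries_eq : familySeries hd = 1 + X * partialSeries hd 0 := by
  have h : (0 + (d - 1)) / d = 0 := Nat.div_eq_of_lt (by omega)
  have h1 := familySeries_mul hd
  rw [partialSeries, h, weightTail_zero]
  simp
  linear_combination h1

/-- The combinatorial recursion for a partial block: close it, which its size permits only if `d ∣
i`, or add an element after a gap of size divisible by `d`, which contributes `kInv`. In the closed
form, the power of `X * kInv` covers the elements still needed before the next permitted size, and
`weightTail` sums the weights from there on. -/
theorem partialSeries_eq (i : ℕ) : partialSeries hd i =
    (if d ∣ i then C (blockWeight d i) * familySeries hd else 0) +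
      X * (kInv hd * partialSeries hd (i + 1)) := by
  by_cases hi : d ∣ i
  · obtain ⟨j, rfl⟩ := hi
    have h1 : (d * j + (d - 1)) / d = j := by
      rw [Nat.mul_add_div hd, Nat.div_eq_of_lt (by omega), add_zero]
    have h2 : (d * j + 1 + (d - 1)) / d = j + 1 := by
      rw [show d * j + 1 + (d - 1) = d * (j + 1) by rw [Nat.mul_succ]; omega,
        Nat.mul_div_cancel_left _ hd]
    have h3 : d * (j + 1) - (d * j + 1) = d - 1 := by rw [Nat.mul_succ]; omega
    have h4 : (X * kInv hd) ^ d = X * kInv hd * (X * kInv hd) ^ (d - 1) := by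
      rw [← pow_succ']
      congr 1
      omega
    rw [if_pos (dvd_mul_right d j), partialSeries, partialSeries, h1, h2, h3, Nat.sub_self,
      pow_zero, one_mul, weightTail_eq hd j, blockWeight, Nat.mul_div_cancel_left _ hd, pow_succ,
      ← mul_pow, h4]
    simp only [map_mul, map_neg, map_pow, map_one]
    ring
  · obtain ⟨q, hq⟩ : ∃ q, i / d = q := ⟨_, rfl⟩
    have h0 := Nat.div_add_mod i d
    have h5 := Nat.mod_lt i hd
    have h6 : 0 < i % d := Nat.pos_of_ne_zero fun h => hi (Nat.dvd_of_mod_eq_zero h)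
    rw [hq] at h0
    have hm : d * (q + 1) = d * q + d := Nat.mul_succ d q
    have h1 : (i + (d - 1)) / d = q + 1 :=
      Nat.div_eq_of_lt_le (by rw [mul_comm]; omega) (by rw [mul_comm, Nat.mul_succ]; omega)
    have h2 : (i + 1 + (d - 1)) / d = q + 1 :=
      Nat.div_eq_of_lt_le (by rw [mul_comm]; omega) (by rw [mul_comm, Nat.mul_succ]; omega)
    have h3 : d * (q + 1) - i = d * (q + 1) - (i + 1) + 1 := by omega
    rw [if_neg hi, partialSeries, partialSeries, h1, h2, h3, pow_succ]
    ring

end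

end IndivNC

/-! ### Weighted sums over the good families of a set -/

namespace IndivNC

open Classical in
/-- The good families of a set. -/
noncomputable def goodFamilies (d : ℕ) (s : Finset ℕ) : Finset (Finset (Finset ℕ)) :=
  {P ∈ s.powerset.powerset | IsGoodFamily d s P}

theorem IsNCFamily.subset {s : Finset ℕ} {P : Finset (Finset ℕ)} (h : IsNCFamily s P)
    {B : Finset ℕ} (hB : B ∈ P) : B ⊆ s := fun x hx => (h.mem_iff x).2 ⟨B, hB, hx⟩

theorem mem_goodFamilies {d : ℕ} {s : Finset ℕ} {P : Finset (Finset ℕ)} :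
    P ∈ goodFamilies d s ↔ IsGoodFamily d s P := by
  classical
  rw [goodFamilies, mem_filter, and_iff_right_iff_imp]
  exact fun h => mem_powerset.2 fun B hB => mem_powerset.2 (h.subset hB)

/-- The weight of a family of blocks. -/
def familyWeight (d : ℕ) (P : Finset (Finset ℕ)) : ℤ := ∏ B ∈ P, blockWeight d (#B - 1)

/-- The families in `F` are the unions of those in `F₁` with those in `F₂`. -/
theorem sum_familyWeight_mul {d : ℕ} {t₁ t₂ : Finset ℕ} (ht : Disjoint t₁ t₂)
    {F F₁ F₂ : Finset (Finset (Finset ℕ))}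
    (h₁ : ∀ P ∈ F₁, ∀ B ∈ P, B.Nonempty ∧ B ⊆ t₁) (h₂ : ∀ P ∈ F₂, ∀ B ∈ P, B.Nonempty ∧ B ⊆ t₂)
    (h : ∀ P ∈ F, ∀ B ∈ P, B ⊆ t₁ ∨ B ⊆ t₂)
    (hu : ∀ P₁ ∈ F₁, ∀ P₂ ∈ F₂, P₁ ∪ P₂ ∈ F)
    (hr₁ : ∀ P ∈ F, {B ∈ P | B ⊆ t₁} ∈ F₁) (hr₂ : ∀ P ∈ F, {B ∈ P | B ⊆ t₂} ∈ F₂) :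
    ∑ P ∈ F, familyWeight d P =
      (∑ P ∈ F₁, familyWeight d P) * ∑ P ∈ F₂, familyWeight d P := by
  have hne : ∀ B : Finset ℕ, B.Nonempty → B ⊆ t₁ → ¬ B ⊆ t₂ := fun B ⟨x, hx⟩ hB hB' =>
    disjoint_left.1 ht (hB hx) (hB' hx)
  rw [sum_mul_sum, ← sum_product']
  symm
  refine sum_nbij' (fun Q => Q.1 ∪ Q.2) (fun P => ({B ∈ P | B ⊆ t₁}, {B ∈ P | B ⊆ t₂})) ?_ ?_ ?_ ?_ ?_
  · intro Q hQ
    exact hu _ (mem_product.1 hQ).1 _ (mem_product.1 hQ).2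
  · intro P hP
    exact mem_product.2 ⟨hr₁ P hP, hr₂ P hP⟩
  · intro Q hQ
    have g₁ := h₁ _ (mem_product.1 hQ).1
    have g₂ := h₂ _ (mem_product.1 hQ).2
    refine Prod.ext ?_ ?_
    · ext B
      simp only [mem_filter, mem_union]
      exact ⟨fun ⟨hB, hB'⟩ => hB.resolve_right fun hB2 => hne B (g₂ B hB2).1 hB' (g₂ B hB2).2,
        fun hB => ⟨Or.inl hB, (g₁ B hB).2⟩⟩
    · ext B
      simp only [mem_filter, mem_union]
      exact ⟨fun ⟨hB, hB'⟩ => hB.resolve_left fun hB2 => hne B (g₁ B hB2).1 (g₁ B hB2).2 hB',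
        fun hB => ⟨Or.inr hB, (g₂ B hB).2⟩⟩
  · intro P hP
    rw [← filter_or]
    exact filter_true_of_mem (h P hP)
  · intro Q hQ
    have g₁ := h₁ _ (mem_product.1 hQ).1
    have g₂ := h₂ _ (mem_product.1 hQ).2
    rw [familyWeight, familyWeight, familyWeight, prod_union]
    exact disjoint_left.2 fun B hB1 hB2 => hne B (g₁ B hB1).1 (g₁ B hB1).2 (g₂ B hB2).2

theorem IsGoodFamily.union {d : ℕ} {t₁ t₂ : Finset ℕ} (ht : Disjoint t₁ t₂)
    {P₁ P₂ : Finset (Finset ℕ)} (h₁ : IsGoodFamily d t₁ P₁) (h₂ : IsGoodFamily d t₂ P₂)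
    (hc : ∀ B ∈ P₁, ∀ C ∈ P₂, ∀ i j k l, i < j → j < k → k < l →
      ¬ (i ∈ B ∧ j ∈ C ∧ k ∈ B ∧ l ∈ C) ∧ ¬ (i ∈ C ∧ j ∈ B ∧ k ∈ C ∧ l ∈ B)) :
    IsGoodFamily d (t₁ ∪ t₂) (P₁ ∪ P₂) where
  nonempty B hB := (mem_union.1 hB).elim (h₁.nonempty B) (h₂.nonempty B)
  eq_of_mem B hB C hC x hx hx' := by
    rcases mem_union.1 hB with hB | hB <;> rcases mem_union.1 hC with hC | hC
    · exact h₁.eq_of_mem B hB C hC x hx hx'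
    · exact absurd (h₂.subset hC hx') (disjoint_left.1 ht (h₁.subset hB hx))
    · exact absurd (h₂.subset hB hx) (disjoint_left.1 ht (h₁.subset hC hx'))
    · exact h₂.eq_of_mem B hB C hC x hx hx'
  mem_iff x := by
    rw [mem_union, h₁.mem_iff, h₂.mem_iff]
    simp only [mem_union, or_and_right, exists_or]
  noncrossing B hB C hC i j k l hi hj hk hl hij hjk hkl := by
    rcases mem_union.1 hB with hB | hB <;> rcases mem_union.1 hC with hC | hC
    · exact h₁.noncrossing B hB C hC i j k l hi hj hk hl hij hjk hkl
    · exact absurd ⟨hi, hj, hk, hl⟩ (hc B hB C hC i j k l hij hjk hkl).1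
    · exact absurd ⟨hi, hj, hk, hl⟩ (hc C hC B hB i j k l hij hjk hkl).2
    · exact h₂.noncrossing B hB C hC i j k l hi hj hk hl hij hjk hkl
  card B hB := (mem_union.1 hB).elim (h₁.card B) (h₂.card B)
  good B hB := (mem_union.1 hB).elim (h₁.good B) (h₂.good B)

theorem IsGoodFamily.restrict {d : ℕ} {s t : Finset ℕ} {P : Finset (Finset ℕ)}
    (h : IsGoodFamily d s P) (hts : t ⊆ s) (ht : ∀ B ∈ P, ∀ x ∈ B, x ∈ t → B ⊆ t) :
    IsGoodFamily d t {B ∈ P | B ⊆ t} where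
  nonempty B hB := h.nonempty B (mem_filter.1 hB).1
  eq_of_mem B hB C hC := h.eq_of_mem B (mem_filter.1 hB).1 C (mem_filter.1 hC).1
  mem_iff x := by
    constructor
    · intro hx
      obtain ⟨B, hB, hxB⟩ := (h.mem_iff x).1 (hts hx)
      exact ⟨B, mem_filter.2 ⟨hB, ht B hB x hxB hx⟩, hxB⟩
    · rintro ⟨B, hB, hx⟩
      exact (mem_filter.1 hB).2 hx
  noncrossing B hB C hC := h.noncrossing B (mem_filter.1 hB).1 C (mem_filter.1 hC).1
  card B hB := h.card B (mem_filter.1 hB).1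
  good B hB := h.good B (mem_filter.1 hB).1

theorem GoodSet.of_convex {d : ℕ} {S T : Finset ℕ} (h : GoodSet d S) (hTS : T ⊆ S)
    (hT : ∀ x ∈ T, ∀ y ∈ T, ∀ z ∈ S, x ≤ z → z < y → z ∈ T) : GoodSet d T := by
  intro x hx y hy hxy
  rw [← h x (hTS hx) y (hTS hy) hxy]
  congr 2
  ext z
  simp only [mem_filter]
  exact ⟨fun ⟨hz, hz'⟩ => ⟨hTS hz, hz'⟩, fun ⟨hz, hz'⟩ => ⟨hT x hx y hy z hz hz'.1 hz'.2, hz'⟩⟩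

/-- The deleted elements form an interval of `A ∪ s` whose size is a multiple of `d`, so rank
differences across it do not change modulo `d`. -/
theorem GoodSet.remove_gap {d : ℕ} {A s : Finset ℕ} (h : GoodSet d (A ∪ s))
    (hA : ∀ a ∈ A, ∀ z ∈ s, a < z) {c : ℕ} (hc : c ∈ s) (hg : d ∣ #{z ∈ s | z < c}) :
    GoodSet d (insert c A ∪ {z ∈ s | c < z}) := by
  have hTS : insert c A ∪ {z ∈ s | c < z} ⊆ A ∪ s := by
    intro z
    simp only [mem_union, mem_insert, mem_filter]
    rintro ((rfl | h) | h)
    · exact Or.inr hc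
    · exact Or.inl h
    · exact Or.inr h.1
  intro x hx y hy hxy
  rw [← h x (hTS hx) y (hTS hy) hxy]
  have hlow : ∀ z ∈ insert c A ∪ {z ∈ s | c < z}, z < c → z ∈ A := by
    intro z hz hzc
    simp only [mem_union, mem_insert, mem_filter] at hz
    rcases hz with (rfl | h) | h
    · omega
    · exact h
    · omega
  have hup : ∀ z ∈ A ∪ s, c ≤ z → z ∈ insert c A ∪ {z ∈ s | c < z} := by
    intro z hz hzc
    simp only [mem_union, mem_insert, mem_filter] at hz ⊢
    rcases hz with h | h
    · exact Or.inl (Or.inr h)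
    · rcases hzc.eq_or_lt with rfl | h'
      · exact Or.inl (Or.inl rfl)
      · exact Or.inr ⟨h, h'⟩
  by_cases hb : x < c ∧ c ≤ y
  · have hxA := hlow x hx hb.1
    have : ({z ∈ A ∪ s | x ≤ z ∧ z < y} : Finset ℕ) =
        {z ∈ insert c A ∪ {z ∈ s | c < z} | x ≤ z ∧ z < y} ∪ {z ∈ s | z < c} := by
      ext z
      have h1 := hA x hxA z
      have h2 := hup z
      simp only [mem_union, mem_insert, mem_filter] at h2 ⊢
      constructor
      · rintro ⟨h3 | h3, h4⟩
        · exact Or.inl ⟨Or.inl (Or.inr h3), h4⟩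
        · rcases lt_or_ge z c with h5 | h5
          · exact Or.inr ⟨h3, h5⟩
          · exact Or.inl ⟨h2 (Or.inr h3) h5, h4⟩
      · rintro (⟨h3, h4⟩ | ⟨h3, h4⟩)
        · refine ⟨?_, h4⟩
          rcases h3 with (rfl | h3) | h3
          · exact Or.inr hc
          · exact Or.inl h3
          · exact Or.inr h3.1
        · exact ⟨Or.inr h3, (h1 h3).le, by omega⟩
    rw [this, card_union_of_disjoint, Nat.cast_add, (ZMod.natCast_eq_zero_iff _ _).2 hg, add_zero]
    refine disjoint_left.2 fun z hz hz' => ?_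
    rw [mem_filter] at hz hz'
    exact lt_irrefl z (hA z (hlow z hz.1 hz'.2) z hz'.1)
  · congr 2
    ext z
    simp only [mem_filter]
    refine ⟨fun ⟨hz, hz'⟩ => ⟨hTS hz, hz'⟩, fun ⟨hz, hz'⟩ => ⟨?_, hz'⟩⟩
    rcases lt_or_ge z c with h5 | h5
    · have hyA := hlow y hy (by omega)
      rcases mem_union.1 hz with h6 | h6
      · exact mem_union_left _ (mem_insert_of_mem h6)
      · exact absurd (hA y hyA z h6) (by omega)
    · exact hup z hz h5

/-- The good families of `A ∪ s` with a block that contains `A`. -/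
noncomputable def extendingFamilies (d : ℕ) (A s : Finset ℕ) : Finset (Finset (Finset ℕ)) :=
  {P ∈ goodFamilies d (A ∪ s) | ∃ B ∈ P, A ⊆ B}

theorem mem_extendingFamilies {d : ℕ} {A s : Finset ℕ} {P : Finset (Finset ℕ)} :
    P ∈ extendingFamilies d A s ↔ IsGoodFamily d (A ∪ s) P ∧ ∃ B ∈ P, A ⊆ B := by
  rw [extendingFamilies, mem_filter, mem_goodFamilies]

/-- Classify by the first element `c` of `s` in the block that contains `A`; if there is none, the
block is `A` itself. -/
theorem sum_extendingFamilies {d : ℕ} {A s : Finset ℕ} (hne : A.Nonempty)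
    (hA : ∀ a ∈ A, ∀ z ∈ s, a < z) :
    ∑ P ∈ extendingFamilies d A s, familyWeight d P =
      ∑ P ∈ extendingFamilies d A s with A ∈ P, familyWeight d P +
        ∑ c ∈ s, ∑ P ∈ extendingFamilies d A s with
          ∃ B ∈ P, insert c A ⊆ B ∧ ∀ z ∈ B, z ∈ s → c ≤ z, familyWeight d P := by
  obtain ⟨a, ha⟩ := hne
  simp only [sum_filter (s := extendingFamilies d A s)]
  rw [sum_comm, ← sum_add_distrib]
  refine sum_congr rfl fun P hP => ?_
  obtain ⟨hP, B, hB, hAB⟩ := mem_extendingFamilies.1 hP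
  have huniq : ∀ C ∈ P, A ⊆ C → C = B := fun C hC hAC => hP.eq_of_mem C hC B hB a (hAC ha) (hAB ha)
  by_cases hAP : A ∈ P
  · rw [if_pos hAP, sum_eq_zero, add_zero]
    intro c hc
    rw [if_neg]
    rintro ⟨C, hC, hcC, -⟩
    have h1 := huniq C hC ((subset_insert c A).trans hcC)
    rw [h1, ← huniq A hAP subset_rfl] at hcC
    exact lt_irrefl c (hA c (hcC (mem_insert_self c A)) c hc)
  · have hne : (B ∩ s).Nonempty := by
      by_contra hcon
      rw [not_nonempty_iff_eq_empty, ← disjoint_iff_inter_eq_empty] at hcon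
      refine hAP (?_ : A ∈ P)
      rwa [subset_antisymm hAB fun z hz => (mem_union.1 (hP.subset hB hz)).resolve_right
        (disjoint_left.1 hcon hz)]
    obtain ⟨c, hc⟩ : ∃ c, c = (B ∩ s).min' hne := ⟨_, rfl⟩
    have hcm : c ∈ B ∩ s := hc ▸ min'_mem _ _
    have hmin : ∀ z ∈ B, z ∈ s → c ≤ z := fun z h1 h2 => hc ▸ min'_le _ _ (mem_inter.2 ⟨h1, h2⟩)
    rw [mem_inter] at hcm
    rw [if_neg hAP, zero_add, sum_eq_single_of_mem c hcm.2, if_pos]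
    · exact ⟨B, hB, insert_subset hcm.1 hAB, hmin⟩
    · intro c' hc' hcc
      rw [if_neg]
      rintro ⟨C, hC, hcC, hm⟩
      obtain rfl := huniq C hC ((subset_insert c' A).trans hcC)
      exact hcc (le_antisymm (hm c hcm.1 hcm.2) (hmin c' (hcC (mem_insert_self _ _)) hc'))

theorem sum_extendingFamilies_block {d : ℕ} {A s : Finset ℕ} (hne : A.Nonempty)
    (hA : ∀ a ∈ A, ∀ z ∈ s, a < z) (hg : GoodSet d A) :
    ∑ P ∈ extendingFamilies d A s with A ∈ P, familyWeight d P =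
      if d ∣ #A - 1 then blockWeight d (#A - 1) * ∑ P ∈ goodFamilies d s, familyWeight d P
      else 0 := by
  have hcard : ((#A : ℕ) : ZMod d) = 1 ↔ d ∣ #A - 1 := by
    rw [← ZMod.natCast_eq_zero_iff, Nat.cast_sub hne.card_pos, Nat.cast_one, sub_eq_zero]
  have hdisj : Disjoint A s := disjoint_left.2 fun z h1 h2 => lt_irrefl z (hA z h1 z h2)
  split_ifs with hc
  · have h1 : blockWeight d (#A - 1) = ∑ P ∈ {{A}}, familyWeight d P := by
      rw [sum_singleton, familyWeight, prod_singleton]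
    have hAg : IsGoodFamily d A {A} :=
      { nonempty := fun B hB => by rwa [mem_singleton.1 hB]
        eq_of_mem := fun B hB C hC x _ _ => (mem_singleton.1 hB).trans (mem_singleton.1 hC).symm
        mem_iff := fun x => by simp
        noncrossing := fun B hB C hC _ _ _ _ _ _ _ _ _ _ _ =>
          (mem_singleton.1 hB).trans (mem_singleton.1 hC).symm
        card := fun B hB => by rw [mem_singleton.1 hB]; exact hcard.2 hc
        good := fun B hB => by rwa [mem_singleton.1 hB] }
    have hsub : ∀ P, IsGoodFamily d (A ∪ s) P → A ∈ P → ∀ B ∈ P, B = A ∨ B ⊆ s := by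
      intro P hP hAP B hB
      by_contra! hcon
      obtain ⟨x, hx, hxs⟩ := not_subset.1 hcon.2
      exact hcon.1 (hP.eq_of_mem B hB A hAP x hx
        ((mem_union.1 (hP.subset hB hx)).resolve_right hxs))
    rw [h1]
    refine sum_familyWeight_mul hdisj ?_ ?_ ?_ ?_ ?_ ?_
    · intro P hP B hB
      rw [mem_singleton.1 hP, mem_singleton] at hB
      subst hB
      exact ⟨hne, subset_rfl⟩
    · intro P hP B hB
      have := mem_goodFamilies.1 hP
      exact ⟨this.nonempty B hB, this.subset hB⟩
    · intro P hP B hB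
      simp only [mem_filter, mem_extendingFamilies] at hP
      exact (hsub P hP.1.1 hP.2 B hB).imp (fun h => h.subset) id
    · intro P₁ hP₁ P₂ hP₂
      rw [mem_singleton.1 hP₁, mem_filter, mem_extendingFamilies]
      have hmem : A ∈ {A} ∪ P₂ := mem_union_left _ (mem_singleton_self A)
      have h2 := mem_goodFamilies.1 hP₂
      refine ⟨⟨hAg.union hdisj h2 ?_, A, hmem, subset_rfl⟩, hmem⟩
      intro B hB C hC i j k l hij hjk hkl
      rw [mem_singleton] at hB
      subst hB
      refine ⟨fun ⟨_, hj, hk, _⟩ => ?_, fun ⟨hi, hj, _, _⟩ => ?_⟩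
      · exact absurd (hA k hk j (h2.subset hC hj)) (by omega)
      · exact absurd (hA j hj i (h2.subset hC hi)) (by omega)
    · intro P hP
      simp only [mem_filter, mem_extendingFamilies] at hP
      rw [mem_singleton]
      ext B
      rw [mem_filter, mem_singleton]
      constructor
      · rintro ⟨hB, hBA⟩
        obtain ⟨x, hx⟩ := hP.1.1.nonempty B hB
        exact hP.1.1.eq_of_mem B hB A hP.2 x hx (hBA hx)
      · rintro rfl
        exact ⟨hP.2, subset_rfl⟩
    · intro P hP
      simp only [mem_filter, mem_extendingFamilies] at hP
      refine mem_goodFamilies.2 (hP.1.1.restrict subset_union_right fun B hB x hx hxs => ?_)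
      refine (hsub P hP.1.1 hP.2 B hB).resolve_left ?_
      rintro rfl
      exact disjoint_left.1 hdisj hx hxs
  · refine sum_eq_zero fun P hP => ?_
    simp only [mem_filter, mem_extendingFamilies] at hP
    exact absurd (hcard.1 (hP.1.1.card A hP.2)) hc

/-- The elements of `s` below `c` lie between two neighbours of one block, so noncrossing makes them
a union of blocks, independent of the rest. Goodness of the block and of `A ∪ s` forces their number
to be divisible by `d`. -/
theorem sum_extendingFamilies_insert {d : ℕ} {A s : Finset ℕ} (hne : A.Nonempty)
    (hA : ∀ a ∈ A, ∀ z ∈ s, a < z) (hg : GoodSet d (A ∪ s)) {c : ℕ} (hc : c ∈ s) :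
    ∑ P ∈ extendingFamilies d A s with ∃ B ∈ P, insert c A ⊆ B ∧ ∀ z ∈ B, z ∈ s → c ≤ z,
        familyWeight d P =
      if d ∣ #{z ∈ s | z < c} then
        (∑ P ∈ goodFamilies d {z ∈ s | z < c}, familyWeight d P) *
          ∑ P ∈ extendingFamilies d (insert c A) {z ∈ s | c < z}, familyWeight d P
      else 0 := by
  split_ifs with hdvd
  · have htu : {z ∈ s | z < c} ∪ (insert c A ∪ {z ∈ s | c < z}) = A ∪ s := by
      ext z
      simp only [mem_union, mem_insert, mem_filter]
      constructor
      · rintro (h | (rfl | h) | h)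
        · exact Or.inr h.1
        · exact Or.inr hc
        · exact Or.inl h
        · exact Or.inr h.1
      · rintro (h | h)
        · exact Or.inr (Or.inl (Or.inr h))
        · rcases lt_trichotomy z c with h' | h' | h'
          · exact Or.inl ⟨h, h'⟩
          · exact Or.inr (Or.inl (Or.inl h'))
          · exact Or.inr (Or.inr ⟨h, h'⟩)
    have hsep : ∀ z ∈ insert c A ∪ {z ∈ s | c < z}, c ≤ z ∨ ∀ x ∈ s, z < x := by
      intro z hz
      simp only [mem_union, mem_insert, mem_filter] at hz
      rcases hz with (rfl | h) | h
      · exact Or.inl le_rfl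
      · exact Or.inr (hA z h)
      · exact Or.inl h.2.le
    have hdisj : Disjoint ({z ∈ s | z < c} : Finset ℕ) (insert c A ∪ {z ∈ s | c < z}) := by
      refine disjoint_left.2 fun z h1 h2 => ?_
      rw [mem_filter] at h1
      rcases hsep z h2 with h | h
      · omega
      · exact lt_irrefl z (h z h1.1)
    have hblock : ∀ P, IsGoodFamily d (A ∪ s) P →
        (∃ B ∈ P, insert c A ⊆ B ∧ ∀ z ∈ B, z ∈ s → c ≤ z) →
        ∀ B ∈ P, B ⊆ {z ∈ s | z < c} ∨ B ⊆ insert c A ∪ {z ∈ s | c < z} := by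
      rintro P hP ⟨C, hC, hcC, hm⟩ B hB
      obtain ⟨a, ha⟩ := hne
      by_contra! hcon
      obtain ⟨x, hx, hx'⟩ := not_subset.1 hcon.1
      obtain ⟨y, hy, hy'⟩ := not_subset.1 hcon.2
      have hy2 : y ∈ s ∧ y < c := by
        have := hP.subset hB hy
        rw [← htu, mem_union] at this
        exact mem_filter.1 (this.resolve_right hy')
      have hBC : B ≠ C := by
        rintro rfl
        exact absurd (hm y hy hy2.1) (by omega)
      have hx2 : x ∈ s ∧ c < x := by
        have := hP.subset hB hx
        rw [← htu, mem_union, or_iff_right hx', mem_union, mem_insert, mem_filter] at this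
        rcases this with (rfl | h) | h
        · exact absurd (hP.eq_of_mem B hB C hC x hx (hcC (mem_insert_self x A))) hBC
        · exact absurd (hP.eq_of_mem B hB C hC x hx (hcC (mem_insert_of_mem h))) hBC
        · exact h
      exact hBC (hP.noncrossing C hC B hB a y c x (hcC (mem_insert_of_mem ha)) hy
        (hcC (mem_insert_self c A)) hx (hA a ha y hy2.1) hy2.2 hx2.2).symm
    refine sum_familyWeight_mul hdisj ?_ ?_ ?_ ?_ ?_ ?_
    · intro P hP B hB
      have := mem_goodFamilies.1 hP
      exact ⟨this.nonempty B hB, this.subset hB⟩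
    · intro P hP B hB
      have := (mem_extendingFamilies.1 hP).1
      exact ⟨this.nonempty B hB, this.subset hB⟩
    · intro P hP
      rw [mem_filter, mem_extendingFamilies] at hP
      exact hblock P hP.1.1 hP.2
    · intro P₁ hP₁ P₂ hP₂
      rw [mem_goodFamilies] at hP₁
      obtain ⟨hP₂, B, hB, hcB⟩ := mem_extendingFamilies.1 hP₂
      have hB' : B ∈ P₁ ∪ P₂ := mem_union_right _ hB
      rw [mem_filter, mem_extendingFamilies, ← htu]
      refine ⟨⟨hP₁.union hdisj hP₂ ?_, B, hB', (subset_insert c A).trans hcB⟩, B, hB', hcB, ?_⟩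
      · have key : ∀ i ∈ ({z ∈ s | z < c} : Finset ℕ), ∀ k ∈ ({z ∈ s | z < c} : Finset ℕ),
            ∀ j ∈ insert c A ∪ {z ∈ s | c < z}, ¬ (i < j ∧ j < k) := by
          intro i hi k hk j hj
          rw [mem_filter] at hi hk
          rcases hsep j hj with h | h
          · omega
          · have := h i hi.1
            omega
        intro C hC D hD i j k l hij hjk hkl
        exact ⟨fun ⟨hi, hj, hk, _⟩ => key i (hP₁.subset hC hi) k (hP₁.subset hC hk) j
            (hP₂.subset hD hj) ⟨hij, hjk⟩,
          fun ⟨_, hj, hk, hl⟩ => key j (hP₁.subset hC hj) l (hP₁.subset hC hl) k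
            (hP₂.subset hD hk) ⟨hjk, hkl⟩⟩
      · intro z hz hzs
        rcases hsep z (hP₂.subset hB hz) with h | h
        · exact h
        · exact absurd (h z hzs) (lt_irrefl z)
    · intro P hP
      rw [mem_filter, mem_extendingFamilies] at hP
      refine mem_goodFamilies.2 (hP.1.1.restrict (htu ▸ subset_union_left) fun B hB x hx hx' => ?_)
      exact (hblock P hP.1.1 hP.2 B hB).resolve_right fun h => disjoint_left.1 hdisj hx' (h hx)
    · intro P hP
      rw [mem_filter, mem_extendingFamilies] at hP
      obtain ⟨B, hB, hcB, hm⟩ := hP.2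
      refine mem_extendingFamilies.2
        ⟨hP.1.1.restrict (htu ▸ subset_union_right) fun B hB x hx hx' => ?_, B, ?_, hcB⟩
      · exact (hblock P hP.1.1 hP.2 B hB).resolve_left fun h => disjoint_left.1 hdisj (h hx) hx'
      · refine mem_filter.2 ⟨hB, (hblock P hP.1.1 hP.2 B hB).resolve_left fun h => ?_⟩
        have := (mem_filter.1 (h (hcB (mem_insert_self c A)))).2
        omega
  · refine sum_eq_zero fun P hP => absurd ?_ hdvd
    rw [mem_filter, mem_extendingFamilies] at hP
    obtain ⟨⟨hP, -⟩, B, hB, hcB, hm⟩ := hP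
    obtain ⟨a, ha⟩ : ∃ a, a = A.max' hne := ⟨_, rfl⟩
    have haA : a ∈ A := ha ▸ max'_mem _ _
    have hac := hA a haA c hc
    have hcons := (hP.good B hB).consecutive (hcB (mem_insert_of_mem haA))
      (hcB (mem_insert_self c A)) hac fun z hz hz' => by
        rcases mem_union.1 (hP.subset hB hz) with h | h
        · have := le_max' A z h
          omega
        · have := hm z hz h
          omega
    have h1 := hg a (mem_union_left _ haA) c (mem_union_right _ hc) hac.le
    have h2 : ({z ∈ A ∪ s | a ≤ z ∧ z < c} : Finset ℕ) = insert a {z ∈ s | z < c} := by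
      ext z
      simp only [mem_filter, mem_union, mem_insert]
      constructor
      · rintro ⟨h | h, h'⟩
        · have := le_max' A z h
          exact Or.inl (by omega)
        · exact Or.inr ⟨h, h'.2⟩
      · rintro (rfl | h)
        · exact ⟨Or.inl haA, le_rfl, hac⟩
        · exact ⟨Or.inr h.1, (hA a haA z h.1).le, h.2⟩
    rw [h2, card_insert_of_notMem fun h => lt_irrefl a (hA a haA a (mem_filter.1 h).1),
      Nat.cast_add, Nat.cast_one, hcons] at h1
    rw [← ZMod.natCast_eq_zero_iff]
    linear_combination h1

/-- Reindexing by rank: the numbers of smaller elements run through `0, …, #s - 1`. -/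
theorem sum_card_filter_lt {M : Type*} [AddCommMonoid M] (s : Finset ℕ) (φ : ℕ → M) :
    ∑ c ∈ s, φ #{z ∈ s | z < c} = ∑ g ∈ range #s, φ g := by
  induction s using Finset.induction_on_max with
  | empty => simp
  | insert m s hm ih =>
    have hms : m ∉ s := fun h => lt_irrefl m (hm m h)
    rw [sum_insert hms, card_insert_of_notMem hms, sum_range_succ, add_comm, ← ih]
    congr 1
    · refine sum_congr rfl fun c hc => ?_
      rw [filter_insert, if_neg (by have := hm c hc; omega)]
    · rw [filter_insert, if_neg (lt_irrefl m), filter_true_of_mem hm]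

theorem card_filter_gt {s : Finset ℕ} {c : ℕ} (hc : c ∈ s) :
    #{z ∈ s | c < z} = #s - 1 - #{z ∈ s | z < c} := by
  have h1 : s = insert c ({z ∈ s | z < c} ∪ {z ∈ s | c < z}) := by
    ext z
    simp only [mem_insert, mem_union, mem_filter]
    constructor
    · intro hz
      rcases lt_trichotomy z c with h | h | h
      · exact Or.inr (Or.inl ⟨hz, h⟩)
      · exact Or.inl h
      · exact Or.inr (Or.inr ⟨hz, h⟩)
    · rintro (rfl | h | h)
      · exact hc
      · exact h.1
      · exact h.1
  have h2 : #s = #{z ∈ s | z < c} + #{z ∈ s | c < z} + 1 := by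
    conv_lhs => rw [h1]
    rw [card_insert_of_notMem (by simp), card_union_of_disjoint]
    exact disjoint_left.2 fun z hz hz' => by
      rw [mem_filter] at hz hz'
      omega
  omega

theorem sum_goodFamilies_empty (d : ℕ) : ∑ P ∈ goodFamilies d ∅, familyWeight d P = 1 := by
  have : goodFamilies d ∅ = {∅} := by
    ext P
    rw [mem_goodFamilies, mem_singleton]
    constructor
    · intro h
      rw [eq_empty_iff_forall_notMem]
      intro B hB
      obtain ⟨x, hx⟩ := h.nonempty B hB
      exact absurd (h.subset hB hx) (notMem_empty x)
    · rintro rfl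
      constructor
      · constructor <;> simp
      · simp
      · simp
  rw [this, sum_singleton, familyWeight, prod_empty]

open PowerSeries

/-- The two sums determine each other recursively: a family on a nonempty set extends the singleton
of its minimum, and a partial block is either closed or extended past a gap. The two series satisfy
the same recursions, so the claims are proved together; goodness is what makes the sums depend on
sizes only. -/
theorem sum_families_eq_coeff {d : ℕ} (hd : 0 < d) (n : ℕ) :
    (∀ s : Finset ℕ, #s = n → GoodSet d s →
      ∑ P ∈ goodFamilies d s, familyWeight d P = coeff n (familySeries hd)) ∧
    ∀ A s : Finset ℕ, A.Nonempty → #s = n → (∀ a ∈ A, ∀ z ∈ s, a < z) → GoodSet d (A ∪ s) →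
      ∑ P ∈ extendingFamilies d A s, familyWeight d P = coeff n (partialSeries hd (#A - 1)) := by
  induction n using Nat.strong_induction_on with
  | _ n ih =>
  have hW : ∀ s : Finset ℕ, #s = n → GoodSet d s →
      ∑ P ∈ goodFamilies d s, familyWeight d P = coeff n (familySeries hd) := by
    intro s hs hg
    rcases n with _ | n
    · rw [card_eq_zero.1 hs, sum_goodFamilies_empty, familySeries_eq, map_add,
        coeff_zero_X_mul, coeff_zero_one, add_zero]
    · have hne : s.Nonempty := card_pos.1 (by omega)
      obtain ⟨m, hm⟩ : ∃ m, m = s.min' hne := ⟨_, rfl⟩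
      have hms : m ∈ s := hm ▸ min'_mem _ _
      have hun : {m} ∪ s.erase m = s := by
        rw [← insert_eq, insert_erase hms]
      have h := (ih n (Nat.lt_succ_self n)).2 {m} (s.erase m) (singleton_nonempty m)
        (by rw [card_erase_of_mem hms, hs, Nat.add_sub_cancel])
        (fun a ha z hz => by
          rw [mem_singleton] at ha
          rw [mem_erase] at hz
          have := min'_le s z hz.2
          omega) (by rwa [hun])
      have hext : extendingFamilies d {m} (s.erase m) = goodFamilies d s := by
        rw [extendingFamilies, hun, filter_true_of_mem]
        intro P hP
        obtain ⟨B, hB, hmB⟩ := ((mem_goodFamilies.1 hP).mem_iff m).1 hms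
        exact ⟨B, hB, singleton_subset_iff.2 hmB⟩
      rw [hext, card_singleton] at h
      rw [h, familySeries_eq, map_add, coeff_succ_X_mul, coeff_one, if_neg (Nat.succ_ne_zero n),
        zero_add]
  refine ⟨hW, fun A s hne hs hA hg => ?_⟩
  have hgA : GoodSet d A := hg.of_convex subset_union_left fun x _ y hy z hz _ hzy =>
    (mem_union.1 hz).resolve_right fun h => by
      have := hA y hy z h
      omega
  have hgs : GoodSet d s := hg.of_convex subset_union_right fun x hx y _ z hz hxz _ =>
    (mem_union.1 hz).resolve_left fun h => by
      have := hA z h x hx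
      omega
  rw [sum_extendingFamilies hne hA, sum_extendingFamilies_block hne hA hgA, hW s hs hgs,
    partialSeries_eq, map_add]
  congr 1
  · split_ifs
    · rw [coeff_C_mul]
    · rw [map_zero]
  rcases n with _ | n
  · rw [card_eq_zero.1 hs, sum_empty, coeff_zero_X_mul]
  rw [coeff_succ_X_mul, coeff_mul, Nat.sum_antidiagonal_eq_sum_range_succ_mk,
    Nat.succ_eq_add_one, ← hs]
  refine Eq.trans ?_ (sum_card_filter_lt s _)
  refine sum_congr rfl fun c hc => ?_
  have hlt : #{z ∈ s | z < c} < n + 1 := by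
    rw [← hs]
    exact card_lt_card (filter_ssubset.2 ⟨c, hc, lt_irrefl c⟩)
  have hcA : c ∉ A := fun h => lt_irrefl c (hA c h c hc)
  rw [sum_extendingFamilies_insert hne hA hg hc]
  split_ifs with hdvd
  · have hgl : GoodSet d {z ∈ s | z < c} := hgs.of_convex (filter_subset _ _)
      fun x _ y hy z hz _ hzy => by
        rw [mem_filter] at hy ⊢
        exact ⟨hz, by omega⟩
    rw [(ih _ hlt).1 _ rfl hgl, coeff_familySeries_of_dvd hd hdvd]
    have hgt := card_filter_gt hc
    rw [(ih #{z ∈ s | c < z} (by omega)).2 (insert c A) _ (insert_nonempty c A) rfl ?_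
      (hg.remove_gap hA hc hdvd), card_insert_of_notMem hcA]
    · have := hne.card_pos
      rw [show #A + 1 - 1 = #A - 1 + 1 by omega, show n - #{z ∈ s | z < c} = #{z ∈ s | c < z} by omega]
    · intro a ha z hz
      rw [mem_filter] at hz
      rcases mem_insert.1 ha with rfl | ha
      · exact hz.2
      · exact hA a ha z hz.1
  · rw [coeff_kInv_of_not_dvd hd hdvd, zero_mul]

/-- The signed sum over the good families of a good set vanishes unless the set is a singleton. -/
theorem sum_goodFamilies_eq {d : ℕ} (hd : 0 < d) {s : Finset ℕ} (hne : s.Nonempty)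
    (hc : ((#s : ℕ) : ZMod d) = 1) (hg : GoodSet d s) :
    ∑ P ∈ goodFamilies d s, familyWeight d P = if #s = 1 then 1 else 0 := by
  have h1 := hne.card_pos
  have hdvd : d ∣ #s - 1 := by
    rw [← ZMod.natCast_eq_zero_iff, Nat.cast_sub h1, Nat.cast_one, hc, sub_self]
  have h2 := coeff_familySeries_succ hd hdvd
  rw [Nat.sub_add_cancel h1] at h2
  rw [(sum_families_eq_coeff hd #s).1 s rfl hg, h2]
  exact if_congr (by omega) rfl rfl

end IndivNC

/-! ### The Möbius function -/

namespace IndivNC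

/-- The good families that refine the family `Q`. -/
noncomputable def refiningFamilies (d : ℕ) (Q : Finset (Finset ℕ)) : Finset (Finset (Finset ℕ)) :=
  {P ∈ goodFamilies d (Q.sup id) | ∀ B ∈ P, ∃ C ∈ Q, B ⊆ C}

theorem mem_refiningFamilies {d : ℕ} {Q P : Finset (Finset ℕ)} :
    P ∈ refiningFamilies d Q ↔ IsGoodFamily d (Q.sup id) P ∧ ∀ B ∈ P, ∃ C ∈ Q, B ⊆ C := by
  rw [refiningFamilies, mem_filter, mem_goodFamilies]

/-- A refinement is an independent choice of a good family on each block: blocks inside different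
blocks of a noncrossing family cannot cross. The ambient family `R` stays fixed while the induction
runs over its subsets `Q`. -/
theorem sum_refiningFamilies {d : ℕ} {s : Finset ℕ} {R : Finset (Finset ℕ)} (hR : IsNCFamily s R)
    (Q : Finset (Finset ℕ)) (hQ : Q ⊆ R) :
    ∑ P ∈ refiningFamilies d Q, familyWeight d P =
      ∏ S ∈ Q, ∑ P ∈ goodFamilies d S, familyWeight d P := by
  induction Q using Finset.induction_on with
  | empty =>
    rw [prod_empty, ← sum_goodFamilies_empty d, refiningFamilies, sup_empty]
    rw [filter_true_of_mem]
    · rfl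
    · intro P hP B hB
      have h := mem_goodFamilies.1 hP
      obtain ⟨x, hx⟩ := h.nonempty B hB
      exact absurd (h.subset hB hx) (notMem_empty x)
  | insert S Q hSQ ih =>
    have hSR : S ∈ R := hQ (mem_insert_self S Q)
    have hQR : Q ⊆ R := (subset_insert S Q).trans hQ
    have hsup : (insert S Q).sup id = S ∪ Q.sup id := sup_insert
    have hmem : ∀ {x}, x ∈ Q.sup id ↔ ∃ C ∈ Q, x ∈ C := by
      intro x
      rw [mem_sup]
      rfl
    have hdisj : Disjoint S (Q.sup id) := disjoint_left.2 fun x hx hx' => by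
      obtain ⟨C, hC, hxC⟩ := hmem.1 hx'
      exact hSQ (hR.eq_of_mem S hSR C (hQR hC) x hx hxC ▸ hC)
    have hblock : ∀ P ∈ refiningFamilies d (insert S Q), ∀ B ∈ P, B ⊆ S ∨ B ⊆ Q.sup id := by
      intro P hP B hB
      obtain ⟨C, hC, hBC⟩ := (mem_refiningFamilies.1 hP).2 B hB
      rcases mem_insert.1 hC with rfl | hC
      · exact Or.inl hBC
      · exact Or.inr fun x hx => hmem.2 ⟨C, hC, hBC hx⟩
    rw [prod_insert hSQ, ← ih hQR]
    refine sum_familyWeight_mul hdisj ?_ ?_ hblock ?_ ?_ ?_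
    · intro P hP B hB
      have := mem_goodFamilies.1 hP
      exact ⟨this.nonempty B hB, this.subset hB⟩
    · intro P hP B hB
      have := (mem_refiningFamilies.1 hP).1
      exact ⟨this.nonempty B hB, this.subset hB⟩
    · intro P₁ hP₁ P₂ hP₂
      have h₁ := mem_goodFamilies.1 hP₁
      obtain ⟨h₂, h₂'⟩ := mem_refiningFamilies.1 hP₂
      rw [mem_refiningFamilies, hsup]
      refine ⟨h₁.union hdisj h₂ ?_, ?_⟩
      · intro B hB C hC i j k l hij hjk hkl
        obtain ⟨D, hD, hCD⟩ := h₂' C hC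
        have hne : S ≠ D := by
          rintro rfl
          exact hSQ hD
        exact ⟨fun ⟨hi, hj, hk, hl⟩ => hne (hR.noncrossing S hSR D (hQR hD) i j k l
            (h₁.subset hB hi) (hCD hj) (h₁.subset hB hk) (hCD hl) hij hjk hkl),
          fun ⟨hi, hj, hk, hl⟩ => hne (hR.noncrossing D (hQR hD) S hSR i j k l
            (hCD hi) (h₁.subset hB hj) (hCD hk) (h₁.subset hB hl) hij hjk hkl).symm⟩
      · intro B hB
        rcases mem_union.1 hB with hB | hB
        · exact ⟨S, mem_insert_self S Q, h₁.subset hB⟩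
        · obtain ⟨C, hC, hBC⟩ := h₂' B hB
          exact ⟨C, mem_insert_of_mem hC, hBC⟩
    · intro P hP
      have h := (mem_refiningFamilies.1 hP).1
      rw [hsup] at h
      refine mem_goodFamilies.2 (h.restrict subset_union_left fun B hB x hx hx' => ?_)
      exact (hblock P hP B hB).resolve_right fun h' => disjoint_left.1 hdisj hx' (h' hx)
    · intro P hP
      obtain ⟨h, h'⟩ := mem_refiningFamilies.1 hP
      rw [hsup] at h
      refine mem_refiningFamilies.2 ⟨h.restrict subset_union_right fun B hB x hx hx' =>
        (hblock P hP B hB).resolve_left fun h' => disjoint_left.1 hdisj (h' hx) hx', ?_⟩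
      intro B hB
      obtain ⟨hB, hBQ⟩ := mem_filter.1 hB
      obtain ⟨C, hC, hBC⟩ := h' B hB
      rcases mem_insert.1 hC with rfl | hC
      · obtain ⟨x, hx⟩ := h.nonempty B hB
        exact absurd (hBQ hx) (disjoint_left.1 hdisj (hBC hx))
      · exact ⟨C, hC, hBC⟩

theorem sum_Iic_familyWeight {d k : ℕ} (hd : 0 < d) (σ : NC d (d * k + 1)) :
    ∑ π ∈ Icc ⊥ σ, familyWeight d π.1.parts = if ⊥ = σ then 1 else 0 := by
  have hn : ((d * k + 1 : ℕ) : ZMod d) = 1 := natCast_mul_add_one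
  have hσ := (isIndivisible_iff hn σ.1).1 σ.2
  have h1 : ∑ π ∈ Icc ⊥ σ, familyWeight d π.1.parts =
      ∑ P ∈ refiningFamilies d σ.1.parts, familyWeight d P := by
    refine sum_bij (fun π _ => π.1.parts) ?_ ?_ ?_ ?_
    · intro π hπ
      have h := (isIndivisible_iff hn π.1).1 π.2
      rw [mem_refiningFamilies, σ.1.sup_parts]
      exact ⟨h, fun B hB => (mem_Icc.1 hπ).2 hB⟩
    · intro π _ ρ _ h
      exact Subtype.ext (Finpartition.ext h)
    · intro P hP
      rw [mem_refiningFamilies, σ.1.sup_parts] at hP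
      exact ⟨⟨hP.1.toIsNCFamily.toFinpartition, (isIndivisible_iff hn _).2 hP.1⟩,
        mem_Icc.2 ⟨bot_le, fun B hB => hP.2 B hB⟩, rfl⟩
    · intro π _
      rfl
  rw [h1, sum_refiningFamilies hσ.toIsNCFamily _ subset_rfl, prod_congr rfl fun S hS =>
    sum_goodFamilies_eq hd (hσ.nonempty S hS) (hσ.card S hS) (hσ.good S hS)]
  split_ifs with h
  · refine prod_eq_one fun S hS => if_pos ?_
    subst h
    obtain ⟨a, -, rfl⟩ := Finpartition.mem_bot_iff.1 hS
    exact card_singleton a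
  · by_contra hcon
    refine h (le_antisymm bot_le fun S hS => ?_)
    have hS1 : #S = 1 := by
      by_contra hS1
      exact hcon (prod_eq_zero hS (if_neg hS1))
    obtain ⟨a, rfl⟩ := card_eq_one.1 hS1
    exact ⟨{a}, Finpartition.mem_bot_iff.2 ⟨a, hσ.subset hS (mem_singleton_self a), rfl⟩, subset_rfl⟩

/-- By `sum_Iic_familyWeight` the weight satisfies the recursion over lower intervals that
determines `μ(0̂, ·)`. -/
theorem mu_bot_eq_familyWeight {d k : ℕ} (hd : 0 < d) (σ : NC d (d * k + 1)) :
    IncidenceAlgebra.mu ℤ (⊥ : NC d (d * k + 1)) σ = familyWeight d σ.1.parts := by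
  classical
  induction σ using WellFoundedLT.induction with
  | ind σ ih =>
  have h1 := IncidenceAlgebra.sum_Icc_mu_right (𝕜 := ℤ) (⊥ : NC d (d * k + 1)) σ
  have h2 := sum_Iic_familyWeight hd σ
  rw [Icc_eq_cons_Ico bot_le, sum_cons] at h1 h2
  have h3 := sum_congr (s₁ := Ico ⊥ σ) rfl fun ρ hρ => ih ρ (mem_Ico.1 hρ).2
  rw [h3] at h1
  split_ifs at h1 h2 <;> linarith

theorem abs_mu_bot_top {d : ℕ} (hd : 0 < d) (k : ℕ) :
    |IncidenceAlgebra.mu ℤ (⊥ : NC d (d * k + 1)) ⊤| = raney (2 * d) k 1 := by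
  have h : (⊤ : NC d (d * k + 1)).1.parts = {Icc 1 (d * k + 1)} := rfl
  rw [mu_bot_eq_familyWeight hd, h, familyWeight, prod_singleton, Nat.card_Icc,
    Nat.add_sub_cancel, Nat.add_sub_cancel, blockWeight, Nat.mul_div_cancel_left _ hd, abs_mul,
    abs_pow, abs_neg, abs_one, one_pow, one_mul, Nat.abs_cast]

end IndivNC

theorem mainTheorem10 (d k : ℕ) (hd : 0 < d) :
    ((IndivNC.restrictedParkingFunctions d k).ncard : ℚ) =
        ((2 * d * k).choose k : ℚ) / (2 * d * k - k + 1) ∧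
      Set.BijOn IndivNC.chainLabels
        {c : IndivNC.MaximalChain (IndivNC.NC d (d * k + 1)) | IndivNC.IsFalling c}
        (IndivNC.restrictedParkingFunctions d k) ∧
      ((IndivNC.restrictedParkingFunctions d k).ncard : ℤ) =
        |IncidenceAlgebra.mu ℤ (⊥ : IndivNC.NC d (d * k + 1)) (⊤ : IndivNC.NC d (d * k + 1))| := by
  have h : (IndivNC.restrictedParkingFunctions d k).ncard = IndivNC.raney (2 * d) k 1 := by
    rw [IndivNC.restrictedParkingFunctions_eq hd, Set.ncard_coe_finset,
      IndivNC.card_parkingWords hd]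
  refine ⟨?_, IndivNC.bijOn_chainLabels hd, ?_⟩
  · rw [h, IndivNC.raney_one (by omega)]
    push_cast
    rfl
  · rw [h, IndivNC.abs_mu_bot_top hd]
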